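/- **Theorem (additive quantum approximation of a tensor network).** Let $G=(V,E)$ be a finite graph with $V\neq\emptyset$ (parallel edges allowed, no loops) of maximal degree $d$. A tensor network $T(G,\mathcal M)$ of dimension $q$ assigns to every vertex $v$ a complex tensor $M_v$ with one index in $\{0,\dots,q-1\}$ for each edge at $v$; its value is $$T(G,\mathcal M)=\sum_{l:E\to\{0,\dots,q-1\}}\ \prod_{v\in V}M_v(l),$$ where $M_v(l)$ is the entry of $M_v$ whose indices are the labels $l(e)$ of the edges $e$ at $v$. A bubbling is an ordering $v_1,\dots,v_n$ of all the vertices. Let $Z_i$ be the set of edges with exactly one end in $\{v_1,\dots,v_i\}$, and $H=\mathbb C^q$. In the $i$-th step let $K$ and $L$ be the sets of edges at $v_i$ that lie in $Z_{i-1}$ and in $Z_i$ respectively, and let $J$ be the set of edges in $Z_{i-1}$ not at $v_i$. The swallowing operator is $$\mathcal O_{v_i}=\mathbb 1_J\otimes M_{v_i}^{K,L}:\ H^{\otimes Z_{i-1}}\to H^{\otimes Z_i},$$ where $M_{v_i}^{K,L}:H^{\otimes K}\to H^{\otimes L}$ is the linear map whose matrix entries are the entries of $M_{v_i}$. Put $\Delta=\prod_{v\in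 V}\|\mathcal O_v\|$ (operator norms). There are a quantum algorithm and a polynomial $p$ such that the following holds for all $q$, all $G$, all tensor networks $T(G,\mathcal M)$ of dimension $q$ on $G$, all bubblings with $\Delta>0$, and all $\varepsilon>0$. Given the network, the bubbling and $\varepsilon$, the algorithm halts after at most $$|V|\cdot\lceil\varepsilon^{-2}\rceil\cdot p(q^d)$$ time steps and outputs a complex number $r$ with $$\Pr\big(|T(G,\mathcal M)-r|\ge\varepsilon\Delta\big)\le\tfrac14 .$$ Here a quantum algorithm is a program of a random access machine with index arithmetic, exact complex arithmetic (field operations, conjugation, comparison of real parts, square roots, and the largest real root of a real polynomial), and a register of qubits, initially $|0\rangle$. On the register it can apply one-qubit unitary gates with entries computed in its memory, optionally controlled by a bounded number of qubits, measure a qubit, and take a fresh register. Each such operation takes one time step, except that finding a root of a polynomial given by $k+1$ coefficients takes $k+1$ steps. -/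

import Mathlib

open scoped NNReal ENNReal

noncomputable section

/-! ### Tensor networks, bubblings and swallowing operators -/

/-- A tensor network of dimension `q` on a graph with vertex set `V` and edge set `E`.
Parallel edges are allowed, loops are not. The order of the two ends of an edge plays no role.
The tensor at `v` has one index, with values in `Fin q`, for every edge at `v`. -/
structure TensorNetwork (V E : Type) [Fintype E] [DecidableEq V] (q : ℕ) where
  end₁ : E → V
  end₂ : E → V
  loopless : ∀ e, end₁ e ≠ end₂ e
  tensor : ∀ v : V,
    ({e : E // e ∈ Finset.univ.filter (fun e => end₁ e = v ∨ end₂ e = v)} → Fin q) → ℂ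

namespace TensorNetwork

section Graph

variable {V E : Type} [Fintype E] [DecidableEq V] {q : ℕ} (N : TensorNetwork V E q)

/-- The edges at the vertex `v`. -/
def edgesAt (v : V) : Finset E :=
  Finset.univ.filter (fun e => N.end₁ e = v ∨ N.end₂ e = v)

def degree (v : V) : ℕ := (N.edgesAt v).card

def maxDegree [Fintype V] : ℕ := Finset.univ.sup N.degree

/-- The value `∑_l ∏_v M_v(l)` of the network; `l` runs over the labelings of the edges. -/
def value [Fintype V] [DecidableEq E] : ℂ :=
  ∑ l : E → Fin q, ∏ v : V, N.tensor v (fun e => l e)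

/-! A bubbling is an ordering `B 0, B 1, …, B (n - 1)` of all the vertices. -/

variable {n : ℕ} (B : Fin n ≃ V)

/-- `v` is one of the first `i` vertices of the bubbling. -/
def Swallowed (i : ℕ) (v : V) : Prop := (B.symm v : ℕ) < i

instance (i : ℕ) : DecidablePred (Swallowed B i) :=
  fun v => inferInstanceAs (Decidable ((B.symm v : ℕ) < i))

/-- The edges with exactly one end among the first `i` vertices. -/
def cut (i : ℕ) : Finset E :=
  Finset.univ.filter (fun e => ¬ (Swallowed B i (N.end₁ e) ↔ Swallowed B i (N.end₂ e)))

variable [DecidableEq E]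

/-- Input edges of the step that swallows `B i`. -/
def inEdges (i : Fin n) : Finset E := N.cut B i ∩ N.edgesAt (B i)

/-- Output edges of the step that swallows `B i`. -/
def outEdges (i : Fin n) : Finset E := N.cut B (i + 1) ∩ N.edgesAt (B i)

/-- Edges untouched by the step that swallows `B i`. -/
def idleEdges (i : Fin n) : Finset E := N.cut B i \ N.edgesAt (B i)

theorem inEdges_subset (i : Fin n) : N.inEdges B i ⊆ N.cut B i := Finset.inter_subset_left

theorem outEdges_subset (i : Fin n) : N.outEdges B i ⊆ N.cut B (i + 1) :=
  Finset.inter_subset_left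

theorem idleEdges_subset (i : Fin n) : N.idleEdges B i ⊆ N.cut B i := Finset.sdiff_subset

theorem swallowed_succ {V : Type} {n : ℕ} (B : Fin n ≃ V) (i : Fin n) (v : V) :
    Swallowed B (i + 1) v ↔ Swallowed B i v ∨ v = B i := by
  unfold Swallowed
  rw [Nat.lt_succ_iff_lt_or_eq, ← B.symm_apply_eq, Fin.ext_iff]

theorem idleEdges_subset_succ (i : Fin n) : N.idleEdges B i ⊆ N.cut B (i + 1) := by
  intro e he
  simp only [idleEdges, cut, edgesAt, Finset.mem_sdiff, Finset.mem_filter, Finset.mem_univ,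
    true_and, not_or, swallowed_succ] at he ⊢
  tauto

/-- Every edge at the swallowed vertex that is not an input edge is an output edge. -/
theorem mem_outEdges_of_notMem (i : Fin n) {e : E} (he : e ∈ N.edgesAt (B i))
    (h : e ∉ N.inEdges B i) : e ∈ N.outEdges B i := by
  have hl := N.loopless e
  have hB : ¬ Swallowed B i (B i) := by simp [Swallowed]
  simp only [inEdges, outEdges, cut, Finset.mem_inter, he, and_true, Finset.mem_filter,
    Finset.mem_univ, true_and, not_not, swallowed_succ] at h ⊢
  simp only [edgesAt, Finset.mem_filter, Finset.mem_univ, true_and] at he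
  rcases he with he | he
  · rw [he] at h hl ⊢
    have := Ne.symm hl
    tauto
  · rw [he] at h hl ⊢
    tauto

/-- The tensor of the swallowed vertex `B i` as a linear map from its input to its output
indices. -/
def vertexMatrix (i : Fin n) :
    Matrix (N.outEdges B i → Fin q) (N.inEdges B i → Fin q) ℂ :=
  Matrix.of fun y x => N.tensor (B i) fun e =>
    if h : e.1 ∈ N.inEdges B i then x ⟨e.1, h⟩
    else y ⟨e.1, N.mem_outEdges_of_notMem B i e.2 h⟩

/-- The swallowing operator of `B i`: the identity on the untouched edges, tensored with
`vertexMatrix`. -/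
def swallowMatrix (i : Fin n) :
    Matrix (N.cut B (i + 1) → Fin q) (N.cut B i → Fin q) ℂ :=
  Matrix.of fun y x =>
    if ∀ e : N.idleEdges B i,
        y ⟨e.1, N.idleEdges_subset_succ B i e.2⟩ = x ⟨e.1, N.idleEdges_subset B i e.2⟩ then
      N.vertexMatrix B i (fun e => y ⟨e.1, N.outEdges_subset B i e.2⟩)
        (fun e => x ⟨e.1, N.inEdges_subset B i e.2⟩)
    else 0

/-- The swallowing operator as a map of Hilbert spaces. The tensor power of `ℂ^q` over a set `Z`
of edges is the Hilbert space with orthonormal basis `Z → Fin q`. -/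
def swallowOp (i : Fin n) :
    EuclideanSpace ℂ (N.cut B i → Fin q) →L[ℂ] EuclideanSpace ℂ (N.cut B (i + 1) → Fin q) :=
  LinearMap.toContinuousLinearMap (Matrix.toEuclideanLin (N.swallowMatrix B i))

/-- The approximation scale: the product of the operator norms of the swallowing operators. -/
def scale : ℝ := ∏ i : Fin n, ‖N.swallowOp B i‖

end Graph

end TensorNetwork

/-! ### Quantum algorithms

A quantum algorithm is a program of a random access machine with exact complex arithmetic and a
quantum register. The classical memory consists of arrays of natural numbers (used for indices and
counters; only addition and truncated subtraction are available) and arrays of complex numbers.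
The quantum register has qubits `0, 1, 2, …`. -/

namespace QRAM

/-- Vectors of the quantum register. The basis vector `s` is the one in which exactly the qubits in
`s` are in state `1`. Vectors need not be normalized: they are read up to a nonzero scalar. -/
abbrev QState : Type := Finset ℕ →₀ ℂ

/-- All qubits in state `0`. -/
def QState.zero : QState := Finsupp.single ∅ 1

/-- Apply the `2 × 2` matrix `U` to the qubit `t`, controlled by the qubits in `C`. -/
def QState.apply (U : Matrix (Fin 2) (Fin 2) ℂ) (C : Finset ℕ) (t : ℕ) : QState →ₗ[ℂ] QState :=
  Finsupp.linearCombination ℂ fun s =>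
    if C ⊆ s then
      let b : Fin 2 := if t ∈ s then 1 else 0
      Finsupp.single (s.erase t) (U 0 b) + Finsupp.single (insert t s) (U 1 b)
    else Finsupp.single s 1

open Classical in
/-- An elementary gate. An instruction that does not describe a gate, because the matrix is not
unitary or the target is one of the controls, has no effect. -/
def QState.gate (U : Matrix (Fin 2) (Fin 2) ℂ) (C : Finset ℕ) (t : ℕ) (ψ : QState) : QState :=
  if U ∈ Matrix.unitaryGroup (Fin 2) ℂ ∧ t ∉ C then QState.apply U C t ψ else ψ

/-- The projection of `ψ` to the basis vectors in which the qubit `t` has the value `b`. -/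
def QState.project (t : ℕ) (b : Bool) (ψ : QState) : QState :=
  ψ.filter fun s => decide (t ∈ s) = b

/-- The squared norm. -/
def QState.weight (ψ : QState) : ℝ≥0 := ∑ s ∈ ψ.support, ‖ψ s‖₊ ^ 2

/-- The probability that a measurement of the qubit `t` gives `1`. -/
def QState.probOne (t : ℕ) (ψ : QState) : ℝ≥0 :=
  (ψ.project t true).weight / ((ψ.project t false).weight + (ψ.project t true).weight)

theorem QState.probOne_le_one (t : ℕ) (ψ : QState) : ψ.probOne t ≤ 1 :=
  div_le_one_of_le₀ le_add_self zero_le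

/-- The distribution on `Bool` that gives `true` the probability `p`. -/
def coin (p : ℝ≥0) (hp : p ≤ 1) : PMF Bool :=
  PMF.ofFintype (fun b => if b then (p : ℝ≥0∞) else ((1 - p : ℝ≥0) : ℝ≥0∞)) (by
    simp only [Fintype.sum_bool, if_true, Bool.false_eq_true, if_false]
    rw [← ENNReal.coe_add, add_tsub_cancel_of_le hp, ENNReal.coe_one])

/-- Configurations of the memory: `nat a i` and `num a i` are the entries at position `i` of the
array with the name `a`. -/
structure State where
  nat : ℕ → ℕ → ℕ
  num : ℕ → ℕ → ℂ
  qubits : QState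

def State.setNat (s : State) (a i v : ℕ) : State :=
  { s with nat := Function.update s.nat a (Function.update (s.nat a) i v) }

def State.setNum (s : State) (a i : ℕ) (v : ℂ) : State :=
  { s with num := Function.update s.num a (Function.update (s.num a) i v) }

/-- Index expressions. -/
inductive NatExp : Type
  | lit (k : ℕ)
  | get (a : ℕ) (i : NatExp)
  | add (e f : NatExp)
  | sub (e f : NatExp)

def NatExp.eval (s : State) : NatExp → ℕ
  | lit k => k
  | get a i => s.nat a (i.eval s)
  | add e f => e.eval s + f.eval s
  | sub e f => e.eval s - f.eval s

/-- Complex arithmetic expressions. -/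
inductive NumExp : Type
  | ofNat (e : NatExp)
  | imUnit
  | get (a : ℕ) (i : NatExp)
  | add (x y : NumExp)
  | sub (x y : NumExp)
  | mul (x y : NumExp)
  | div (x y : NumExp)
  | conj (x : NumExp)
  | sqrtRe (x : NumExp)

def NumExp.eval (s : State) : NumExp → ℂ
  | ofNat e => (e.eval s : ℂ)
  | imUnit => Complex.I
  | get a i => s.num a (i.eval s)
  | add x y => x.eval s + y.eval s
  | sub x y => x.eval s - y.eval s
  | mul x y => x.eval s * y.eval s
  | div x y => x.eval s / y.eval s
  | conj x => (starRingEnd ℂ) (x.eval s)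
  | sqrtRe x => (Real.sqrt (x.eval s).re : ℂ)

/-- Tests: comparison of indices and of real parts. -/
inductive Test : Type
  | natLT (e f : NatExp)
  | reLT (x y : NumExp)

def Test.Holds (s : State) : Test → Prop
  | natLT e f => e.eval s < f.eval s
  | reLT x y => (x.eval s).re < (y.eval s).re

/-- The largest root of the real polynomial `∑_{j ≤ k} Re (c j) X ^ j` (when it is nonzero and has
a real root; `0` otherwise). -/
def largestRoot (c : ℕ → ℂ) (k : ℕ) : ℝ :=
  sSup {x : ℝ | ∑ j ∈ Finset.range (k + 1), (c j).re * x ^ j = 0}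

/-- Programs. The instruction `gate a i cs t` applies the one-qubit gate with the entries (row by
row) at the positions `i, …, i + 3` of the array `a` to the qubit `t`, controlled by the qubits in
the list `cs`, whose length is fixed in the text of the program. The instruction `fresh` discards
the quantum register and takes a new one in which all qubits are `0`; `measure t a i` measures the
qubit `t` and writes the outcome to the position `i` of the array `a`; `root a i k b j` writes to
the position `j` of the array `b` the largest real root of the polynomial of degree at most `k`
with the coefficients at the positions `i, …, i + k` of the array `a`. -/
inductive Prog : Type
  | skip
  | setNat (a : ℕ) (i v : NatExp)
  | setNum (a : ℕ) (i : NatExp) (v : NumExp)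
  | root (a : ℕ) (i k : NatExp) (b : ℕ) (j : NatExp)
  | fresh
  | gate (a : ℕ) (i : NatExp) (cs : List NatExp) (t : NatExp)
  | measure (t : NatExp) (a : ℕ) (i : NatExp)
  | seq (P Q : Prog)
  | cond (c : Test) (P Q : Prog)
  | loop (c : Test) (P : Prog)

/-- The matrix stored row by row at the positions `i, …, i + 3` of the array `a`. -/
def State.matrixAt (s : State) (a i : ℕ) : Matrix (Fin 2) (Fin 2) ℂ :=
  !![s.num a i, s.num a (i + 1); s.num a (i + 2), s.num a (i + 3)]

/-- The configuration after the qubit `t` was measured with the result `b`, which is written to the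
position `i` of the array `a`. -/
def State.collapse (s : State) (t a i : ℕ) (b : Bool) : State :=
  { s with qubits := s.qubits.project t b }.setNat a i b.toNat

/-- `Exec P s μ τ`: started in `s`, the program `P` halts after at most `τ` time steps, whatever
the outcomes of the measurements are, and `μ` is the distribution of the final configuration.
An instruction and a test take one step each, except that finding a root of a polynomial given by
`k + 1` coefficients takes `k + 1` steps. -/
inductive Exec : Prog → State → PMF State → ℕ → Prop
  | skip (s : State) : Exec .skip s (PMF.pure s) 1
  | setNat (a : ℕ) (i v : NatExp) (s : State) :
      Exec (.setNat a i v) s (PMF.pure (s.setNat a (i.eval s) (v.eval s))) 1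
  | setNum (a : ℕ) (i : NatExp) (v : NumExp) (s : State) :
      Exec (.setNum a i v) s (PMF.pure (s.setNum a (i.eval s) (v.eval s))) 1
  | root (a : ℕ) (i k : NatExp) (b : ℕ) (j : NatExp) (s : State) :
      Exec (.root a i k b j) s
        (PMF.pure (s.setNum b (j.eval s)
          (largestRoot (fun l => s.num a (i.eval s + l)) (k.eval s) : ℝ)))
        (k.eval s + 1)
  | fresh (s : State) : Exec .fresh s (PMF.pure { s with qubits := QState.zero }) 1
  | gate (a : ℕ) (i : NatExp) (cs : List NatExp) (t : NatExp) (s : State) :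
      Exec (.gate a i cs t) s
        (PMF.pure { s with
          qubits := s.qubits.gate (s.matrixAt a (i.eval s))
            (cs.map (NatExp.eval s)).toFinset (t.eval s) }) 1
  | measure (t : NatExp) (a : ℕ) (i : NatExp) (s : State) :
      Exec (.measure t a i) s
        ((coin (s.qubits.probOne (t.eval s)) (QState.probOne_le_one _ _)).map
          (s.collapse (t.eval s) a (i.eval s))) 1
  | seq (P Q : Prog) (s : State) (μ : PMF State) (ν : State → PMF State) (τ₁ τ₂ : ℕ)
      (hP : Exec P s μ τ₁) (hQ : ∀ s' ∈ μ.support, Exec Q s' (ν s') τ₂) :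
      Exec (.seq P Q) s (μ.bind ν) (τ₁ + τ₂)
  | cond_true (c : Test) (P Q : Prog) (s : State) (μ : PMF State) (τ : ℕ)
      (hc : c.Holds s) (hP : Exec P s μ τ) : Exec (.cond c P Q) s μ (τ + 1)
  | cond_false (c : Test) (P Q : Prog) (s : State) (μ : PMF State) (τ : ℕ)
      (hc : ¬ c.Holds s) (hQ : Exec Q s μ τ) : Exec (.cond c P Q) s μ (τ + 1)
  | loop_true (c : Test) (P : Prog) (s : State) (μ : PMF State) (ν : State → PMF State)
      (τ₁ τ₂ : ℕ) (hc : c.Holds s) (hP : Exec P s μ τ₁)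
      (hL : ∀ s' ∈ μ.support, Exec (.loop c P) s' (ν s') τ₂) :
      Exec (.loop c P) s (μ.bind ν) (τ₁ + τ₂ + 1)
  | loop_false (c : Test) (P : Prog) (s : State) (hc : ¬ c.Holds s) :
      Exec (.loop c P) s (PMF.pure s) 1
  | weaken (P : Prog) (s : State) (μ : PMF State) (τ τ' : ℕ) (hτ : τ ≤ τ')
      (hP : Exec P s μ τ) : Exec P s μ τ'

/-- The output is the entry at position `0` of the array of complex numbers with the name `2`. -/
def State.output (s : State) : ℂ := s.num 2 0

/-! #### Input of a tensor network with a bubbling -/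

variable {n m q : ℕ} (N : TensorNetwork (Fin n) (Fin m) q)

/-- The edges at `v` in increasing order. -/
def edgeList (v : Fin n) : List ℕ :=
  List.ofFn fun j : Fin (N.degree v) => (((N.edgesAt v).orderIsoOfFin rfl j).1 : ℕ)

/-- The `q ^ degree v` entries of the tensor at `v`. With the edges at `v` in increasing order, the
entry with the indices `x₀, x₁, x₂, …` is at the position `x₀ + x₁ q + x₂ q² + …`. -/
def entryList (v : Fin n) : List ℂ :=
  List.ofFn fun j : Fin (q ^ N.degree v) =>
    N.tensor v fun e => finFunctionFinEquiv.symm j (((N.edgesAt v).orderIsoOfFin rfl).symm e)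

/-- The initial configuration. The arrays of natural numbers `0`, `1`, `2` hold `q, n, m`, the
degrees of the vertices, and the names of the edges at the vertices; the arrays of complex numbers
`0` and `1` hold `ε` and the entries of the tensors. The vertices are listed in the order of the
bubbling `B`. All other cells are `0`, and so are all qubits. -/
def input (B : Fin n ≃ Fin n) (ε : ℝ) : State where
  nat a i :=
    match a with
    | 0 => [q, n, m].getD i 0
    | 1 => (List.ofFn fun j => N.degree (B j)).getD i 0
    | 2 => (List.ofFn fun j => edgeList N (B j)).flatten.getD i 0
    | _ => 0
  num a i :=
    match a with
    | 0 => [(ε : ℂ)].getD i 0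
    | 1 => (List.ofFn fun j => entryList N (B j)).flatten.getD i 0
    | _ => 0
  qubits := QState.zero

end QRAM

end

/-! The network is simulated coherently with labels in one-hot form. Each edge of the current cut
owns a block of `q` qubits exactly one of which is 1, and one further block, the token, holds an
intermediate index in the same way. A first gate prepares `(|∅⟩ + |{token}⟩)/√2`. The summand `|∅⟩`
is a reference: between the preparation and the final test all gates occur in the groups
`mergeGate`, `splitGate`, `rotGate`, which fix it, so it keeps the amplitude `1/√2`. On the other
summand a vertex is swallowed by merging its input edges into the token, applying the vertex matrix
divided by its norm to the token, and splitting the output edges off again. At the end the cut is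
empty, so all labelings share the basis vector `{token}`. There their amplitudes `∏ M_v(l)/‖M_v‖`
add up to `t = value / totalNorm`, times `1/√2` (`sum_amplitude`, `runs_prepareProg`).

A contraction is not unitary. The lost amplitude ends up in `Dead` basis vectors, which are 0 at the
token and at all unused qubits. Since abandoned qubits are never used again, later gates fix these
vectors. The contraction is applied row by row (`ElimOuter`, `ElimInner`). An additional column,
belonging to a new qubit, completes the current row to a unit vector orthogonal to all other rows.
Plane rotations between the token qubits and the new qubit then move this row into the additional
column, and orthogonality makes the other rows vanish there. The new qubit thus carries the value of
the row functional on the original token, and an `a × b` matrix costs at most `a * b` rotations. The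
norm itself is computed exactly, as the root of the largest eigenvalue of `Aᴴ A`: traces of powers
give the characteristic polynomial by Newton's identities (`sqrt_largestRoot_eq_norm`).

A gate on the token qubit makes the reference interfere with the result: the outcome is 1 with
probability `(1 - Re (η t))/2`, and dead vectors contribute equally to both outcomes
(`probOne_testGate`). With `η = 1` and `η = -i` this yields unbiased estimators of `Re t` and `Im
t`, with values `±1`. After `k` rounds the sum has expected squared error at most `2 k`, and
Markov's inequality with `k = ⌈8/ε²⌉` gives failure probability at most `1/4`. The error is first
measured in units of `totalNorm`, the product of the norms of the vertex matrices. These are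
submatrices of the swallowing operators, so `totalNorm ≤ scale`.

All work at a vertex is polynomial in `D = q ^ maxDegree`, because dimensions, degrees and `q` are
at most `D` where they matter. For degrees this needs `q ≥ 2`; for `q < 2` there is a single
labeling and the value is computed directly.

Fixed cells in the invariants: the arrays of natural numbers `3`, `4`, `5` hold the current vertex
and its positions in the edge and entry lists, `6` the start of the token, `7` the first unused
qubit, `8` the marks of the cut edges, `9` the starts of the edge blocks, `10` the powers of `q`,
`30` the number of rounds. The arrays of complex numbers `3`, `9`, `14` hold the gates, the product
of norms, and the running sum of samples. -/

noncomputable section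

/-! ### Calculus of executions: time bounds, postconditions, frames and expectations. -/

namespace QRAM

/-! ### Deterministic executions -/

/-- Started in `s`, the program `P` halts after at most `τ` steps in a configuration determined by
`s`, which satisfies `Q`. -/
def Runs (P : Prog) (s : State) (τ : ℕ) (Q : State → Prop) : Prop :=
  ∃ s', Exec P s (PMF.pure s') τ ∧ Q s'

namespace Runs

variable {P P' : Prog} {s : State} {τ τ' : ℕ} {Q R : State → Prop}

theorem mono (h : Runs P s τ Q) (hτ : τ ≤ τ') (hQ : ∀ s', Q s' → R s') : Runs P s τ' R := by
  obtain ⟨s', h, hs⟩ := h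
  exact ⟨s', .weaken _ _ _ _ _ hτ h, hQ _ hs⟩

theorem le (h : Runs P s τ Q) (hτ : τ ≤ τ') : Runs P s τ' Q := h.mono hτ fun _ h => h

theorem post (h : Runs P s τ Q) (hQ : ∀ s', Q s' → R s') : Runs P s τ R := h.mono le_rfl hQ

theorem skip (h : Q s) : Runs .skip s 1 Q := ⟨s, .skip s, h⟩

theorem setNat {a : ℕ} {i v : NatExp} (h : Q (s.setNat a (i.eval s) (v.eval s))) :
    Runs (.setNat a i v) s 1 Q := ⟨_, .setNat a i v s, h⟩

theorem setNum {a : ℕ} {i : NatExp} {v : NumExp} (h : Q (s.setNum a (i.eval s) (v.eval s))) :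
    Runs (.setNum a i v) s 1 Q := ⟨_, .setNum a i v s, h⟩

theorem fresh (h : Q { s with qubits := QState.zero }) : Runs .fresh s 1 Q := ⟨_, .fresh s, h⟩

theorem root {a : ℕ} {i k : NatExp} {b : ℕ} {j : NatExp}
    (h : Q (s.setNum b (j.eval s)
      (largestRoot (fun l => s.num a (i.eval s + l)) (k.eval s) : ℝ))) :
    Runs (.root a i k b j) s (k.eval s + 1) Q := ⟨_, .root a i k b j s, h⟩

theorem gate {a : ℕ} {i : NatExp} {cs : List NatExp} {t : NatExp}
    (h : Q { s with
      qubits := s.qubits.gate (s.matrixAt a (i.eval s))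
        (cs.map (NatExp.eval s)).toFinset (t.eval s) }) :
    Runs (.gate a i cs t) s 1 Q := ⟨_, .gate a i cs t s, h⟩

theorem seq (h : Runs P s τ fun s' => Runs P' s' τ' Q) : Runs (.seq P P') s (τ + τ') Q := by
  obtain ⟨s', h, s'', h', hQ⟩ := h
  refine ⟨s'', ?_, hQ⟩
  have := Exec.seq P P' s (PMF.pure s') (fun _ => PMF.pure s'') τ τ' h (by
    intro t ht
    rw [PMF.support_pure, Set.mem_singleton_iff] at ht
    rwa [ht])
  rwa [PMF.pure_bind] at this

theorem cond {c : Test} (h : c.Holds s → Runs P s τ Q) (h' : ¬ c.Holds s → Runs P' s τ Q) :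
    Runs (.cond c P P') s (τ + 1) Q := by
  by_cases hc : c.Holds s
  · obtain ⟨s', h, hQ⟩ := h hc
    exact ⟨s', .cond_true _ _ _ _ _ _ hc h, hQ⟩
  · obtain ⟨s', h, hQ⟩ := h' hc
    exact ⟨s', .cond_false _ _ _ _ _ _ hc h, hQ⟩

/-- The number of rounds is built into the family of invariants, so no separate termination argument
is needed. Each round pays for its test, and the last `1` pays for the failing test. -/
theorem loop {c : Test} {N : ℕ} (I : ℕ → State → Prop)
    (hstep : ∀ k < N, ∀ s, I k s → c.Holds s ∧ Runs P s τ (I (k + 1)))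
    (hend : ∀ s, I N s → ¬ c.Holds s) (s : State) (h0 : I 0 s) :
    Runs (.loop c P) s (N * (τ + 1) + 1) (I N) := by
  suffices H : ∀ j k, j + k = N → ∀ s, I j s → Runs (.loop c P) s (k * (τ + 1) + 1) (I N) from
    H 0 N (by simp) s h0
  intro j k
  induction k generalizing j with
  | zero =>
    intro hj s hs
    obtain rfl : j = N := by omega
    exact ⟨s, (Exec.loop_false _ _ _ (hend s hs)).weaken _ _ _ _ _ (by simp), hs⟩
  | succ k ih =>
    intro hj s hs
    obtain ⟨hc, s', h1, h2⟩ := hstep j (by omega) s hs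
    obtain ⟨s'', h3, h4⟩ := ih (j + 1) (by omega) s' h2
    refine ⟨s'', ?_, h4⟩
    have := Exec.loop_true c P s (PMF.pure s') (fun _ => PMF.pure s'') _ _ hc h1 (by
      intro t ht
      rw [PMF.support_pure, Set.mem_singleton_iff] at ht
      rwa [ht])
    rw [PMF.pure_bind] at this
    refine this.weaken _ _ _ _ _ ?_
    ring_nf
    omega

end Runs

/-- The entry at position `0` of an array, used as a variable. -/
abbrev var (x : ℕ) : NatExp := .get x (.lit 0)

/-- Programs executed one after the other. -/
def block : List Prog → Prog
  | [] => .skip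
  | P :: l => .seq P (block l)

/-- Run `body` for the values `0, 1, …, b - 1` of the variable `x`. -/
def forTo (x : ℕ) (b : NatExp) (body : Prog) : Prog :=
  .seq (.setNat x (.lit 0) (.lit 0))
    (.loop (.natLT (var x) b) (.seq body (.setNat x (.lit 0) (.add (var x) (.lit 1)))))

/-- Time is charged for an upper bound `D` of the number `n` of rounds; nested loops thereby get
bounds that are polynomials in one common `D`. In `τ + 2` the body is followed by the increment and
the test; the final `2` is the initial assignment and the failing test. -/
theorem Runs.forTo {x : ℕ} {b : NatExp} {body : Prog} {s : State} {τ : ℕ} {Q : State → Prop}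
    (n D : ℕ) (hD : n ≤ D) (I : ℕ → State → Prop) (h0 : I 0 (s.setNat x 0 0))
    (hI : ∀ k s, I k s → s.nat x 0 = k ∧ b.eval s = n)
    (hb : ∀ k < n, ∀ s, I k s →
      Runs body s τ fun s' => s'.nat x 0 = k ∧ I (k + 1) (s'.setNat x 0 (k + 1)))
    (hQ : ∀ s, I n s → Q s) : Runs (forTo x b body) s (D * (τ + 2) + 2) Q := by
  refine (Runs.seq (τ := 1) (τ' := n * (τ + 2) + 1) (Runs.setNat ?_)).mono ?_ hQ
  · refine Runs.loop I ?_ ?_ _ h0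
    · intro k hk s hs
      refine ⟨?_, ?_⟩
      · have := hI k s hs
        simp only [Test.Holds, NatExp.eval]
        omega
      · refine Runs.seq ((hb k hk s hs).post ?_)
        rintro s' ⟨h1, h2⟩
        refine Runs.setNat ?_
        simpa [NatExp.eval, h1] using h2
    · intro s hs
      have := hI n s hs
      simp only [Test.Holds, NatExp.eval]
      omega
  · have := Nat.mul_le_mul_right (τ + 2) hD
    omega

theorem Runs.block_nil {s : State} {Q : State → Prop} (h : Q s) : Runs (block []) s 1 Q :=
  Runs.skip h

theorem Runs.block_cons {P : Prog} {l : List Prog} {s : State} {τ τ' : ℕ} {Q : State → Prop}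
    (h : Runs P s τ fun s' => Runs (block l) s' τ' Q) : Runs (block (P :: l)) s (τ + τ') Q :=
  Runs.seq h

/-! ### Reading memory cells after an assignment -/

namespace State

variable (s : State) (a i b j : ℕ)

@[simp] theorem nat_setNat (v : ℕ) :
    (s.setNat a i v).nat b j = if b = a ∧ j = i then v else s.nat b j := by
  simp only [setNat, Function.update_apply]
  split_ifs <;> simp_all

@[simp] theorem num_setNum (v : ℂ) :
    (s.setNum a i v).num b j = if b = a ∧ j = i then v else s.num b j := by
  simp only [setNum, Function.update_apply]
  split_ifs <;> simp_all

@[simp] theorem num_setNat (v : ℕ) : (s.setNat a i v).num = s.num := rfl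

@[simp] theorem qubits_setNat (v : ℕ) : (s.setNat a i v).qubits = s.qubits := rfl

@[simp] theorem nat_setNum (v : ℂ) : (s.setNum a i v).nat = s.nat := rfl

@[simp] theorem qubits_setNum (v : ℂ) : (s.setNum a i v).qubits = s.qubits := rfl

/-- `s'` differs from `s` at most in the arrays of natural numbers in `W` and the arrays of complex
numbers in `V`, and in the quantum register. -/
def SameOutside (W V : List ℕ) (s s' : State) : Prop :=
  (∀ a ∉ W, ∀ i, s'.nat a i = s.nat a i) ∧ ∀ a ∉ V, ∀ i, s'.num a i = s.num a i

variable {s} {s' s'' : State} {W V W' V' : List ℕ}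

theorem SameOutside.refl (W V : List ℕ) (s : State) : SameOutside W V s s :=
  ⟨fun _ _ _ => rfl, fun _ _ _ => rfl⟩

theorem SameOutside.trans (h : SameOutside W V s s') (h' : SameOutside W V s' s'') :
    SameOutside W V s s'' :=
  ⟨fun a ha i => (h'.1 a ha i).trans (h.1 a ha i), fun a ha i => (h'.2 a ha i).trans (h.2 a ha i)⟩

theorem SameOutside.mono (h : SameOutside W V s s') (hW : W ⊆ W') (hV : V ⊆ V') :
    SameOutside W' V' s s' :=
  ⟨fun a ha => h.1 a fun h => ha (hW h), fun a ha => h.2 a fun h => ha (hV h)⟩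

theorem SameOutside.setNat (h : SameOutside W V s s') {a i v : ℕ} (ha : a ∈ W) :
    SameOutside W V s (s'.setNat a i v) := by
  refine ⟨fun b hb j => ?_, fun b hb j => h.2 b hb j⟩
  rw [nat_setNat, if_neg (by rintro ⟨rfl, -⟩; exact hb ha), h.1 b hb]

theorem SameOutside.setNum (h : SameOutside W V s s') {a i : ℕ} {v : ℂ} (ha : a ∈ V) :
    SameOutside W V s (s'.setNum a i v) := by
  refine ⟨fun b hb j => h.1 b hb j, fun b hb j => ?_⟩
  rw [num_setNum, if_neg (by rintro ⟨rfl, -⟩; exact hb ha), h.2 b hb]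

end State

/-! ### Expectations -/

/-- The expectation of a nonnegative function. -/
def expect {α : Type} (μ : PMF α) (f : α → ℝ≥0∞) : ℝ≥0∞ := ∑' a, μ a * f a

theorem expect_pure {α : Type} (a : α) (f : α → ℝ≥0∞) : expect (PMF.pure a) f = f a := by
  classical
  unfold expect
  rw [tsum_eq_single a]
  · simp
  · intro b hb
    simp [PMF.pure_apply, hb]

theorem expect_bind {α β : Type} (μ : PMF α) (ν : α → PMF β) (f : β → ℝ≥0∞) :
    expect (μ.bind ν) f = expect μ fun a => expect (ν a) f := by
  unfold expect
  simp_rw [PMF.bind_apply, ← ENNReal.tsum_mul_right, ← ENNReal.tsum_mul_left]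
  rw [ENNReal.tsum_comm]
  simp_rw [mul_assoc]

theorem expect_mono {α : Type} {μ : PMF α} {f g : α → ℝ≥0∞}
    (h : ∀ a ∈ μ.support, f a ≤ g a) : expect μ f ≤ expect μ g := by
  refine ENNReal.tsum_le_tsum fun a => ?_
  by_cases ha : μ a = 0
  · simp [ha]
  · gcongr
    exact h a ((PMF.mem_support_iff _ _).2 ha)

theorem expect_map {α β : Type} (μ : PMF α) (g : α → β) (f : β → ℝ≥0∞) :
    expect (μ.map g) f = expect μ (f ∘ g) := by
  rw [PMF.map, expect_bind]
  simp [expect_pure, Function.comp_def]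

theorem expect_coin (p : ℝ≥0) (hp : p ≤ 1) (f : Bool → ℝ≥0∞) :
    expect (coin p hp) f = p * f true + ((1 - p : ℝ≥0) : ℝ≥0∞) * f false := by
  simp [expect, coin, tsum_fintype]

/-- Functions to be averaged take the value `∞` where an invariant fails. A finite expectation then
certifies the invariant on the whole support. -/
theorem ne_top_of_mem_support {α : Type} {μ : PMF α} {f : α → ℝ≥0∞} (h : expect μ f ≠ ∞) {a : α}
    (ha : a ∈ μ.support) : f a ≠ ∞ := by
  intro hf
  have := ENNReal.ne_top_of_tsum_ne_top h a
  rw [hf, ENNReal.mul_top ((PMF.mem_support_iff _ _).1 ha)] at this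
  exact this rfl

/-- Started in `s`, the program `P` halts after at most `τ` steps, and the expectation of `f` in the
final configuration is at most `c`. -/
def RunsExpect (P : Prog) (s : State) (τ : ℕ) (f : State → ℝ≥0∞) (c : ℝ≥0∞) : Prop :=
  ∃ μ, Exec P s μ τ ∧ expect μ f ≤ c

namespace RunsExpect

variable {P P' : Prog} {s : State} {τ τ' : ℕ} {f g : State → ℝ≥0∞} {c c' : ℝ≥0∞}

theorem mono (h : RunsExpect P s τ f c) (hτ : τ ≤ τ') (hc : c ≤ c') :
    RunsExpect P s τ' f c' := by
  obtain ⟨μ, h, hs⟩ := h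
  exact ⟨μ, .weaken _ _ _ _ _ hτ h, hs.trans hc⟩

theorem of_runs {Q : State → Prop} (h : Runs P s τ Q) (hf : ∀ s', Q s' → f s' ≤ c) :
    RunsExpect P s τ f c := by
  obtain ⟨s', h, hQ⟩ := h
  exact ⟨_, h, by rw [expect_pure]; exact hf _ hQ⟩

theorem seq (h : RunsExpect P s τ g c) (hc : c ≠ ∞)
    (h' : ∀ s', g s' ≠ ∞ → RunsExpect P' s' τ' f (g s')) :
    RunsExpect (.seq P P') s (τ + τ') f c := by
  classical
  obtain ⟨μ, h1, h2⟩ := h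
  have hfin : ∀ a ∈ μ.support, g a ≠ ∞ := fun a ha =>
    ne_top_of_mem_support (ne_top_of_le_ne_top hc h2) ha
  choose! ν hν using h'
  refine ⟨μ.bind ν, .seq _ _ _ _ _ _ _ h1 fun s' hs => (hν s' (hfin s' hs)).1, ?_⟩
  rw [expect_bind]
  exact (expect_mono fun a ha => (hν a (hfin a ha)).2).trans h2

theorem seq_runs {Q : State → Prop} (h : Runs P s τ Q)
    (h' : ∀ s', Q s' → RunsExpect P' s' τ' f c) : RunsExpect (.seq P P') s (τ + τ') f c := by
  obtain ⟨s', h1, hQ⟩ := h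
  obtain ⟨μ, h2, h3⟩ := h' s' hQ
  refine ⟨(PMF.pure s').bind fun _ => μ, .seq _ _ _ _ _ _ _ h1 ?_, by rwa [PMF.pure_bind]⟩
  intro t ht
  rw [PMF.support_pure, Set.mem_singleton_iff] at ht
  rwa [ht]

theorem measure {t : NatExp} {a : ℕ} {i : NatExp}
    (h : (s.qubits.probOne (t.eval s) : ℝ≥0∞) * f (s.collapse (t.eval s) a (i.eval s) true) +
      ((1 - s.qubits.probOne (t.eval s) : ℝ≥0) : ℝ≥0∞) *
        f (s.collapse (t.eval s) a (i.eval s) false) ≤ c) :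
    RunsExpect (.measure t a i) s 1 f c := by
  refine ⟨_, .measure t a i s, ?_⟩
  rwa [expect_map, expect_coin]

/-- `F` is a potential whose expectation does not increase from round to round. Its finiteness
doubles as the loop invariant, so the test and the next round are analysed only where `F` is finite.
-/
theorem loop {b : Test} {N : ℕ} (F : ℕ → State → ℝ≥0∞)
    (hstep : ∀ k < N, ∀ s, F k s ≠ ∞ → b.Holds s ∧ RunsExpect P s τ (F (k + 1)) (F k s))
    (hend : ∀ s, F N s ≠ ∞ → ¬ b.Holds s) (s : State) (h0 : F 0 s ≠ ∞) :
    RunsExpect (.loop b P) s (N * (τ + 1) + 1) (F N) (F 0 s) := by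
  classical
  suffices H : ∀ j k, j + k = N → ∀ s, F j s ≠ ∞ →
      RunsExpect (.loop b P) s (k * (τ + 1) + 1) (F N) (F j s) from H 0 N (by simp) s h0
  intro j k
  induction k generalizing j with
  | zero =>
    intro hj s hs
    obtain rfl : j = N := by omega
    exact ⟨_, (Exec.loop_false _ _ _ (hend s hs)).weaken _ _ _ _ _ (by simp), by rw [expect_pure]⟩
  | succ k ih =>
    intro hj s hs
    obtain ⟨hc, μ, h1, h2⟩ := hstep j (by omega) s hs
    have hfin : ∀ a ∈ μ.support, F (j + 1) a ≠ ∞ := fun a ha =>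
      ne_top_of_mem_support (ne_top_of_le_ne_top hs h2) ha
    have := ih (j + 1) (by omega)
    choose! ν hν using this
    refine ⟨μ.bind ν, (Exec.loop_true b P s μ ν _ _ hc h1
      fun s' hs => (hν s' (hfin s' hs)).1).weaken _ _ _ _ _ ?_, ?_⟩
    · ring_nf
      omega
    · rw [expect_bind]
      exact (expect_mono fun a ha => (hν a (hfin a ha)).2).trans h2

end RunsExpect

end QRAM

end

/-! ### Action of gates on basis vectors, unitarity, and statistics of the final measurement. -/

noncomputable section

namespace QRAM

/-! ### Gates on basis vectors -/

/-- The NOT gate. -/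
def gateX : Matrix (Fin 2) (Fin 2) ℂ := !![0, 1; 1, 0]

theorem gateX_mem : gateX ∈ Matrix.unitaryGroup (Fin 2) ℂ := by
  rw [Matrix.mem_unitaryGroup_iff]
  ext i j
  fin_cases i <;> fin_cases j <;>
    simp [gateX, Matrix.mul_apply, Fin.sum_univ_two, Matrix.star_eq_conjTranspose]

namespace QState

theorem gate_of_mem {U : Matrix (Fin 2) (Fin 2) ℂ} (hU : U ∈ Matrix.unitaryGroup (Fin 2) ℂ)
    {C : Finset ℕ} {t : ℕ} (ht : t ∉ C) (ψ : QState) : ψ.gate U C t = apply U C t ψ :=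
  if_pos ⟨hU, ht⟩

theorem apply_single (U : Matrix (Fin 2) (Fin 2) ℂ) (C : Finset ℕ) (t : ℕ) (s : Finset ℕ) (z : ℂ) :
    apply U C t (Finsupp.single s z) =
      if C ⊆ s then
        Finsupp.single (s.erase t) (U 0 (if t ∈ s then 1 else 0) * z) +
          Finsupp.single (insert t s) (U 1 (if t ∈ s then 1 else 0) * z)
      else Finsupp.single s z := by
  rw [apply, Finsupp.linearCombination_single]
  split_ifs <;> simp [mul_comm]

theorem apply_single_of_not_subset {U : Matrix (Fin 2) (Fin 2) ℂ} {C : Finset ℕ} {t : ℕ}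
    {s : Finset ℕ} (h : ¬ C ⊆ s) (z : ℂ) :
    apply U C t (Finsupp.single s z) = Finsupp.single s z := by
  rw [apply_single, if_neg h]

theorem apply_single_of_notMem {U : Matrix (Fin 2) (Fin 2) ℂ} {C : Finset ℕ} {t : ℕ}
    {s : Finset ℕ} (h : C ⊆ s) (ht : t ∉ s) (z : ℂ) :
    apply U C t (Finsupp.single s z) =
      Finsupp.single s (U 0 0 * z) + Finsupp.single (insert t s) (U 1 0 * z) := by
  rw [apply_single, if_pos h, if_neg ht, Finset.erase_eq_of_notMem ht]

theorem apply_single_of_mem {U : Matrix (Fin 2) (Fin 2) ℂ} {C : Finset ℕ} {t : ℕ}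
    {s : Finset ℕ} (h : C ⊆ s) (ht : t ∈ s) (z : ℂ) :
    apply U C t (Finsupp.single s z) =
      Finsupp.single (s.erase t) (U 0 1 * z) + Finsupp.single s (U 1 1 * z) := by
  rw [apply_single, if_pos h, if_pos ht, Finset.insert_eq_of_mem ht]

theorem applyX_single_of_notMem {C : Finset ℕ} {t : ℕ}
    {s : Finset ℕ} (h : C ⊆ s) (ht : t ∉ s) (z : ℂ) :
    apply gateX C t (Finsupp.single s z) = Finsupp.single (insert t s) z := by
  simp [apply_single_of_notMem h ht, gateX]

theorem applyX_single_of_mem {C : Finset ℕ} {t : ℕ}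
    {s : Finset ℕ} (h : C ⊆ s) (ht : t ∈ s) (z : ℂ) :
    apply gateX C t (Finsupp.single s z) = Finsupp.single (s.erase t) z := by
  simp [apply_single_of_mem h ht, gateX]

theorem map_eq_self {L : QState →ₗ[ℂ] QState} {ψ : QState}
    (h : ∀ s ∈ ψ.support, ∀ z, L (Finsupp.single s z) = Finsupp.single s z) : L ψ = ψ := by
  conv_lhs => rw [← Finsupp.sum_single ψ]
  conv_rhs => rw [← Finsupp.sum_single ψ]
  rw [Finsupp.sum, map_sum]
  exact Finset.sum_congr rfl fun s hs => h s hs _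

/-- Replaces the pair of ones at `a` and `e` by a one at `c`. -/
def mergeGate (a e c : ℕ) : QState →ₗ[ℂ] QState :=
  apply gateX {c} e ∘ₗ apply gateX {c} a ∘ₗ apply gateX {a, e} c

/-- Replaces the one at `c` by a pair of ones at `a` and `e`. -/
def splitGate (a e c : ℕ) : QState →ₗ[ℂ] QState :=
  apply gateX {a, e} c ∘ₗ apply gateX {c} e ∘ₗ apply gateX {c} a

/-- Applies `U` to the span of the vectors with exactly one of the qubits `a` and `c` in state `1`. -/
def rotGate (U : Matrix (Fin 2) (Fin 2) ℂ) (a c : ℕ) : QState →ₗ[ℂ] QState :=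
  apply gateX {c} a ∘ₗ apply U {a} c ∘ₗ apply gateX {c} a

/-- The first gate is not enabled, so `c` stays 0 and the other two are not enabled either. -/
theorem mergeGate_fix {a e c : ℕ} {s : Finset ℕ} (hc : c ∉ s) (h : ¬ (a ∈ s ∧ e ∈ s)) (z : ℂ) :
    mergeGate a e c (Finsupp.single s z) = Finsupp.single s z := by
  simp only [mergeGate, LinearMap.comp_apply]
  rw [apply_single_of_not_subset (by simpa [Finset.insert_subset_iff] using h),
    apply_single_of_not_subset (by simpa using hc), apply_single_of_not_subset (by simpa using hc)]

/-- The first gate sets `c`; this enables the other two, which clear `a` and `e`. -/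
theorem mergeGate_hit {a e c : ℕ} {J : Finset ℕ} (ha : a ∉ J) (he : e ∉ J) (hc : c ∉ J)
    (hae : a ≠ e) (hac : a ≠ c) (hec : e ≠ c) (z : ℂ) :
    mergeGate a e c (Finsupp.single (insert a (insert e J)) z) = Finsupp.single (insert c J) z := by
  simp only [mergeGate, LinearMap.comp_apply]
  rw [applyX_single_of_notMem (by simp [Finset.insert_subset_iff])
      (by simp [hc, hac.symm, hec.symm]), applyX_single_of_mem (by simp) (by simp),
    applyX_single_of_mem (by simp [hac.symm]) (by simp [hae.symm])]
  congr 1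
  ext x
  simp only [Finset.mem_erase, Finset.mem_insert]
  grind

theorem splitGate_fix {a e c : ℕ} {s : Finset ℕ} (hc : c ∉ s) (h : ¬ (a ∈ s ∧ e ∈ s)) (z : ℂ) :
    splitGate a e c (Finsupp.single s z) = Finsupp.single s z := by
  simp only [splitGate, LinearMap.comp_apply]
  rw [apply_single_of_not_subset (by simpa using hc), apply_single_of_not_subset (by simpa using hc),
    apply_single_of_not_subset (by simpa [Finset.insert_subset_iff] using h)]

theorem splitGate_hit {a e c : ℕ} {J : Finset ℕ} (ha : a ∉ J) (he : e ∉ J) (hc : c ∉ J)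
    (hae : a ≠ e) (hac : a ≠ c) (hec : e ≠ c) (z : ℂ) :
    splitGate a e c (Finsupp.single (insert c J) z) = Finsupp.single (insert a (insert e J)) z := by
  simp only [splitGate, LinearMap.comp_apply]
  rw [applyX_single_of_notMem (by simp) (by simp [ha, hac]),
    applyX_single_of_notMem (by simp) (by simp [he, hae.symm, hec]),
    applyX_single_of_mem (by simp [Finset.insert_subset_iff]) (by simp)]
  congr 1
  ext x
  simp only [Finset.mem_erase, Finset.mem_insert]
  grind

variable {U : Matrix (Fin 2) (Fin 2) ℂ}

theorem rotGate_fix {a c : ℕ} {s : Finset ℕ} (ha : a ∉ s) (hc : c ∉ s) (z : ℂ) :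
    rotGate U a c (Finsupp.single s z) = Finsupp.single s z := by
  simp only [rotGate, LinearMap.comp_apply]
  rw [apply_single_of_not_subset (by simpa using hc), apply_single_of_not_subset (by simpa using ha),
    apply_single_of_not_subset (by simpa using hc)]

/-- Conjugation by the controlled NOT turns the pair `{a}`, `{c}` into `{a}`, `{a, c}`, the two
states of the qubit `c` with `a` set, on which the controlled `U` acts. -/
theorem rotGate_left {a c : ℕ} {J : Finset ℕ} (ha : a ∉ J) (hc : c ∉ J) (hac : a ≠ c) (z : ℂ) :
    rotGate U a c (Finsupp.single (insert a J) z) =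
      Finsupp.single (insert a J) (U 0 0 * z) + Finsupp.single (insert c J) (U 1 0 * z) := by
  simp only [rotGate, LinearMap.comp_apply]
  rw [apply_single_of_not_subset (by simp [hac.symm, hc]),
    apply_single_of_notMem (by simp) (by simp [hac.symm, hc]), map_add,
    apply_single_of_not_subset (by simp [hac.symm, hc]),
    applyX_single_of_mem (by simp) (by simp)]
  congr 2
  ext x
  simp only [Finset.mem_erase, Finset.mem_insert]
  grind

theorem rotGate_right {a c : ℕ} {J : Finset ℕ} (ha : a ∉ J) (hc : c ∉ J) (hac : a ≠ c) (z : ℂ) :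
    rotGate U a c (Finsupp.single (insert c J) z) =
      Finsupp.single (insert a J) (U 0 1 * z) + Finsupp.single (insert c J) (U 1 1 * z) := by
  simp only [rotGate, LinearMap.comp_apply]
  rw [applyX_single_of_notMem (by simp) (by simp [hac, ha]),
    apply_single_of_mem (by simp) (by simp), map_add,
    apply_single_of_not_subset (by simp),
    applyX_single_of_mem (by simp) (by simp)]
  congr 2
  · ext x
    simp only [Finset.mem_erase, Finset.mem_insert]
    grind
  · ext x
    simp only [Finset.mem_erase, Finset.mem_insert]
    grind

/-! ### The norm -/

theorem weight_eq_sum (ψ : QState) {W : Finset (Finset ℕ)} (h : ψ.support ⊆ W) :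
    (ψ.weight : ℝ) = ∑ s ∈ W, ‖ψ s‖ ^ 2 := by
  rw [weight, NNReal.coe_sum]
  simp only [NNReal.coe_pow, coe_nnnorm]
  refine Finset.sum_subset h fun s _ hs => ?_
  simp [Finsupp.notMem_support_iff.1 hs]

/-- As `t ∉ C`, the condition `C ⊆ s` does not depend on the qubit `t`, so the gate acts separately
on each pair `s.erase t`, `insert t s`. -/
theorem apply_apply {C : Finset ℕ} {t : ℕ} (ht : t ∉ C) (ψ : QState) (s : Finset ℕ) :
    apply U C t ψ s =
      if C ⊆ s then
        (if t ∈ s then U 1 0 * ψ (s.erase t) + U 1 1 * ψ s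
          else U 0 0 * ψ s + U 0 1 * ψ (insert t s))
      else ψ s := by
  induction ψ using Finsupp.induction_linear with
  | zero => simp
  | add f g hf hg =>
    rw [map_add, Finsupp.add_apply, hf, hg]
    simp only [Finsupp.add_apply]
    split_ifs <;> ring
  | single r z =>
    rw [apply_single]
    have key : C ⊆ r.erase t ↔ C ⊆ r := by
      rw [Finset.subset_erase]
      exact and_iff_left ht
    have key' : ∀ s, C ⊆ insert t s ↔ C ⊆ s := fun s =>
      ⟨fun h x hx => (Finset.mem_insert.1 (h hx)).resolve_left (by rintro rfl; exact ht hx),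
        fun h => h.trans (Finset.subset_insert _ _)⟩
    have key'' : ∀ s : Finset ℕ, C ⊆ s.erase t ↔ C ⊆ s := fun s => by
      rw [Finset.subset_erase]
      exact and_iff_left ht
    by_cases hC : C ⊆ r
    · rw [if_pos hC]
      by_cases hs : C ⊆ s
      · rw [if_pos hs]
        by_cases htr : t ∈ r <;> by_cases hts : t ∈ s <;>
          simp only [htr, hts, if_true, if_false, Finsupp.add_apply, Finsupp.single_apply]
        · have h1 : r.erase t ≠ s := by rintro rfl; simp at hts
          have h2 : r ≠ s.erase t := by rintro rfl; simp at htr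
          rw [Finset.insert_eq_of_mem htr, if_neg h1, if_neg h2]
          simp
        · have h1 : r ≠ s := by rintro rfl; exact hts htr
          have h2 : insert t r ≠ s := by rintro rfl; simp at hts
          have h3 : r.erase t = s ↔ r = insert t s := by
            constructor
            · rintro rfl; rw [Finset.insert_erase htr]
            · rintro rfl; rw [Finset.erase_insert hts]
          rw [if_neg h1, if_neg h2, mul_zero, zero_add, add_zero]
          simp only [h3]
          split_ifs <;> simp
        · have h1 : r ≠ s := by rintro rfl; exact htr hts
          have h2 : r.erase t ≠ s := by rintro rfl; simp at hts
          have h3 : insert t r = s ↔ r = s.erase t := by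
            constructor
            · rintro rfl; rw [Finset.erase_insert htr]
            · rintro rfl; rw [Finset.insert_erase hts]
          rw [if_neg h1, if_neg h2, mul_zero, zero_add, add_zero]
          simp only [h3]
          split_ifs <;> simp
        · have h1 : insert t r ≠ s := by rintro rfl; simp at hts
          have h2 : r ≠ insert t s := by rintro rfl; simp at htr
          rw [Finset.erase_eq_of_notMem htr, if_neg h1, if_neg h2]
          simp
      · rw [if_neg hs, Finsupp.add_apply]
        have h1 : r.erase t ≠ s := by rintro rfl; exact hs (key.2 hC)
        have h2 : insert t r ≠ s := by rintro rfl; exact hs ((key' r).2 hC)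
        have h3 : r ≠ s := by rintro rfl; exact hs hC
        simp [h1, h2, h3]
    · rw [if_neg hC]
      by_cases hs : C ⊆ s
      · have h1 : r ≠ s.erase t := by rintro rfl; exact hC ((key'' s).2 hs)
        have h2 : r ≠ insert t s := by rintro rfl; exact hC ((key' s).2 hs)
        have h3 : r ≠ s := by rintro rfl; exact hC hs
        simp [h1, h2, h3]
      · rw [if_neg hs]

theorem norm_sq_unitary (hU : U ∈ Matrix.unitaryGroup (Fin 2) ℂ) (x y : ℂ) :
    ‖U 0 0 * x + U 0 1 * y‖ ^ 2 + ‖U 1 0 * x + U 1 1 * y‖ ^ 2 = ‖x‖ ^ 2 + ‖y‖ ^ 2 := by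
  have h := Matrix.mem_unitaryGroup_iff'.1 hU
  have h00 := congrFun₂ h 0 0
  have h01 := congrFun₂ h 0 1
  have h10 := congrFun₂ h 1 0
  have h11 := congrFun₂ h 1 1
  simp only [Matrix.mul_apply, Fin.sum_univ_two, Matrix.star_apply, RCLike.star_def,
    Matrix.one_apply_eq, Matrix.one_apply_ne (show (0 : Fin 2) ≠ 1 by decide),
    Matrix.one_apply_ne (show (1 : Fin 2) ≠ 0 by decide)] at h00 h01 h10 h11
  have e : ∀ z : ℂ, ((‖z‖ ^ 2 : ℝ) : ℂ) = (starRingEnd ℂ) z * z := fun z => by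
    rw [Complex.conj_mul', Complex.ofReal_pow]
  have : (((‖U 0 0 * x + U 0 1 * y‖ ^ 2 + ‖U 1 0 * x + U 1 1 * y‖ ^ 2 : ℝ)) : ℂ) =
      ((‖x‖ ^ 2 + ‖y‖ ^ 2 : ℝ) : ℂ) := by
    rw [Complex.ofReal_add, Complex.ofReal_add, e, e, e, e]
    simp only [map_add, map_mul]
    linear_combination (starRingEnd ℂ x * x) * h00 + (starRingEnd ℂ x * y) * h01 +
      (starRingEnd ℂ y * x) * h10 + (starRingEnd ℂ y * y) * h11
  exact_mod_cast this

/-- Together with `subset_pairs` this enlarges a finite support to a union of pairs that differ in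
the qubit `t` only, so that norms before and after a gate can be compared pair by pair. -/
theorem sum_insert_pairs (t : ℕ) (T : Finset (Finset ℕ)) (hT : ∀ s ∈ T, t ∉ s)
    (g : Finset ℕ → ℝ) :
    ∑ s ∈ T ∪ T.image (insert t), g s = ∑ s ∈ T, (g s + g (insert t s)) := by
  rw [Finset.sum_union, Finset.sum_image, Finset.sum_add_distrib]
  · intro a ha b hb hab
    rw [← Finset.erase_insert (hT a ha), ← Finset.erase_insert (hT b hb)]
    exact congrArg (fun s => Finset.erase s t) hab
  · rw [Finset.disjoint_left]
    intro s hs hs'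
    obtain ⟨r, -, rfl⟩ := Finset.mem_image.1 hs'
    exact hT _ hs (Finset.mem_insert_self _ _)

theorem subset_pairs (t : ℕ) (S : Finset (Finset ℕ)) :
    S ⊆ S.image (fun s => s.erase t) ∪ (S.image (fun s => s.erase t)).image (insert t) := by
  intro s hs
  by_cases ht : t ∈ s
  · refine Finset.mem_union_right _ (Finset.mem_image.2 ⟨s.erase t, ?_, Finset.insert_erase ht⟩)
    exact Finset.mem_image_of_mem _ hs
  · exact Finset.mem_union_left _ (Finset.mem_image.2 ⟨s, hs, Finset.erase_eq_of_notMem ht⟩)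

theorem weight_gate (U : Matrix (Fin 2) (Fin 2) ℂ) (C : Finset ℕ) (t : ℕ) (ψ : QState) :
    (ψ.gate U C t).weight = ψ.weight := by
  classical
  by_cases h : U ∈ Matrix.unitaryGroup (Fin 2) ℂ ∧ t ∉ C
  swap
  · rw [gate, if_neg h]
  obtain ⟨hU, ht⟩ := h
  rw [gate_of_mem hU ht]
  set S := ψ.support ∪ (apply U C t ψ).support
  set T := S.image (fun s => s.erase t)
  have hT : ∀ s ∈ T, t ∉ s := by
    intro s hs
    obtain ⟨r, -, rfl⟩ := Finset.mem_image.1 hs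
    simp
  apply NNReal.eq
  rw [weight_eq_sum _ (Finset.subset_union_right.trans (subset_pairs t S)),
    weight_eq_sum ψ (Finset.subset_union_left.trans (subset_pairs t S)),
    sum_insert_pairs t T hT, sum_insert_pairs t T hT]
  refine Finset.sum_congr rfl fun s hs => ?_
  have hts := hT s hs
  have key' : C ⊆ insert t s ↔ C ⊆ s :=
    ⟨fun h x hx => (Finset.mem_insert.1 (h hx)).resolve_left (by rintro rfl; exact ht hx),
      fun h => h.trans (Finset.subset_insert _ _)⟩
  rw [apply_apply ht, apply_apply ht]
  simp only [key', hts, Finset.mem_insert_self, if_true, if_false, Finset.erase_insert hts]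
  split_ifs
  · exact norm_sq_unitary hU _ _
  · rfl

theorem weight_zero_state : QState.zero.weight = 1 := by
  simp [QState.zero, weight]

/-! ### The final measurement -/

/-- The gate after which the measurement of a qubit compares its amplitudes. -/
def testGate (η : ℂ) : Matrix (Fin 2) (Fin 2) ℂ :=
  !![1 / (Real.sqrt 2 : ℂ), η / (Real.sqrt 2 : ℂ); 1 / (Real.sqrt 2 : ℂ), - η / (Real.sqrt 2 : ℂ)]

theorem sqrt_two_mul_self : (Real.sqrt 2 : ℂ) * (Real.sqrt 2 : ℂ) = 2 := by
  rw [← Complex.ofReal_mul, Real.mul_self_sqrt (by norm_num)]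
  norm_num

theorem sqrt_two_ne_zero : (Real.sqrt 2 : ℂ) ≠ 0 := by
  rw [Complex.ofReal_ne_zero]
  positivity

theorem testGate_mem {η : ℂ} (hη : ‖η‖ = 1) : testGate η ∈ Matrix.unitaryGroup (Fin 2) ℂ := by
  have h1 : η * (starRingEnd ℂ) η = 1 := by rw [Complex.mul_conj', hη]; simp
  have h2 := sqrt_two_mul_self
  have h3 := sqrt_two_ne_zero
  rw [Matrix.mem_unitaryGroup_iff]
  ext i j
  fin_cases i <;> fin_cases j <;>
    simp [testGate, Matrix.mul_apply, Fin.sum_univ_two, Matrix.star_apply] <;>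
    field_simp <;> simp only [pow_two, h1, h2] <;> norm_num

/-- After the gate, `insert r s` has the amplitude `(ψ s - η ψ (insert r s))/√2`. Interference is
possible only in the pair of `∅` and `{r}`; every other `s` gives `‖D s‖²/2` to each outcome,
whatever its phase. -/
theorem probOne_testGate {η : ℂ} (hη : ‖η‖ = 1) {r : ℕ} {D : QState} {β : ℂ}
    (hD : ∀ s ∈ D.support, r ∉ s) (hw : (D + Finsupp.single {r} β).weight = 1) :
    ((probOne r (gate (testGate η) ∅ r (D + Finsupp.single {r} β))) : ℝ) =
      (1 - ‖β‖ ^ 2 - ‖D ∅‖ ^ 2 + ‖D ∅ - η * β‖ ^ 2) / 2 := by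
  classical
  have hU := testGate_mem hη
  set ψ : QState := D + Finsupp.single {r} β with hψ
  set φ := gate (testGate η) ∅ r ψ with hφ
  have hφw : φ.weight = 1 := by rw [hφ, weight_gate, hw]
  have hφa : φ = apply (testGate η) ∅ r ψ := gate_of_mem hU (by simp) _
  -- `∅` is added so that the interfering pair is a summand even if its amplitudes vanish.
  set S := insert ∅ (ψ.support ∪ φ.support) with hS
  set T := S.image (fun s => s.erase r) with hTdef
  have hT : ∀ s ∈ T, r ∉ s := by
    intro s hs
    obtain ⟨r, -, rfl⟩ := Finset.mem_image.1 hs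
    simp
  have hsub := subset_pairs r S
  have h0T : ∅ ∈ T := Finset.mem_image.2 ⟨∅, by simp [hS], by simp⟩
  have e1 : ((φ.project r true).weight : ℝ) = ∑ s ∈ T, ‖φ (insert r s)‖ ^ 2 := by
    rw [weight_eq_sum (W := T ∪ T.image (insert r)), sum_insert_pairs r T hT]
    · refine Finset.sum_congr rfl fun s hs => ?_
      simp [project, hT s hs]
    · intro s hs
      refine hsub ?_
      simp only [project, Finsupp.support_filter, Finset.mem_filter] at hs
      simp [hS, hs.1]
  have e0 : ((φ.project r false).weight : ℝ) = ∑ s ∈ T, ‖φ s‖ ^ 2 := by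
    rw [weight_eq_sum (W := T ∪ T.image (insert r)), sum_insert_pairs r T hT]
    · refine Finset.sum_congr rfl fun s hs => ?_
      simp [project, hT s hs]
    · intro s hs
      refine hsub ?_
      simp only [project, Finsupp.support_filter, Finset.mem_filter] at hs
      simp [hS, hs.1]
  -- The gate preserves the norm, so the normalizing denominator in `probOne` is 1.
  have etot : ((φ.project r false).weight : ℝ) + (φ.project r true).weight = 1 := by
    rw [e0, e1, ← Finset.sum_add_distrib, ← sum_insert_pairs r T hT (fun s => ‖φ s‖ ^ 2),
      ← weight_eq_sum φ, hφw, NNReal.coe_one]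
    exact fun s hs => hsub (by simp only [hS, Finset.mem_insert, Finset.mem_union]; tauto)
  have hDval : ∀ s ∈ T, D (insert r s) = 0 := by
    intro s hs
    by_contra h
    exact hD _ (Finsupp.mem_support_iff.2 h) (Finset.mem_insert_self _ _)
  have hval : ∀ s ∈ T, φ (insert r s) = (ψ s - η * ψ (insert r s)) / (Real.sqrt 2 : ℂ) := by
    intro s hs
    rw [hφa, apply_apply (by simp)]
    simp only [Finset.empty_subset, if_true, Finset.mem_insert_self, Finset.erase_insert (hT s hs)]
    simp [testGate]
    ring
  have hψr : ∀ s ∈ T, ψ (insert r s) = if s = ∅ then β else 0 := by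
    intro s hs
    have : ({r} : Finset ℕ) = insert r s ↔ s = ∅ := by
      constructor
      · intro h
        rw [← Finset.erase_insert (hT s hs), ← h]
        simp
      · rintro rfl; rfl
    rw [hψ, Finsupp.add_apply, hDval s hs, zero_add, Finsupp.single_apply]
    simp only [this]
  have hψs : ∀ s ∈ T, ψ s = D s := by
    intro s hs
    have : ({r} : Finset ℕ) ≠ s := by rintro rfl; exact hT _ hs (by simp)
    rw [hψ, Finsupp.add_apply, Finsupp.single_apply, if_neg this, add_zero]
  have hwsum : ∑ s ∈ T, (‖D s‖ ^ 2 + if s = ∅ then ‖β‖ ^ 2 else 0) = 1 := by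
    have := weight_eq_sum ψ (W := T ∪ T.image (insert r))
      (fun s hs => hsub (by simp only [hS, Finset.mem_insert, Finset.mem_union]; tauto))
    rw [hw, sum_insert_pairs r T hT, NNReal.coe_one] at this
    rw [this]
    refine Finset.sum_congr rfl fun s hs => ?_
    rw [hψs s hs, hψr s hs]
    split_ifs <;> simp
  rw [probOne, NNReal.coe_div, NNReal.coe_add, etot, div_one, e1]
  have hterm : ∀ s ∈ T, ‖φ (insert r s)‖ ^ 2 = (‖D s‖ ^ 2 +
      if s = ∅ then ‖D ∅ - η * β‖ ^ 2 - ‖D ∅‖ ^ 2 else 0) / 2 := by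
    intro s hs
    rw [hval s hs, hψs s hs, hψr s hs, norm_div, div_pow, Complex.norm_real,
      Real.norm_of_nonneg (by positivity), Real.sq_sqrt (by norm_num)]
    split_ifs with h
    · rw [h]; ring
    · simp
  rw [Finset.sum_congr rfl hterm, ← Finset.sum_div, Finset.sum_add_distrib,
    Finset.sum_ite_eq' T ∅, if_pos h0T]
  rw [Finset.sum_add_distrib, Finset.sum_ite_eq' T ∅, if_pos h0T] at hwsum
  linarith

end QState

end QRAM

end

/-! ### Exact operator norms: traces of powers, Newton's identities, largest root. -/

noncomputable section

namespace QRAM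

/-! ### The operator norm of a matrix from traces of powers -/

section Newton

variable {b : ℕ} (x : Fin b → ℝ)

/-- Vieta's formula identifies the coefficient of degree `b - j` with `(-1)^j e_j`, and Newton's
identity for elementary symmetric polynomials and power sums is rewritten accordingly. The sum is
reflected to run upwards in the degree, as the program computes it. -/
theorem newton_coeff {k : ℕ} (hk : k < b) :
    ((k : ℝ) + 1) * (∏ i, (Polynomial.X - Polynomial.C (x i))).coeff (b - (k + 1)) =
      - ∑ i ∈ Finset.range (k + 1),
        (∏ i, (Polynomial.X - Polynomial.C (x i))).coeff (b - k + i) * ∑ l, x l ^ (i + 1) := by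
  set e : ℕ → ℝ := fun j => MvPolynomial.aeval x (MvPolynomial.esymm (Fin b) ℝ j) with he
  have hcard : Multiset.card (Finset.univ.val.map x) = b := by simp
  have hcoeff : ∀ j ≤ b, (∏ i, (Polynomial.X - Polynomial.C (x i))).coeff (b - j) =
      (-1) ^ j * e j := by
    intro j hj
    have := Multiset.prod_X_sub_C_coeff (Finset.univ.val.map x) (k := b - j)
      (by rw [hcard]; omega)
    rw [hcard, Nat.sub_sub_self hj, Multiset.map_map] at this
    rw [he]
    simp only [MvPolynomial.aeval_esymm_eq_multiset_esymm]
    exact this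
  have hN : ((k + 1 : ℕ) : ℝ) * e (k + 1) = (-1) ^ (k + 1 + 1) *
      ∑ a ∈ Finset.HasAntidiagonal.antidiagonal (k + 1) with a.1 < k + 1, (-1) ^ a.1 * e a.1 * ∑ l, x l ^ a.2 := by
    have := congrArg (MvPolynomial.aeval x) (MvPolynomial.mul_esymm_eq_sum (Fin b) ℝ (k + 1))
    simpa only [map_mul, map_natCast, map_pow, map_neg, map_one, map_sum, MvPolynomial.psum,
      MvPolynomial.aeval_X] using this
  rw [Finset.sum_filter, Finset.Nat.sum_antidiagonal_eq_sum_range_succ_mk,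
    Finset.sum_range_succ] at hN
  simp only [lt_self_iff_false, if_false, add_zero] at hN
  rw [hcoeff (k + 1) hk]
  have : ∑ i ∈ Finset.range (k + 1),
      (∏ i, (Polynomial.X - Polynomial.C (x i))).coeff (b - k + i) * ∑ l, x l ^ (i + 1) =
      ∑ j ∈ Finset.range (k + 1), (-1) ^ j * e j * ∑ l, x l ^ (k + 1 - j) := by
    rw [← Finset.sum_range_reflect]
    refine Finset.sum_congr rfl fun j hj => ?_
    rw [Finset.mem_range] at hj
    rw [show b - k + (k + 1 - 1 - j) = b - j by omega, hcoeff j (by omega),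
      show k + 1 - 1 - j + 1 = k + 1 - j by omega]
  rw [this]
  have h2 : ∑ j ∈ Finset.range (k + 1), (if j < k + 1 then
      (-1) ^ j * e j * ∑ l, x l ^ (k + 1 - j) else 0) =
      ∑ j ∈ Finset.range (k + 1), (-1) ^ j * e j * ∑ l, x l ^ (k + 1 - j) :=
    Finset.sum_congr rfl fun j hj => if_pos (Finset.mem_range.1 hj)
  rw [h2] at hN
  push_cast at hN
  calc ((k : ℝ) + 1) * ((-1) ^ (k + 1) * e (k + 1))
      = (-1) ^ (k + 1) * (((k : ℝ) + 1) * e (k + 1)) := by ring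
    _ = _ := by
      rw [hN, ← mul_assoc, ← pow_add, Odd.neg_one_pow ⟨k + 1, by ring⟩, neg_one_mul]

theorem largestRoot_of_coeff {c : ℕ → ℂ}
    (hc : ∀ j ≤ b, c j = ((∏ i, (Polynomial.X - Polynomial.C (x i))).coeff j : ℝ)) :
    largestRoot c b = sSup (Set.range x) := by
  unfold largestRoot
  congr 1
  ext t
  have hdeg : (∏ i, (Polynomial.X - Polynomial.C (x i))).natDegree = b := by
    rw [Polynomial.natDegree_prod_of_monic _ _ fun i _ => Polynomial.monic_X_sub_C _]
    simp
  have : ∑ j ∈ Finset.range (b + 1), (c j).re * t ^ j = ∏ i, (t - x i) := by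
    have h := Polynomial.eval_eq_sum_range (p := ∏ i, (Polynomial.X - Polynomial.C (x i))) t
    rw [hdeg, Polynomial.eval_prod] at h
    simp only [Polynomial.eval_sub, Polynomial.eval_X, Polynomial.eval_C] at h
    rw [h]
    refine Finset.sum_congr rfl fun j hj => ?_
    rw [hc j (by rw [Finset.mem_range] at hj; omega), Complex.ofReal_re]
  rw [Set.mem_ofPred_eq, this, Finset.prod_eq_zero_iff]
  simp only [Finset.mem_univ, true_and, sub_eq_zero, Set.mem_range]
  exact ⟨fun ⟨i, h⟩ => ⟨i, h.symm⟩, fun ⟨i, h⟩ => ⟨i, h.symm⟩⟩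

end Newton

open scoped Matrix Matrix.Norms.L2Operator ComplexOrder

/-- The matrix with the entries `A w u`, `w < a`, `u < b`. -/
def toMat (a b : ℕ) (A : ℕ → ℕ → ℂ) : Matrix (Fin a) (Fin b) ℂ := Matrix.of fun w u => A w u

theorem trace_pow_eq_sum_eigenvalues {b : ℕ} {M : Matrix (Fin b) (Fin b) ℂ} (hM : M.IsHermitian)
    (k : ℕ) : (M ^ k).trace = ((∑ i, hM.eigenvalues i ^ k : ℝ) : ℂ) := by
  conv_lhs => rw [hM.spectral_theorem, ← map_pow, Unitary.conjStarAlgAut_apply]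
  rw [Matrix.trace_mul_comm, ← mul_assoc]
  simp [Matrix.diagonal_pow, Matrix.trace]

/-- Unitary conjugation reduces this to the diagonal of eigenvalues, whose norm is their sup norm;
positivity removes the absolute values. -/
theorem norm_eq_sSup_eigenvalues {b : ℕ} {M : Matrix (Fin b) (Fin b) ℂ} (hM : M.PosSemidef)
    (hb : 0 < b) : ‖M‖ = sSup (Set.range hM.1.eigenvalues) := by
  have : Nonempty (Fin b) := ⟨⟨0, hb⟩⟩
  have h1 : ‖M‖ = ‖(Complex.ofReal ∘ hM.1.eigenvalues : Fin b → ℂ)‖ := by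
    conv_lhs => rw [hM.1.spectral_theorem, Unitary.conjStarAlgAut_apply]
    rw [← Matrix.l2_opNorm_diagonal, CStarRing.norm_mul_mem_unitary _ (Unitary.star_mem (Subtype.prop _)),
      CStarRing.norm_mem_unitary_mul _ (Subtype.prop _)]
    rfl
  rw [h1]
  refine le_antisymm ?_ ?_
  · rw [pi_norm_le_iff_of_nonempty]
    intro i
    rw [Function.comp_apply, Complex.norm_real, Real.norm_of_nonneg (hM.eigenvalues_nonneg i)]
    exact le_csSup (Set.finite_range _).bddAbove ⟨i, rfl⟩
  · refine csSup_le (Set.range_nonempty _) ?_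
    rintro _ ⟨i, rfl⟩
    refine le_trans ?_ (norm_le_pi_norm _ i)
    rw [Function.comp_apply, Complex.norm_real]
    exact le_abs_self _

/-- One multiplication by `Aᴴ A`. -/
def gramStep (a b : ℕ) (A : ℕ → ℕ → ℂ) (v : ℕ → ℂ) (x : ℕ) : ℂ :=
  ∑ w ∈ Finset.range a, (starRingEnd ℂ) (A w x) * ∑ x' ∈ Finset.range b, A w x' * v x'

/-- The column `u` of `(Aᴴ A) ^ k`. -/
def gramColumn (a b : ℕ) (A : ℕ → ℕ → ℂ) (u : ℕ) : ℕ → ℕ → ℂ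
  | 0 => fun x => if x = u then 1 else 0
  | k + 1 => gramStep a b A (gramColumn a b A u k)

/-- The trace of `(Aᴴ A) ^ (k + 1)`. -/
def gramTrace (a b : ℕ) (A : ℕ → ℕ → ℂ) (k : ℕ) : ℂ :=
  ∑ u ∈ Finset.range b, gramColumn a b A u (k + 1) u

theorem gramColumn_eq (a b : ℕ) (A : ℕ → ℕ → ℂ) (k : ℕ) (u x : Fin b) :
    gramColumn a b A u k x = (((toMat a b A)ᴴ * toMat a b A) ^ k) x u := by
  induction k generalizing x with
  | zero => simp [gramColumn, Matrix.one_apply, Fin.ext_iff]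
  | succ k ih =>
    rw [pow_succ', Matrix.mul_assoc, Matrix.mul_apply, gramColumn, gramStep, Finset.sum_range]
    refine Finset.sum_congr rfl fun w _ => ?_
    rw [Matrix.mul_apply, Finset.sum_range]
    simp only [ih]
    rfl

theorem gramTrace_eq (a b : ℕ) (A : ℕ → ℕ → ℂ) (k : ℕ) :
    gramTrace a b A k = (((toMat a b A)ᴴ * toMat a b A) ^ (k + 1)).trace := by
  rw [gramTrace, Finset.sum_range, Matrix.trace]
  exact Finset.sum_congr rfl fun u _ => gramColumn_eq a b A _ u u

/-- The hypotheses on `c` are the recursion executed by `coeffProg`. By Newton's identities it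
determines the characteristic polynomial of `Aᴴ A` from the leading coefficient downwards, and the
largest eigenvalue of `Aᴴ A` is `‖A‖²`. -/
theorem sqrt_largestRoot_eq_norm {a b : ℕ} (hb : 0 < b) (A : ℕ → ℕ → ℂ) {c : ℕ → ℂ} (h1 : c b = 1)
    (h2 : ∀ k < b, c (b - (k + 1)) =
      0 - (∑ i ∈ Finset.range (k + 1), c (b - k + i) * gramTrace a b A i) / ((k + 1 : ℕ) : ℂ)) :
    Real.sqrt (largestRoot c b) = ‖toMat a b A‖ := by
  set M := (toMat a b A)ᴴ * toMat a b A with hM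
  have hpos : M.PosSemidef := Matrix.posSemidef_conjTranspose_mul_self _
  set x := hpos.1.eigenvalues with hx
  have htr : ∀ i, gramTrace a b A i = ((∑ l, x l ^ (i + 1) : ℝ) : ℂ) := fun i => by
    rw [gramTrace_eq, trace_pow_eq_sum_eigenvalues hpos.1]
  have hmon : (∏ i, (Polynomial.X - Polynomial.C (x i))).coeff b = 1 := by
    have hm : (∏ i, (Polynomial.X - Polynomial.C (x i))).Monic :=
      Polynomial.monic_prod_of_monic _ _ fun i _ => Polynomial.monic_X_sub_C _
    have hdeg : (∏ i, (Polynomial.X - Polynomial.C (x i))).natDegree = b := by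
      rw [Polynomial.natDegree_prod_of_monic _ _ fun i _ => Polynomial.monic_X_sub_C _]
      simp
    have := hm.coeff_natDegree
    rwa [hdeg] at this
  have key : ∀ k ≤ b, c (b - k) = ((∏ i, (Polynomial.X - Polynomial.C (x i))).coeff (b - k) : ℝ) := by
    intro k
    induction k using Nat.strong_induction_on with
    | _ k ih =>
      intro hk
      rcases k with _ | k
      · simp [h1, hmon]
      · rw [h2 k hk]
        have hn := newton_coeff x hk
        have hk1 : ((k : ℝ) + 1) ≠ 0 := by positivity
        rw [mul_comm, ← eq_div_iff hk1] at hn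
        rw [hn]
        push_cast
        rw [zero_sub, neg_div]
        congr 2
        refine Finset.sum_congr rfl fun i hi => ?_
        rw [Finset.mem_range] at hi
        have := ih (k - i) (by omega) (by omega)
        rw [show b - (k - i) = b - k + i by omega] at this
        rw [this, htr]
        push_cast
        rfl
  rw [largestRoot_of_coeff x (fun j hj => by
    have := key (b - j) (by omega)
    rwa [Nat.sub_sub_self hj] at this), ← norm_eq_sSup_eigenvalues hpos hb, hM,
    Matrix.l2_opNorm_conjTranspose_mul_self, Real.sqrt_mul_self (norm_nonneg _)]

end QRAM

end

/-! ### Linear algebra of the elimination: applying a contraction by plane rotations. -/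

noncomputable section

namespace QRAM

open Complex (normSq)
open scoped ComplexConjugate

/-! ### Elimination of the rows of a contraction by rotations of columns -/

/-- The rows of `X` define a contraction. -/
def RowContraction (a b : ℕ) (X : ℕ → ℕ → ℂ) : Prop :=
  ∀ v : ℕ → ℂ, ∑ u ∈ Finset.range b, normSq (∑ w ∈ Finset.range a, v w * X w u) ≤
    ∑ w ∈ Finset.range a, normSq (v w)

section Norm

open scoped Matrix Matrix.Norms.L2Operator

/-- The combination of the rows of `A` with coefficients `v` is the conjugate of `Aᴴ` applied to
`conj v`, and `‖Aᴴ‖ = ‖A‖`. -/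
theorem rowContraction_of_norm {a b : ℕ} {A X : ℕ → ℕ → ℂ} (h : 0 < ‖toMat a b A‖)
    (hX : ∀ w < a, ∀ u < b, X w u = A w u / (‖toMat a b A‖ : ℂ)) : RowContraction a b X := by
  intro v
  set ν := ‖toMat a b A‖ with hν
  set y : EuclideanSpace ℂ (Fin a) := WithLp.toLp 2 fun w => conj (v w) with hy
  have h1 := Matrix.l2_opNorm_mulVec (toMat a b A)ᴴ y
  rw [Matrix.l2_opNorm_conjTranspose, ← hν] at h1
  have h2 : ‖y‖ ^ 2 = ∑ w ∈ Finset.range a, normSq (v w) := by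
    rw [EuclideanSpace.norm_sq_eq, Finset.sum_range]
    refine Finset.sum_congr rfl fun w _ => ?_
    simp [hy, Complex.normSq_eq_norm_sq]
  have h3 : ‖WithLp.toLp 2 ((toMat a b A)ᴴ *ᵥ y.ofLp)‖ ^ 2 =
      ν ^ 2 * ∑ u ∈ Finset.range b, normSq (∑ w ∈ Finset.range a, v w * X w u) := by
    rw [EuclideanSpace.norm_sq_eq, Finset.sum_range, Finset.mul_sum]
    refine Finset.sum_congr rfl fun u _ => ?_
    have : (∑ w ∈ Finset.range a, v w * X w u) =
        conj (((toMat a b A)ᴴ *ᵥ y.ofLp) u) / (ν : ℂ) := by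
      rw [Finset.sum_range, Matrix.mulVec, dotProduct, map_sum, Finset.sum_div]
      refine Finset.sum_congr rfl fun w _ => ?_
      rw [hX w w.2 u u.2]
      simp [hy, toMat]
      ring
    rw [this, Complex.normSq_eq_norm_sq, norm_div, Complex.norm_conj, Complex.norm_real,
      Real.norm_of_nonneg h.le, div_pow, mul_div_cancel₀ _ (by positivity)]
  have h4 := pow_le_pow_left₀ (norm_nonneg _) h1 2
  change ‖WithLp.toLp 2 ((toMat a b A)ᴴ *ᵥ y.ofLp)‖ ^ 2 ≤ _ at h4
  rw [h3, mul_pow, h2] at h4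
  exact le_of_mul_le_mul_left h4 (by positivity)

end Norm

theorem sum_range_change {M : Type*} [AddCommGroup M] {b j : ℕ} (hj : j < b) {f g : ℕ → M}
    (h : ∀ u < b, u ≠ j → g u = f u) :
    ∑ u ∈ Finset.range b, g u = ∑ u ∈ Finset.range b, f u - f j + g j := by
  rw [← Finset.add_sum_erase _ f (Finset.mem_range.2 hj),
    ← Finset.add_sum_erase _ g (Finset.mem_range.2 hj)]
  have : ∑ u ∈ (Finset.range b).erase j, g u = ∑ u ∈ (Finset.range b).erase j, f u :=
    Finset.sum_congr rfl fun u hu => by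
      rw [Finset.mem_erase, Finset.mem_range] at hu
      exact h u hu.2 hu.1
  rw [this]
  abel

theorem sum_normSq_add_mul (S : Finset ℕ) (p r : ℕ → ℂ) (t : ℂ) :
    ∑ u ∈ S, normSq (p u + t * r u) = ∑ u ∈ S, normSq (p u) + normSq t * ∑ u ∈ S, normSq (r u) +
      2 * (conj t * ∑ u ∈ S, p u * conj (r u)).re := by
  simp only [Complex.normSq_add, Finset.sum_add_distrib, map_mul,
    Finset.mul_sum, Complex.re_sum]
  congr 1
  refine Finset.sum_congr rfl fun u _ => ?_
  ring_nf

/-- The rows before `y` are eliminated. The functional given by row `w` of `X`, and by `γ w` for the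
eliminated rows, has kept its value on the vectors `α`. -/
structure ElimOuter (a b : ℕ) (A : ℕ → ℕ → ℂ) (y : ℕ) (X α γ : ℕ → ℕ → ℂ) : Prop where
  contraction : RowContraction a b X
  value : ∀ w < a, ∀ z < b,
    ∑ u ∈ Finset.range b, X w u * α u z + (if w < y then γ w z else 0) = A w z
  unused : ∀ w, y ≤ w → ∀ z < b, γ w z = 0
  done : ∀ w < y, ∀ u < b, X w u = 0

/-- The entries of row `y` before `j` are eliminated with the help of the additional column `κ`. -/
structure ElimInner (a b : ℕ) (A : ℕ → ℕ → ℂ) (y j : ℕ) (X : ℕ → ℕ → ℂ) (κ : ℕ → ℂ)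
    (α γ : ℕ → ℕ → ℂ) : Prop where
  ortho : ∀ w < a, ∑ u ∈ Finset.range b, X w u * conj (X y u) + κ w * conj (κ y) =
    if w = y then 1 else 0
  value : ∀ w < a, ∀ z < b,
    ∑ u ∈ Finset.range b, X w u * α u z + (if w < y then γ w z else 0) + κ w * γ y z = A w z
  unused : ∀ w, y < w → ∀ z < b, γ w z = 0
  done : ∀ w < y, κ w = 0 ∧ ∀ u < b, X w u = 0
  zero : ∀ u < j, u < b → X y u = 0
  contraction : ∀ v : ℕ → ℂ, v y = 0 →
    ∑ u ∈ Finset.range b, normSq (∑ w ∈ Finset.range a, v w * X w u) +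
      normSq (∑ w ∈ Finset.range a, v w * κ w) ≤ ∑ w ∈ Finset.range a, normSq (v w)
  pivot : ∃ k : ℝ, 0 ≤ k ∧ κ y = k

variable {a b y j : ℕ} {A X α γ : ℕ → ℕ → ℂ}

theorem ElimOuter.init (h : RowContraction a b A) :
    ElimOuter a b A 0 A (fun u z => if u = z then 1 else 0) fun _ _ => 0 where
  contraction := h
  value w _ z hz := by
    have : z ∈ Finset.range b := Finset.mem_range.2 hz
    simp [hz]
  unused _ _ _ _ := rfl
  done w hw := by omega

theorem RowContraction.row_le (h : RowContraction a b X) (hy : y < a) :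
    ∑ u ∈ Finset.range b, normSq (X y u) ≤ 1 := by
  have := h (fun w => if w = y then 1 else 0)
  have hy' : y ∈ Finset.range a := Finset.mem_range.2 hy
  simpa [hy, apply_ite normSq] using this

/-- The contraction inequality at `v + t e_y`, expanded. The free coefficient `t` is chosen
optimally in `ElimOuter.inner`. -/
theorem RowContraction.add_single (h : RowContraction a b X) (hy : y < a) (v : ℕ → ℂ)
    (hv : v y = 0) (t : ℂ) :
    ∑ u ∈ Finset.range b, normSq (∑ w ∈ Finset.range a, v w * X w u) +
      normSq t * ∑ u ∈ Finset.range b, normSq (X y u) +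
      2 * (conj t * ∑ w ∈ Finset.range a,
        v w * ∑ u ∈ Finset.range b, X w u * conj (X y u)).re ≤
      ∑ w ∈ Finset.range a, normSq (v w) + normSq t := by
  have hy' : y ∈ Finset.range a := Finset.mem_range.2 hy
  have := h (fun w => v w + if w = y then t else 0)
  have e1 : ∀ u, ∑ w ∈ Finset.range a, (v w + if w = y then t else 0) * X w u =
      (∑ w ∈ Finset.range a, v w * X w u) + t * X y u := fun u => by
    simp [add_mul, Finset.sum_add_distrib, ite_mul, hy]
  have e2 : ∑ w ∈ Finset.range a, normSq (v w + if w = y then t else 0) =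
      ∑ w ∈ Finset.range a, normSq (v w) + normSq t := by
    rw [sum_range_change hy (f := fun w => normSq (v w))]
    · simp [hv]
    · intro u _ hu
      simp [hu]
  simp only [e1] at this
  rw [e2, sum_normSq_add_mul] at this
  refine le_trans (le_of_eq ?_) this
  congr 4
  simp only [Finset.mul_sum, Finset.sum_mul]
  rw [Finset.sum_comm]
  simp only [mul_assoc]

/-- The column `κ` is the one that gives row `y` norm one and makes it orthogonal to the other rows.
The substance is that the other rows remain a contraction with `κ` included. This is a Schur
complement argument: optimize over the coefficient of row `y`. -/
theorem ElimOuter.inner (h : ElimOuter a b A y X α γ) (hy : y < a) {κ : ℕ → ℂ} {k : ℝ}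
    (hk : k = Real.sqrt (1 - ∑ u ∈ Finset.range b, normSq (X y u)))
    (hκ : ∀ w < a, κ w = if w = y then (k : ℂ) else
      (0 - ∑ u ∈ Finset.range b, X w u * conj (X y u)) / k) :
    ElimInner a b A y 0 X κ α γ := by
  have hrow := h.contraction.row_le hy
  have hk0 : 0 ≤ k := by rw [hk]; positivity
  have hk2 : k ^ 2 = 1 - ∑ u ∈ Finset.range b, normSq (X y u) := by
    rw [hk, Real.sq_sqrt (by linarith)]
  have hκy : κ y = k := by rw [hκ y hy, if_pos rfl]
  have hself : ∑ u ∈ Finset.range b, X y u * conj (X y u) = ((1 - k ^ 2 : ℝ) : ℂ) := by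
    simp only [Complex.mul_conj]
    rw [hk2, ← Complex.ofReal_sum]
    simp
  have hortho : ∀ w < a, w ≠ y → ∑ u ∈ Finset.range b, X w u * conj (X y u) = - κ w * k := by
    intro w hw hwy
    rw [hκ w hw, if_neg hwy]
    -- If `k = 0`, row `y` already has norm one, and division by zero makes `κ` vanish.
    -- Orthogonality then has to come from the contraction property, tested on `conj G` times row
    -- `w` plus row `y`.
    by_cases hkz : k = 0
    · rw [hkz]
      set G := ∑ u ∈ Finset.range b, X w u * conj (X y u) with hG
      have hw' : w ∈ Finset.range a := Finset.mem_range.2 hw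
      have := h.contraction.add_single hy (fun w' => if w' = w then conj G else 0)
        (by simp [hwy.symm]) 1
      rw [hkz] at hk2
      have hrow1 : ∑ u ∈ Finset.range b, normSq (X y u) = 1 := by linarith
      rw [hrow1] at this
      simp only [ite_mul, zero_mul, Finset.sum_ite_eq', hw', if_true, map_one, one_mul,
        apply_ite normSq, map_zero, ← hG] at this
      rw [mul_comm (conj G), Complex.mul_conj, Complex.ofReal_re, Complex.normSq_conj] at this
      have hs : 0 ≤ ∑ u ∈ Finset.range b, normSq (conj G * X w u) :=
        Finset.sum_nonneg fun _ _ => Complex.normSq_nonneg _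
      have : normSq G ≤ 0 := by linarith
      have := Complex.normSq_eq_zero.1 (le_antisymm this (Complex.normSq_nonneg _))
      rw [this]
      simp
    · have : (k : ℂ) ≠ 0 := Complex.ofReal_ne_zero.2 hkz
      field_simp
      ring
  refine ⟨?_, ?_, ?_, ?_, ?_, ?_, k, hk0, hκy⟩
  · intro w hw
    rw [hκy, Complex.conj_ofReal]
    split_ifs with hwy
    · rw [hwy, hself, hκy]
      push_cast
      ring
    · rw [hortho w hw hwy]
      ring
  · intro w hw z hz
    rw [h.unused y le_rfl z hz, mul_zero, add_zero, h.value w hw z hz]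
  · intro w hw
    exact h.unused w hw.le
  · intro w hw
    refine ⟨?_, h.done w hw⟩
    rw [hκ w (by omega), if_neg (by omega), Finset.sum_eq_zero]
    · simp
    · intro u hu
      rw [h.done w hw u (Finset.mem_range.1 hu), zero_mul]
  · intro u hu
    omega
  · intro v hv
    by_cases hkz : k = 0
    · have : ∀ w < a, κ w = 0 := by
        intro w hw
        rw [hκ w hw, hkz]
        simp
      rw [Finset.sum_eq_zero (f := fun w => v w * κ w)]
      · simpa using h.contraction v
      · intro w hw
        rw [this w (Finset.mem_range.1 hw), mul_zero]
    · set S := ∑ w ∈ Finset.range a, v w * κ w with hS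
      have hkc : (k : ℂ) ≠ 0 := Complex.ofReal_ne_zero.2 hkz
      -- This maximizes `2 Re (conj t * W) - k² |t|²`, the gain in `add_single`, where `W = - k * S`
      -- is the sum evaluated below.
      set t : ℂ := - S / k with ht
      have hSt : S = - (k * t) := by
        rw [ht]
        field_simp
      have := h.contraction.add_single hy v hv t
      have e : ∑ w ∈ Finset.range a, v w * ∑ u ∈ Finset.range b, X w u * conj (X y u) =
          (k ^ 2 : ℝ) * t := by
        have : ∑ w ∈ Finset.range a, v w * ∑ u ∈ Finset.range b, X w u * conj (X y u) =
            ∑ w ∈ Finset.range a, - k * (v w * κ w) := by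
          refine Finset.sum_congr rfl fun w hw => ?_
          by_cases hwy : w = y
          · rw [hwy, hv]; simp
          · rw [hortho w (Finset.mem_range.1 hw) hwy]; ring
        rw [this, ← Finset.mul_sum, ← hS, hSt]
        push_cast
        ring
      rw [e, show conj t * ((k ^ 2 : ℝ) * t) = ((k ^ 2 * normSq t : ℝ) : ℂ) by
        rw [Complex.ofReal_mul, Complex.normSq_eq_conj_mul_self]; ring, Complex.ofReal_re] at this
      rw [hSt, Complex.normSq_neg, Complex.normSq_mul, Complex.normSq_ofReal]
      have h1 : ∑ u ∈ Finset.range b, normSq (X y u) = 1 - k ^ 2 := by linarith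
      rw [h1] at this
      nlinarith

variable {κ : ℕ → ℂ}

/-- Row `y` is now concentrated in its pivot, which is nonnegative, so norm one forces `κ y = 1`.
Orthogonality to row `y` then gives `κ w = 0` for all other rows. The column can be dropped, and `γ
y` alone carries the value of row `y`. -/
theorem ElimInner.outer (h : ElimInner a b A y b X κ α γ) (hy : y < a) :
    ElimOuter a b A (y + 1) X α γ := by
  obtain ⟨k, hk0, hk⟩ := h.pivot
  have hz : ∀ u ∈ Finset.range b, X y u = 0 := fun u hu =>
    h.zero u (Finset.mem_range.1 hu) (Finset.mem_range.1 hu)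
  have ho : ∀ w < a, κ w * conj (κ y) = if w = y then 1 else 0 := by
    intro w hw
    rw [← h.ortho w hw, Finset.sum_eq_zero, zero_add]
    intro u hu
    rw [hz u hu]
    simp
  have hk1 : k = 1 := by
    have := ho y hy
    rw [if_pos rfl, hk, Complex.conj_ofReal, ← Complex.ofReal_mul, Complex.ofReal_eq_one] at this
    nlinarith
  have hκy : κ y = 1 := by rw [hk, hk1, Complex.ofReal_one]
  have hκ : ∀ w < a, w ≠ y → κ w = 0 := by
    intro w hw hwy
    have := ho w hw
    rwa [if_neg hwy, hκy, map_one, mul_one] at this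
  refine ⟨?_, ?_, ?_, ?_⟩
  · intro v
    -- Contraction with the additional column is known only for combinations without row `y`; on the
    -- columns before `b` that row has become zero and makes no difference.
    have := h.contraction (Function.update v y 0) (by simp)
    have e1 : ∀ u ∈ Finset.range b, ∑ w ∈ Finset.range a, Function.update v y 0 w * X w u =
        ∑ w ∈ Finset.range a, v w * X w u := by
      intro u hu
      refine Finset.sum_congr rfl fun w _ => ?_
      by_cases hwy : w = y
      · rw [hwy, hz u hu, mul_zero, mul_zero]
      · rw [Function.update_of_ne hwy]
    rw [Finset.sum_congr rfl fun u hu => congrArg normSq (e1 u hu)] at this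
    refine le_trans (le_add_of_nonneg_right (Complex.normSq_nonneg _)) (this.trans ?_)
    refine Finset.sum_le_sum fun w _ => ?_
    by_cases hwy : w = y
    · rw [hwy, Function.update_self, map_zero]
      exact Complex.normSq_nonneg _
    · rw [Function.update_of_ne hwy]
  · intro w hw z hz'
    rw [← h.value w hw z hz', add_assoc]
    congr 1
    by_cases hwy : w = y
    · simp [hwy, hκy]
    · rw [hκ w hw hwy, zero_mul, add_zero]
      by_cases hlt : w < y
      · rw [if_pos hlt, if_pos (by omega)]
      · rw [if_neg hlt, if_neg (by omega)]
  · intro w hw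
    exact h.unused w hw
  · intro w hw u hu
    by_cases hwy : w = y
    · rw [hwy]
      exact hz u (Finset.mem_range.2 hu)
    · exact (h.done w (by omega)).2 u hu

theorem ElimInner.skip (h : ElimInner a b A y j X κ α γ) (h0 : X y j = 0) :
    ElimInner a b A y (j + 1) X κ α γ :=
  ⟨h.ortho, h.value, h.unused, h.done, fun u hu hb => by
    by_cases huj : u = j
    · rw [huj, h0]
    · exact h.zero u (by omega) hb, h.contraction, h.pivot⟩

/-- The rotation that eliminates the entry `x` with the pivot `k`, on vectors. -/
def rotMatrix (x : ℂ) (k r : ℝ) : Matrix (Fin 2) (Fin 2) ℂ :=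
  !![(k : ℂ) / r, (0 - conj x) / r; x / r, (k : ℂ) / r]

theorem rotMatrix_mem {x : ℂ} {k r : ℝ} (hr : r ≠ 0) (h : r ^ 2 = normSq x + k ^ 2) :
    rotMatrix x k r ∈ Matrix.unitaryGroup (Fin 2) ℂ := by
  have hrc : (r : ℂ) ≠ 0 := Complex.ofReal_ne_zero.2 hr
  have hc : (r : ℂ) ^ 2 = x * conj x + (k : ℂ) ^ 2 := by
    rw [Complex.mul_conj, ← Complex.ofReal_pow, h]
    push_cast
    rfl
  rw [Matrix.mem_unitaryGroup_iff]
  ext i j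
  fin_cases i <;> fin_cases j <;>
    simp [rotMatrix, Matrix.mul_apply, Fin.sum_univ_two, Matrix.star_apply] <;>
    field_simp <;> simp only [hc] <;> ring

/-- A unitary acts on the coordinates `(α j, γ y)` of the vectors, and its inverse on the entries
`(X w j, κ w)` of the functionals. All pairings, inner products of rows and norms of combinations
survive. The angle is chosen such that the entry `X y j` becomes zero and the pivot becomes `r ≥ 0`.
-/
theorem ElimInner.step (h : ElimInner a b A y j X κ α γ) (hj : j < b) {k r : ℝ}
    (hk : κ y = k) (hr : 0 < r) (hr2 : r ^ 2 = normSq (X y j) + k ^ 2)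
    {X' : ℕ → ℕ → ℂ} {κ' : ℕ → ℂ} {α' γ' : ℕ → ℕ → ℂ}
    (hX : ∀ w u, X' w u = if u = j then (X w j * k - κ w * X y j) / r else X w u)
    (hκ : ∀ w, κ' w = (X w j * conj (X y j) + κ w * k) / r)
    (hα : ∀ u z, α' u z = if u = j then (k : ℂ) / r * α j z + (0 - conj (X y j)) / r * γ y z
      else α u z)
    (hγ : ∀ w z, γ' w z = if w = y then X y j / r * α j z + (k : ℂ) / r * γ y z else γ w z) :
    ElimInner a b A y (j + 1) X' κ' α' γ' := by
  set x := X y j with hx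
  have hrc : (r : ℂ) ≠ 0 := Complex.ofReal_ne_zero.2 hr.ne'
  have hc : (r : ℂ) ^ 2 = x * conj x + (k : ℂ) ^ 2 := by
    rw [Complex.mul_conj, ← Complex.ofReal_pow, hr2]
    push_cast
    rfl
  have hXj : ∀ w, X' w j = (X w j * k - κ w * x) / r := fun w => by rw [hX, if_pos rfl]
  have hXn : ∀ w u, u ≠ j → X' w u = X w u := fun w u hu => by rw [hX, if_neg hu]
  have hαj : ∀ z, α' j z = (k : ℂ) / r * α j z + (0 - conj x) / r * γ y z := fun z => by
    rw [hα, if_pos rfl]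
  have hαn : ∀ u z, u ≠ j → α' u z = α u z := fun u z hu => by rw [hα, if_neg hu]
  have hγy : ∀ z, γ' y z = x / r * α j z + (k : ℂ) / r * γ y z := fun z => by rw [hγ, if_pos rfl]
  have hγn : ∀ w z, w ≠ y → γ' w z = γ w z := fun w z hw => by rw [hγ, if_neg hw]
  have hXy : X' y j = 0 := by rw [hXj, hk, ← hx, mul_comm, sub_self, zero_div]
  have hκy : κ' y = r := by
    rw [hκ, hk, ← hx, div_eq_iff hrc, ← pow_two (r : ℂ), hc]
    ring
  refine ⟨?_, ?_, ?_, ?_, ?_, ?_, r, hr.le, hκy⟩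
  · intro w hw
    rw [← h.ortho w hw, sum_range_change hj (f := fun u => X w u * conj (X y u))
      (fun u _ hu => by rw [hXn w u hu, hXn y u hu]), hXy, hκy, hκ, hk, ← hx]
    simp only [map_zero, mul_zero, add_zero, Complex.conj_ofReal]
    rw [div_mul_cancel₀ _ hrc]
    ring
  · intro w hw z hz
    rw [← h.value w hw z hz, sum_range_change hj (f := fun u => X w u * α u z)
      (fun u _ hu => by rw [hXn w u hu, hαn u z hu]), hγy, hXj, hαj, hκ]
    have e : (if w < y then γ' w z else 0) = if w < y then γ w z else 0 := by
      split_ifs with hlt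
      · rw [hγn w z hlt.ne]
      · rfl
    rw [e]
    have : (X w j * k - κ w * x) / r * ((k : ℂ) / r * α j z + (0 - conj x) / r * γ y z) +
        (X w j * conj x + κ w * k) / r * (x / r * α j z + (k : ℂ) / r * γ y z) =
        X w j * α j z + κ w * γ y z := by
      field_simp
      rw [hc]
      ring
    linear_combination this
  · intro w hw z hz
    rw [hγn w z (by omega)]
    exact h.unused w hw z hz
  · intro w hw
    obtain ⟨h1, h2⟩ := h.done w hw
    refine ⟨by rw [hκ, h1, h2 j hj]; simp, fun u hu => ?_⟩
    by_cases huj : u = j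
    · rw [huj, hXj, h1, h2 j hj]; simp
    · rw [hXn w u huj, h2 u hu]
  · intro u hu hb
    by_cases huj : u = j
    · rw [huj, hXy]
    · rw [hXn y u huj]
      exact h.zero u (by omega) hb
  · intro v hv
    refine le_trans (le_of_eq ?_) (h.contraction v hv)
    rw [sum_range_change hj (f := fun u => normSq (∑ w ∈ Finset.range a, v w * X w u))
      (fun u _ hu => by simp only [hXn _ u hu])]
    set P := ∑ w ∈ Finset.range a, v w * X w j with hP
    set K := ∑ w ∈ Finset.range a, v w * κ w with hK
    have e1 : ∑ w ∈ Finset.range a, v w * X' w j = (P * k - K * x) / r := by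
      simp only [hXj, hP, hK, Finset.sum_mul, ← Finset.sum_sub_distrib, Finset.sum_div]
      exact Finset.sum_congr rfl fun w _ => by ring
    have e2 : ∑ w ∈ Finset.range a, v w * κ' w = (P * conj x + K * k) / r := by
      simp only [hκ, hP, hK, Finset.sum_mul, ← Finset.sum_add_distrib, Finset.sum_div]
      exact Finset.sum_congr rfl fun w _ => by ring
    rw [e1, e2]
    have : normSq ((P * k - K * x) / r) + normSq ((P * conj x + K * k) / r) =
        normSq P + normSq K := by
      rw [Complex.normSq_div, Complex.normSq_div, Complex.normSq_ofReal, ← add_div,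
        div_eq_iff (by positivity)]
      apply Complex.ofReal_injective
      push_cast
      simp only [Complex.normSq_eq_conj_mul_self, map_sub, map_add, map_mul,
        Complex.conj_ofReal, Complex.conj_conj]
      rw [← pow_two (r : ℂ), hc]
      ring
    linarith

end QRAM

end

/-! ### Index computations at one vertex: powers, incident edges, positions of entries. -/

noncomputable section

namespace QRAM

open State

/-- Writes the powers `q ^ j`, `j ≤ degree`, to the array `10`. -/
def powersProg : Prog := block [
  .setNat 10 (.lit 0) (.lit 1),
  forTo 20 (.get 1 (var 3)) (block [
    .setNat 10 (.add (var 20) (.lit 1)) (.lit 0),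
    forTo 21 (.get 0 (.lit 0))
      (.setNat 10 (.add (var 20) (.lit 1))
        (.add (.get 10 (.add (var 20) (.lit 1))) (.get 10 (var 20))))])]

/-- Index arithmetic has no multiplication, so each power comes from the preceding one by `q`
additions. The bound `q ≤ D` is required only if there is an edge, since for an edgeless graph `D =
q ^ 0` may be smaller than `q`. -/
theorem runs_powersProg {s : State} {q d D : ℕ} (hq : s.nat 0 0 = q) (hd : s.nat 1 (s.nat 3 0) = d)
    (hdD : d ≤ D) (hqD : 0 < d → q ≤ D) :
    Runs powersProg s (D * (D * 3 + 6) + 4) fun s' =>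
      SameOutside [10, 20, 21] [] s s' ∧ s'.qubits = s.qubits ∧ ∀ j ≤ d, s'.nat 10 j = q ^ j := by
  refine Runs.le (Runs.block_cons (Runs.setNat (Runs.block_cons (Runs.forTo (τ := D * 3 + 4) d D hdD
    (fun k s' => SameOutside [10, 20, 21] [] s s' ∧ s'.qubits = s.qubits ∧ s'.nat 20 0 = k ∧
      ∀ j ≤ k, s'.nat 10 j = q ^ j) ?_ ?_ ?_ fun s' hs => Runs.block_nil
        ⟨hs.1, hs.2.1, hs.2.2.2⟩)))) (by ring_nf; omega)
  · refine ⟨((SameOutside.refl _ _ _).setNat (by simp)).setNat (by simp), rfl, by simp, ?_⟩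
    intro j hj
    simp [NatExp.eval, Nat.le_zero.1 hj]
  · rintro k s' ⟨hf, -, hk, -⟩
    refine ⟨hk, ?_⟩
    simp [NatExp.eval, hf.1, hd]
  · rintro k hk s' ⟨hf, hqu, hk', hp⟩
    refine Runs.le (Runs.block_cons (Runs.setNat (Runs.block_cons (τ' := 1)
      (Runs.forTo (τ := 1) q D (hqD (by omega))
      (fun y s' => SameOutside [10, 20, 21] [] s s' ∧ s'.qubits = s.qubits ∧ s'.nat 20 0 = k ∧
        s'.nat 21 0 = y ∧ (∀ j ≤ k, s'.nat 10 j = q ^ j) ∧ s'.nat 10 (k + 1) = y * q ^ k)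
      ?_ ?_ ?_ ?_)))) (by omega)
    · refine ⟨(hf.setNat (by simp)).setNat (by simp), hqu, by simp [hk'], by simp, ?_, ?_⟩
      · intro j hj
        have : j ≠ k + 1 := by omega
        simp [NatExp.eval, hk', this, hp j hj]
      · simp [NatExp.eval, hk']
    · rintro y s' ⟨hf, -, -, hy, -⟩
      refine ⟨hy, ?_⟩
      simp [NatExp.eval, hf.1, hq]
    · rintro y hy s' ⟨hf, hqu, hk', hy', hp, hp'⟩
      refine Runs.setNat ⟨by simp [hy'], (hf.setNat (by simp)).setNat (by simp), hqu,
        by simp [hk'], by simp, ?_, ?_⟩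
      · intro j hj
        have : j ≠ k + 1 := by omega
        simp [NatExp.eval, hk', this, hp j hj]
      · simp [NatExp.eval, hk', hp k le_rfl, hp']
        ring
    · rintro s' ⟨hf, hqu, hk', hy', hp, hp'⟩
      refine Runs.block_nil ⟨hk', hf.setNat (by simp), hqu, by simp, ?_⟩
      intro j hj
      rcases Nat.lt_or_eq_of_le hj with h | rfl
      · simp [hp j (by omega)]
      · simp [hp', pow_succ, mul_comm]


/-! ### The edges at a vertex -/

/-- The numbers `0, …, d - 1` of the edges `ed` at a vertex are split into those of the marked edges,
listed in `inP`, and those of the other edges, listed in `outP`. -/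
structure EdgeSplit (d : ℕ) (ed mk : ℕ → ℕ) (kin : ℕ) (inE inP : ℕ → ℕ) (kout : ℕ)
    (outE outP : ℕ → ℕ) : Prop where
  inEdge : ∀ r < kin, inP r < d ∧ inE r = ed (inP r) ∧ 0 < mk (inE r)
  outEdge : ∀ r < kout, outP r < d ∧ outE r = ed (outP r) ∧ ¬ 0 < mk (outE r)
  sum_eq : ∀ g : ℕ → ℕ, ∑ j ∈ Finset.range d, g j =
    ∑ r ∈ Finset.range kin, g (inP r) + ∑ r ∈ Finset.range kout, g (outP r)

namespace EdgeSplit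

variable {d : ℕ} {ed mk : ℕ → ℕ} {kin : ℕ} {inE inP : ℕ → ℕ} {kout : ℕ} {outE outP : ℕ → ℕ}

theorem snoc_in (h : EdgeSplit d ed mk kin inE inP kout outE outP) {inE' inP' outE' outP' : ℕ → ℕ}
    (hd : 0 < mk (ed d)) (h1 : ∀ r < kin, inE' r = inE r ∧ inP' r = inP r)
    (h2 : inE' kin = ed d) (h3 : inP' kin = d)
    (h4 : ∀ r < kout, outE' r = outE r ∧ outP' r = outP r) :
    EdgeSplit (d + 1) ed mk (kin + 1) inE' inP' kout outE' outP' where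
  inEdge r hr := by
    rcases Nat.lt_or_eq_of_le (Nat.lt_succ_iff.1 hr) with hr | rfl
    · obtain ⟨h5, h6, h7⟩ := h.inEdge r hr
      rw [(h1 r hr).1, (h1 r hr).2]
      exact ⟨by omega, h6, h7⟩
    · rw [h2, h3]
      exact ⟨by omega, rfl, hd⟩
  outEdge r hr := by
    obtain ⟨h5, h6, h7⟩ := h.outEdge r hr
    rw [(h4 r hr).1, (h4 r hr).2]
    exact ⟨by omega, h6, h7⟩
  sum_eq g := by
    rw [Finset.sum_range_succ, Finset.sum_range_succ, h.sum_eq, h3,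
      Finset.sum_congr rfl fun r hr => congrArg g (h1 r (Finset.mem_range.1 hr)).2,
      Finset.sum_congr rfl fun r hr => congrArg g (h4 r (Finset.mem_range.1 hr)).2]
    ring

theorem snoc_out (h : EdgeSplit d ed mk kin inE inP kout outE outP)
    {inE' inP' outE' outP' : ℕ → ℕ}
    (hd : ¬ 0 < mk (ed d)) (h1 : ∀ r < kin, inE' r = inE r ∧ inP' r = inP r)
    (h4 : ∀ r < kout, outE' r = outE r ∧ outP' r = outP r)
    (h2 : outE' kout = ed d) (h3 : outP' kout = d) :
    EdgeSplit (d + 1) ed mk kin inE' inP' (kout + 1) outE' outP' where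
  outEdge r hr := by
    rcases Nat.lt_or_eq_of_le (Nat.lt_succ_iff.1 hr) with hr | rfl
    · obtain ⟨h5, h6, h7⟩ := h.outEdge r hr
      rw [(h4 r hr).1, (h4 r hr).2]
      exact ⟨by omega, h6, h7⟩
    · rw [h2, h3]
      exact ⟨by omega, rfl, hd⟩
  inEdge r hr := by
    obtain ⟨h5, h6, h7⟩ := h.inEdge r hr
    rw [(h1 r hr).1, (h1 r hr).2]
    exact ⟨by omega, h6, h7⟩
  sum_eq g := by
    rw [Finset.sum_range_succ, Finset.sum_range_succ, h.sum_eq, h3,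
      Finset.sum_congr rfl fun r hr => congrArg g (h1 r (Finset.mem_range.1 hr)).2,
      Finset.sum_congr rfl fun r hr => congrArg g (h4 r (Finset.mem_range.1 hr)).2]
    ring

theorem card_eq (h : EdgeSplit d ed mk kin inE inP kout outE outP) : kin + kout = d := by
  simpa using (h.sum_eq fun _ => 1).symm

end EdgeSplit

/-- Splits the edges at the current vertex into input edges (arrays `11`, `42`, number `43`) and
output edges (arrays `14`, `44`, number `45`), and updates the marks (array `8`) of the edges in the
cut. -/
def splitProg : Prog := block [
  .setNat 43 (.lit 0) (.lit 0),
  .setNat 45 (.lit 0) (.lit 0),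
  forTo 20 (.get 1 (var 3)) (block [
    .setNat 26 (.lit 0) (.get 2 (.add (var 4) (var 20))),
    .cond (.natLT (.lit 0) (.get 8 (var 26)))
      (block [
        .setNat 8 (var 26) (.lit 0),
        .setNat 11 (var 43) (var 26),
        .setNat 42 (var 43) (var 20),
        .setNat 43 (.lit 0) (.add (var 43) (.lit 1))])
      (block [
        .setNat 8 (var 26) (.lit 1),
        .setNat 14 (var 45) (var 26),
        .setNat 44 (var 45) (var 20),
        .setNat 45 (.lit 0) (.add (var 45) (.lit 1))])])]

/-- A mark means membership in the current cut, so marked edges at the vertex are its inputs.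
Toggling the marks of all edges at the vertex produces the next cut. -/
theorem runs_splitProg {s : State} {d D : ℕ} {ed : ℕ → ℕ} (hd : s.nat 1 (s.nat 3 0) = d)
    (hdD : d ≤ D) (hed : ∀ j < d, s.nat 2 (s.nat 4 0 + j) = ed j)
    (hinj : ∀ i < d, ∀ j < d, ed i = ed j → i = j) :
    Runs splitProg s (D * 10 + 5) fun s' =>
      SameOutside [8, 11, 14, 20, 26, 42, 43, 44, 45] [] s s' ∧ s'.qubits = s.qubits ∧
      EdgeSplit d ed (s.nat 8) (s'.nat 43 0) (s'.nat 11) (s'.nat 42) (s'.nat 45 0) (s'.nat 14)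
        (s'.nat 44) ∧
      ∀ e, s'.nat 8 e = if ∃ j < d, ed j = e then (if 0 < s.nat 8 e then 0 else 1)
        else s.nat 8 e := by
  refine Runs.le (Runs.block_cons (Runs.setNat (Runs.block_cons (Runs.setNat
    (Runs.block_cons (Runs.forTo (τ := 8) d D hdD
    (fun k s' => SameOutside [8, 11, 14, 20, 26, 42, 43, 44, 45] [] s s' ∧
      s'.qubits = s.qubits ∧
      EdgeSplit k ed (s.nat 8) (s'.nat 43 0) (s'.nat 11) (s'.nat 42) (s'.nat 45 0) (s'.nat 14)
        (s'.nat 44) ∧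
      (∀ e, s'.nat 8 e = if ∃ j < k, ed j = e then (if 0 < s.nat 8 e then 0 else 1)
        else s.nat 8 e) ∧ s'.nat 20 0 = k) ?_ ?_ ?_ fun s' hs => Runs.block_nil
        ⟨hs.1, hs.2.1, hs.2.2.1, hs.2.2.2.1⟩)))))) (by omega)
  · refine ⟨(((SameOutside.refl _ _ _).setNat (by simp)).setNat (by simp)).setNat (by simp), rfl,
      ⟨?_, ?_, ?_⟩, ?_, by simp⟩
    · intro r hr
      simp [NatExp.eval] at hr
    · intro r hr
      simp [NatExp.eval] at hr
    · intro g
      simp [NatExp.eval]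
    · intro e
      simp [NatExp.eval]
  · rintro k s' ⟨hf, -, -, -, hk⟩
    refine ⟨hk, ?_⟩
    simp [NatExp.eval, hf.1, hd]
  · rintro k hk s' ⟨hf, hqu, hsp, hmk, hk'⟩
    have hek : s'.nat 2 (s'.nat 4 0 + k) = ed k := by
      rw [hf.1 2 (by simp), hf.1 4 (by simp), hed k hk]
    -- The edges are distinct, so the mark read now has not been toggled in an earlier round.
    have hmkk : s'.nat 8 (ed k) = s.nat 8 (ed k) := by
      rw [hmk, if_neg]
      rintro ⟨j, hj, hjk⟩
      have := hinj j (by omega) k hk hjk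
      omega
    have hexists : ∀ e, (∃ j < k + 1, ed j = e) ↔ (e = ed k ∨ ∃ j < k, ed j = e) := by
      intro e
      constructor
      · rintro ⟨j, hj, rfl⟩
        rcases Nat.lt_or_eq_of_le (Nat.lt_succ_iff.1 hj) with hj | rfl
        · exact Or.inr ⟨j, hj, rfl⟩
        · exact Or.inl rfl
      · rintro (rfl | ⟨j, hj, rfl⟩)
        · exact ⟨k, by omega, rfl⟩
        · exact ⟨j, by omega, rfl⟩
    refine Runs.block_cons (Runs.setNat (Runs.block_cons (Runs.mono (Runs.cond (τ := 5) ?_ ?_)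
      (le_refl 6) fun _ h => Runs.block_nil h)))
    · intro hc
      have hpos : 0 < s.nat 8 (ed k) := by
        simpa [Test.Holds, NatExp.eval, hk', hek, hmkk] using hc
      refine Runs.block_cons (Runs.setNat (Runs.block_cons (Runs.setNat (Runs.block_cons
        (Runs.setNat (Runs.block_cons (Runs.setNat (Runs.block_nil ?_))))))))
      refine ⟨by simp [NatExp.eval, hk'], ?_, hqu, ?_, ?_, by simp⟩
      · iterate 6 refine SameOutside.setNat ?_ (by simp)
        exact hf
      · have := hsp.snoc_in (inE' := fun r => if r = s'.nat 43 0 then ed k else s'.nat 11 r)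
          (inP' := fun r => if r = s'.nat 43 0 then k else s'.nat 42 r) (outE' := s'.nat 14)
          (outP' := s'.nat 44) hpos (fun r hr => by simp [hr.ne]) (by simp) (by simp)
          (fun r hr => ⟨rfl, rfl⟩)
        convert! this using 1 <;>
          (funext r; simp [NatExp.eval, hk', hek])
      · intro e
        simp only [hexists]
        by_cases he : e = ed k
        · simp [NatExp.eval, hk', hek, he]
          exact fun h => absurd hpos (by omega)
        · simp [NatExp.eval, hk', hek, he, hmk]
    · intro hc
      have hpos : ¬ 0 < s.nat 8 (ed k) := by
        simpa [Test.Holds, NatExp.eval, hk', hek, hmkk] using hc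
      refine Runs.block_cons (Runs.setNat (Runs.block_cons (Runs.setNat (Runs.block_cons
        (Runs.setNat (Runs.block_cons (Runs.setNat (Runs.block_nil ?_))))))))
      refine ⟨by simp [NatExp.eval, hk'], ?_, hqu, ?_, ?_, by simp⟩
      · iterate 6 refine SameOutside.setNat ?_ (by simp)
        exact hf
      · have := hsp.snoc_out (outE' := fun r => if r = s'.nat 45 0 then ed k else s'.nat 14 r)
          (outP' := fun r => if r = s'.nat 45 0 then k else s'.nat 44 r) (inE' := s'.nat 11)
          (inP' := s'.nat 42) hpos (fun r hr => ⟨rfl, rfl⟩) (fun r hr => by simp [hr.ne])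
          (by simp) (by simp)
        convert! this using 1 <;>
          (funext r; simp [NatExp.eval, hk', hek])
      · intro e
        simp only [hexists]
        by_cases he : e = ed k
        · simp [NatExp.eval, hk', hek, he]
          omega
        · simp [NatExp.eval, hk', hek, he, hmk]

/-! ### Positions of tensor entries -/

/-- The position that belongs to the digits of `u` in base `q` when the `r`-th digit has the weight
`q ^ P r`. -/
def offset (q k : ℕ) (P : ℕ → ℕ) (u : ℕ) : ℕ := ∑ r ∈ Finset.range k, u / q ^ r % q * q ^ P r

theorem div_pow_mod_add {q r i x y : ℕ} (hq : 0 < q) (hi : i < r) :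
    (y * q ^ r + x) / q ^ i % q = x / q ^ i % q := by
  obtain ⟨t, rfl⟩ : ∃ t, r = i + 1 + t := ⟨r - (i + 1), by omega⟩
  rw [show y * q ^ (i + 1 + t) + x = x + q ^ i * (q * (y * q ^ t)) by ring,
    Nat.add_mul_div_left _ _ (by positivity), Nat.add_mul_mod_self_left]

theorem div_pow_mod_top {q r x y : ℕ} (hx : x < q ^ r) (hy : y < q) :
    (y * q ^ r + x) / q ^ r % q = y := by
  have : 0 < q ^ r := by omega
  rw [add_comm, Nat.add_mul_div_right _ _ this, Nat.div_eq_of_lt hx, zero_add, Nat.mod_eq_of_lt hy]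

theorem offset_top {q r x y : ℕ} (P : ℕ → ℕ) (hx : x < q ^ r) (hy : y < q) :
    offset q (r + 1) P (y * q ^ r + x) = offset q (r + 1) P x + y * q ^ P r := by
  unfold offset
  rw [Finset.sum_range_succ, Finset.sum_range_succ, div_pow_mod_top hx hy, Nat.div_eq_of_lt hx,
    Nat.zero_mod, zero_mul, add_zero]
  congr 1
  refine Finset.sum_congr rfl fun i hi => ?_
  rw [div_pow_mod_add (by omega) (Finset.mem_range.1 hi)]

theorem offset_succ_of_lt {q r x : ℕ} (P : ℕ → ℕ) (hx : x < q ^ r) :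
    offset q (r + 1) P x = offset q r P x := by
  unfold offset
  rw [Finset.sum_range_succ, Nat.div_eq_of_lt hx, Nat.zero_mod, zero_mul, add_zero]

theorem mul_add_lt {q n x y : ℕ} (hx : x < n) (hy : y < q) : y * n + x < q * n := by
  calc y * n + x < y * n + n := by omega
    _ = (y + 1) * n := by ring
    _ ≤ q * n := Nat.mul_le_mul_right _ hy

/-- Writes the positions for the digit weights listed in the array `p`, with length `c`, to the
array `o`. -/
def offsetProg (p c o : ℕ) : Prog := block [
  .setNat o (.lit 0) (.lit 0),
  forTo 20 (var c) (block [
    .setNat 24 (.lit 0) (.lit 0),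
    .setNat 25 (.lit 0) (.lit 0),
    forTo 21 (.get 0 (.lit 0)) (block [
      forTo 22 (.get 10 (var 20))
        (.setNat o (.add (var 24) (var 22)) (.add (.get o (var 22)) (var 25))),
      .setNat 24 (.lit 0) (.add (var 24) (.get 10 (var 20))),
      .setNat 25 (.lit 0) (.add (var 25) (.get 10 (.get p (var 20))))])])]

/-- The table grows by one digit at a time: block `y` of length `q ^ r` is a copy of the first block
shifted by `y * q ^ P r`, which again avoids multiplication. For `y = 0` the first block is
rewritten with its own values; hence the disjunction in the invariants. The bounds `30 <` keep the
tables apart from the loop variables. -/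
theorem runs_offsetProg {s : State} {q d D k p c o : ℕ} (hp : 30 < p) (hc : 30 < c) (ho : 30 < o)
    (hpo : p ≠ o) (hco : c ≠ o) (hq : s.nat 0 0 = q) (hqD : 0 < d → q ≤ D) (hq0 : 0 < q)
    (hkd : k ≤ d) (hdD : d ≤ D) (hpw : ∀ j ≤ d, s.nat 10 j = q ^ j) (hpD : q ^ d ≤ D)
    (hck : s.nat c 0 = k) (hP : ∀ r < k, s.nat p r ≤ d) :
    Runs (offsetProg p c o) s (D * (D * (D * 3 + 7) + 7) + 4) fun s' =>
      SameOutside [o, 20, 21, 22, 24, 25] [] s s' ∧ s'.qubits = s.qubits ∧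
      ∀ u < q ^ k, s'.nat o u = offset q k (s.nat p) u := by
  have := ho.ne
  have h1 : p ≠ 20 ∧ p ≠ 21 ∧ p ≠ 22 ∧ p ≠ 24 ∧ p ≠ 25 := by omega
  have h2 : c ≠ 20 ∧ c ≠ 21 ∧ c ≠ 22 ∧ c ≠ 24 ∧ c ≠ 25 := by omega
  have h3 : o ≠ 20 ∧ o ≠ 21 ∧ o ≠ 22 ∧ o ≠ 24 ∧ o ≠ 25 := by omega
  have h4 : 20 ≠ o ∧ 21 ≠ o ∧ 22 ≠ o ∧ 24 ≠ o ∧ 25 ≠ o ∧ 10 ≠ o ∧ 0 ≠ o := by omega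
  have hp' : p ∉ [o, 20, 21, 22, 24, 25] := by simp [hpo, h1]
  have hc' : c ∉ [o, 20, 21, 22, 24, 25] := by simp [hco, h2]
  have h0' : 0 ∉ [o, 20, 21, 22, 24, 25] := by simp [h4]
  have h10' : 10 ∉ [o, 20, 21, 22, 24, 25] := by simp [h4]
  refine Runs.le (Runs.block_cons (Runs.setNat (Runs.block_cons (Runs.forTo
    (τ := D * (D * 3 + 7) + 5) k D (by omega)
    (fun r s' => SameOutside [o, 20, 21, 22, 24, 25] [] s s' ∧ s'.qubits = s.qubits ∧
      s'.nat 20 0 = r ∧ ∀ u < q ^ r, s'.nat o u = offset q r (s.nat p) u) ?_ ?_ ?_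
        fun s' hs => Runs.block_nil ⟨hs.1, hs.2.1, hs.2.2.2⟩))))
    (by ring_nf; omega)
  · refine ⟨((SameOutside.refl _ _ _).setNat (by simp)).setNat (by simp), rfl, by simp, ?_⟩
    intro u hu
    have : u = 0 := by simpa using hu
    simp [NatExp.eval, this, offset, h3]
  · rintro r s' ⟨hf, -, hr, -⟩
    refine ⟨hr, ?_⟩
    simp [NatExp.eval, hf.1 c hc', hck]
  · rintro r hr s₁ ⟨hf, hqu, hr', hoff⟩
    refine Runs.le (Runs.block_cons (Runs.setNat (Runs.block_cons (Runs.setNat (Runs.block_cons (τ' := 1)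
      (Runs.forTo (τ := D * 3 + 5) q D (hqD (by omega))
      (fun y s' => SameOutside [o, 20, 21, 22, 24, 25] [] s s' ∧ s'.qubits = s.qubits ∧
        s'.nat 20 0 = r ∧ s'.nat 21 0 = y ∧ s'.nat 24 0 = y * q ^ r ∧
        s'.nat 25 0 = y * q ^ s.nat p r ∧
        ∀ i, i < q ^ r ∨ i < y * q ^ r → s'.nat o i = offset q (r + 1) (s.nat p) i)
      ?_ ?_ ?_ ?_)))))) (by ring_nf; omega)
    · refine ⟨((hf.setNat (by simp)).setNat (by simp)).setNat (by simp), hqu, by simp [hr'],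
        by simp, by simp [NatExp.eval], by simp [NatExp.eval], ?_⟩
      intro i hi
      have hi : i < q ^ r := by simpa using hi
      rw [offset_succ_of_lt _ hi, ← hoff i hi]
      simp [h3]
    · rintro y s' ⟨hf, -, -, hy, -⟩
      refine ⟨hy, ?_⟩
      simp [NatExp.eval, hf.1 0 h0', hq]
    · rintro y hy s₂ ⟨hf, hqu, hr', hy', h24, h25, hoff⟩
      refine Runs.le (Runs.block_cons (τ' := 3) (Runs.forTo (τ := 1) (q ^ r) D
        ((Nat.pow_le_pow_right hq0 (by omega)).trans hpD)
        (fun x s' => SameOutside [o, 20, 21, 22, 24, 25] [] s s' ∧ s'.qubits = s.qubits ∧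
          s'.nat 20 0 = r ∧ s'.nat 21 0 = y ∧ s'.nat 22 0 = x ∧ s'.nat 24 0 = y * q ^ r ∧
          s'.nat 25 0 = y * q ^ s.nat p r ∧
          ∀ i, i < q ^ r ∨ i < y * q ^ r + x → s'.nat o i = offset q (r + 1) (s.nat p) i)
        ?_ ?_ ?_ ?_)) (by omega)
      · refine ⟨hf.setNat (by simp), hqu, by simp [hr'], by simp [hy'], by simp, by simp [h24],
          by simp [h25], ?_⟩
        intro i hi
        rw [← hoff i (by simpa using hi)]
        simp [h3]
      · rintro x s' ⟨hf, -, hr', -, hx, -⟩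
        refine ⟨hx, ?_⟩
        simp only [NatExp.eval, hr']
        rw [hf.1 10 h10', hpw r (by omega)]
      · rintro x hx s₃ ⟨hf, hqu, hr', hy', hx', h24, h25, hoff⟩
        refine Runs.setNat ⟨by simp [hx', h4], (hf.setNat (by simp)).setNat (by simp), hqu,
          by simp [hr', h4], by simp [hy', h4], by simp, by simp [h24, h4], by simp [h25, h4], ?_⟩
        intro i hi
        by_cases hix : i = y * q ^ r + x
        · rw [hix, offset_top _ hx hy, ← hoff x (Or.inl hx)]
          simp [NatExp.eval, h24, h25, hx', h3]
        · rw [← hoff i (by omega)]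
          simp [NatExp.eval, h24, h25, hx', h3, hix]
      · rintro s₃ ⟨hf, hqu, hr', hy', hx', h24, h25, hoff⟩
        refine Runs.block_cons (Runs.setNat (Runs.block_cons (Runs.setNat (Runs.block_nil ?_))))
        have e1 : s₃.nat 10 r = q ^ r := by rw [hf.1 10 h10', hpw r (by omega)]
        have e2 : s₃.nat 10 (s₃.nat p r) = q ^ s.nat p r := by
          rw [hf.1 10 h10', hf.1 p hp', hpw _ (hP r hr)]
        refine ⟨by simp [hy'], ((hf.setNat (by simp)).setNat (by simp)).setNat (by simp), hqu,
          by simp [hr'], by simp, ?_, ?_, ?_⟩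
        · simp [NatExp.eval, h24, hr', e1]
          ring
        · simp [NatExp.eval, h25, hr', e2, h1]
          ring
        · intro i hi
          rw [← hoff i (by rwa [add_mul, one_mul] at hi)]
          simp [h3]
    · rintro s₂ ⟨hf, hqu, hr', hy', h24, h25, hoff⟩
      refine Runs.block_nil ⟨hr', hf.setNat (by simp), hqu, by simp, ?_⟩
      intro u hu
      rw [← hoff u (Or.inr (by rwa [pow_succ'] at hu))]
      simp [h3]

/-- Writes the positions of the beginnings of the rows of a matrix to the array `19`. -/
def rowProg : Prog := block [
  .setNat 19 (.lit 0) (.lit 0),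
  forTo 20 (.get 10 (var 45))
    (.setNat 19 (.add (var 20) (.lit 1)) (.add (.get 19 (var 20)) (.get 10 (var 43))))]

theorem runs_rowProg {s : State} {a b D : ℕ} (ha : s.nat 10 (s.nat 45 0) = a) (haD : a ≤ D)
    (hb : s.nat 10 (s.nat 43 0) = b) :
    Runs rowProg s (D * 3 + 4) fun s' =>
      SameOutside [19, 20] [] s s' ∧ s'.qubits = s.qubits ∧ ∀ w ≤ a, s'.nat 19 w = w * b := by
  refine Runs.le (Runs.block_cons (Runs.setNat (Runs.block_cons (Runs.forTo (τ := 1) a D haD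
    (fun k s' => SameOutside [19, 20] [] s s' ∧ s'.qubits = s.qubits ∧ s'.nat 20 0 = k ∧
      ∀ w ≤ k, s'.nat 19 w = w * b) ?_ ?_ ?_ fun s' hs => Runs.block_nil
        ⟨hs.1, hs.2.1, hs.2.2.2⟩)))) (by omega)
  · refine ⟨((SameOutside.refl _ _ _).setNat (by simp)).setNat (by simp), rfl, by simp, ?_⟩
    intro j hj
    simp [NatExp.eval, Nat.le_zero.1 hj]
  · rintro k s' ⟨hf, -, hk, -⟩
    refine ⟨hk, ?_⟩
    simp [NatExp.eval, hf.1, ha]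
  · rintro k hk s' ⟨hf, hqu, hk', hp⟩
    refine Runs.setNat ⟨by simp [hk'], (hf.setNat (by simp)).setNat (by simp), hqu, by simp, ?_⟩
    intro w hw
    rcases Nat.lt_or_eq_of_le hw with h | rfl
    · have : w ≠ k + 1 := by omega
      simp [NatExp.eval, hk', this, hp w (by omega)]
    · simp [NatExp.eval, hk', hp k le_rfl, hf.1, hb]
      ring

end QRAM

end

/-! ### The vertex matrix in memory and the computation of its norm. -/

noncomputable section

namespace QRAM

open State

/-! ### Sums -/

/-- Writes the sum of the values of `t` for `x = 0, …, b - 1` to position `i` of the array `arr`. -/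
def sumProg (x : ℕ) (b : NatExp) (arr : ℕ) (i : NatExp) (t : NumExp) : Prog := block [
  .setNum arr i (.ofNat (.lit 0)),
  forTo x b (.setNum arr i (.add (.get arr i) t))]

/-- The hypothesis `h` says that position, bound and summand are unaffected by the loop: they are
evaluated in an arbitrary state that differs from `s` only in the array `x` and the accumulator
cell. -/
theorem runs_sumProg {s : State} {x arr n D i₀ : ℕ} {b i : NatExp} {t : NumExp} {f : ℕ → ℂ}
    (hnD : n ≤ D) (hi : i.eval s = i₀)
    (h : ∀ k s', (∀ a, a ≠ x → ∀ j, s'.nat a j = s.nat a j) →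
      (∀ a j, ¬ (a = arr ∧ j = i₀) → s'.num a j = s.num a j) → s'.nat x 0 = k →
      i.eval s' = i₀ ∧ b.eval s' = n ∧ (k < n → t.eval s' = f k)) :
    Runs (sumProg x b arr i t) s (D * 3 + 4) fun s' =>
      SameOutside [x] [arr] s s' ∧ s'.qubits = s.qubits ∧
      s'.num arr i₀ = ∑ k ∈ Finset.range n, f k ∧ ∀ j, j ≠ i₀ → s'.num arr j = s.num arr j := by
  refine Runs.le (Runs.block_cons (Runs.setNum (Runs.block_cons (Runs.forTo (τ := 1) n D hnD
    (fun k s' => (∀ a, a ≠ x → ∀ j, s'.nat a j = s.nat a j) ∧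
      (∀ a j, ¬ (a = arr ∧ j = i₀) → s'.num a j = s.num a j) ∧ s'.nat x 0 = k ∧
      s'.qubits = s.qubits ∧ s'.num arr i₀ = ∑ k ∈ Finset.range k, f k) ?_ ?_ ?_
      fun s' hs => Runs.block_nil ?_)))) (by omega)
  · refine ⟨fun a ha j => by simp [ha], fun a j hj => ?_, by simp, rfl, by simp [hi, NumExp.eval,
      NatExp.eval]⟩
    rw [num_setNat, num_setNum, hi, if_neg hj]
  · rintro k s' ⟨h1, h2, h3, -⟩
    exact ⟨h3, (h k s' h1 h2 h3).2.1⟩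
  · rintro k hk s' ⟨h1, h2, h3, hqu, h4⟩
    obtain ⟨h5, -, h6⟩ := h k s' h1 h2 h3
    refine Runs.setNum ⟨h3, fun a ha j => by simp [ha, h1], fun a j hj => ?_, by simp, hqu, ?_⟩
    · rw [num_setNat, num_setNum, h5, if_neg hj, h2 a j hj]
    · simp [NumExp.eval, h5, h6 hk, h4, Finset.sum_range_succ]
  · obtain ⟨h1, h2, h3, hqu, h4⟩ := hs
    refine ⟨⟨fun a ha j => h1 a (by simpa using ha) j, fun a ha j => h2 a j (by simp at ha; tauto)⟩,
      hqu, h4, fun j hj => h2 arr j (by tauto)⟩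

/-! ### The matrix of a vertex in memory -/

/-- The number of columns of the matrix of the current vertex. -/
abbrev dimIn : NatExp := .get 10 (var 43)

/-- The number of rows of the matrix of the current vertex. -/
abbrev dimOut : NatExp := .get 10 (var 45)

/-- The entry of the matrix of the current vertex in row `w` and column `u`. -/
abbrev entry (w u : NatExp) : NumExp := .get 1 (.add (var 5) (.add (.get 41 w) (.get 40 u)))

/-- The matrix of the current vertex is `A`, with `a` rows and `b` columns. -/
structure HasMatrix (a b : ℕ) (A : ℕ → ℕ → ℂ) (s : State) : Prop where
  dimIn : s.nat 10 (s.nat 43 0) = b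
  dimOut : s.nat 10 (s.nat 45 0) = a
  entry : ∀ w < a, ∀ u < b, s.num 1 (s.nat 5 0 + (s.nat 41 w + s.nat 40 u)) = A w u

theorem HasMatrix.congr {a b : ℕ} {A : ℕ → ℕ → ℂ} {s s' : State} (h : HasMatrix a b A s)
    (h10 : s'.nat 10 = s.nat 10) (h43 : s'.nat 43 0 = s.nat 43 0) (h45 : s'.nat 45 0 = s.nat 45 0)
    (h5 : s'.nat 5 0 = s.nat 5 0) (h41 : s'.nat 41 = s.nat 41) (h40 : s'.nat 40 = s.nat 40)
    (h1 : s'.num 1 = s.num 1) : HasMatrix a b A s' := by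
  constructor
  · rw [h10, h43, h.dimIn]
  · rw [h10, h45, h.dimOut]
  · rw [h1, h5, h41, h40]
    exact h.entry

theorem HasMatrix.same {a b : ℕ} {A : ℕ → ℕ → ℂ} {s s' : State} {W V : List ℕ}
    (h : HasMatrix a b A s) (hf : SameOutside W V s s')
    (hW : ∀ x ∈ W, x ≠ 10 ∧ x ≠ 43 ∧ x ≠ 45 ∧ x ≠ 5 ∧ x ≠ 41 ∧ x ≠ 40) (hV : 1 ∉ V) :
    HasMatrix a b A s' :=
  h.congr (funext (hf.1 10 fun h => (hW _ h).1 rfl)) (hf.1 43 (fun h => (hW _ h).2.1 rfl) 0)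
    (hf.1 45 (fun h => (hW _ h).2.2.1 rfl) 0) (hf.1 5 (fun h => (hW _ h).2.2.2.1 rfl) 0)
    (funext (hf.1 41 fun h => (hW _ h).2.2.2.2.1 rfl))
    (funext (hf.1 40 fun h => (hW _ h).2.2.2.2.2 rfl)) (funext (hf.2 1 hV))

variable {a b D : ℕ} {A : ℕ → ℕ → ℂ}

/-- Multiplies the vector in the array `5` by `Aᴴ A`. -/
def gramProg : Prog := block [
  forTo 22 dimOut (sumProg 23 dimIn 6 (var 22) (.mul (entry (var 22) (var 23)) (.get 5 (var 23)))),
  forTo 22 dimIn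
    (sumProg 23 dimOut 5 (var 22) (.mul (.conj (entry (var 23) (var 22))) (.get 6 (var 23))))]

theorem runs_gramProg {s : State} {v : ℕ → ℂ} (hA : HasMatrix a b A s) (ha : a ≤ D) (hb : b ≤ D)
    (hv : ∀ x < b, s.num 5 x = v x) :
    Runs gramProg s (D * (D * 6 + 12) + 5) fun s' =>
      SameOutside [22, 23] [5, 6] s s' ∧ s'.qubits = s.qubits ∧
      ∀ x < b, s'.num 5 x = gramStep a b A v x := by
  refine Runs.le (Runs.block_cons (Runs.forTo (τ := D * 3 + 4) a D ha
    (fun k s' => SameOutside [22, 23] [5, 6] s s' ∧ s'.qubits = s.qubits ∧ s'.nat 22 0 = k ∧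
      (∀ x < b, s'.num 5 x = v x) ∧
      ∀ w < k, s'.num 6 w = ∑ x ∈ Finset.range b, A w x * v x) ?_ ?_ ?_ fun s₁ hs => 
    Runs.block_cons (Runs.forTo (τ := D * 3 + 4) b D hb
    (fun k s' => SameOutside [22, 23] [5, 6] s s' ∧ s'.qubits = s.qubits ∧ s'.nat 22 0 = k ∧
      (∀ w < a, s'.num 6 w = ∑ x ∈ Finset.range b, A w x * v x) ∧
      ∀ x < k, s'.num 5 x = gramStep a b A v x) ?_ ?_ ?_
    fun s' hs => Runs.block_nil ⟨hs.1, hs.2.1, hs.2.2.2.2⟩))) (by ring_nf; omega)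
  · exact ⟨(SameOutside.refl _ _ _).setNat (by simp), rfl, by simp, hv, fun w hw => by omega⟩
  · rintro k s' ⟨hf, -, hk, -⟩
    exact ⟨hk, (hA.same hf (by simp) (by simp)).dimOut⟩
  · rintro k hk s₁ ⟨hf, hqu, hk', h5, h6⟩
    have hA₁ := hA.same hf (by simp) (by simp)
    refine (runs_sumProg (n := b) (i₀ := k) (f := fun x => A k x * v x) hb (by exact hk') ?_).post ?_
    · intro j s' h1 h2 h3
      refine ⟨by simp [NatExp.eval, h1, hk'], by simp [NatExp.eval, h1, hA₁.dimIn], fun hj => ?_⟩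
      simp [NumExp.eval, NatExp.eval, h1, h2, h3, hk', hA₁.entry k hk j hj, h5 j hj]
    · rintro s₂ ⟨hf', hqu', h7, h8⟩
      refine ⟨by simp [hf'.1, hk'], (hf.trans (hf'.mono (by simp) (by simp))).setNat (by simp),
        hqu'.trans hqu, by simp, fun x hx => ?_, fun w hw => ?_⟩
      · simp [hf'.2, h5 x hx]
      · rcases Nat.lt_or_eq_of_le (Nat.lt_succ_iff.1 hw) with hw | rfl
        · simp [h8 w hw.ne, h6 w hw]
        · exact h7
  · obtain ⟨hf, hqu, hk', h5, h6⟩ := hs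
    exact ⟨hf.setNat (by simp), hqu, by simp, h6, fun w hw => by omega⟩
  · rintro k s' ⟨hf, -, hk, -⟩
    exact ⟨hk, (hA.same hf (by simp) (by simp)).dimIn⟩
  · rintro k hk s₁ ⟨hf, hqu, hk', h6, h5⟩
    have hA₁ := hA.same hf (by simp) (by simp)
    refine (runs_sumProg (n := a) (i₀ := k) (f := fun w => (starRingEnd ℂ) (A w k) *
      ∑ x ∈ Finset.range b, A w x * v x) ha (by exact hk') ?_).post ?_
    · intro j s' h1 h2 h3
      refine ⟨by simp [NatExp.eval, h1, hk'], by simp [NatExp.eval, h1, hA₁.dimOut], fun hj => ?_⟩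
      simp [NumExp.eval, NatExp.eval, h1, h2, h3, hk', hA₁.entry j hj k hk, h6 j hj]
    · rintro s₂ ⟨hf', hqu', h7, h8⟩
      refine ⟨by simp [hf'.1, hk'], (hf.trans (hf'.mono (by simp) (by simp))).setNat (by simp),
        hqu'.trans hqu, by simp, fun x hx => ?_, fun w hw => ?_⟩
      · simp [hf'.2, h6 x hx]
      · rcases Nat.lt_or_eq_of_le (Nat.lt_succ_iff.1 hw) with hw | rfl
        · simp [h8 w hw.ne, h5 w hw]
        · exact h7

/-- Writes the traces of the powers of `Aᴴ A` to the array `4`. -/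
def traceProg : Prog := block [
  forTo 20 dimIn (.setNum 4 (var 20) (.ofNat (.lit 0))),
  forTo 20 dimIn (block [
    forTo 21 dimIn (.setNum 5 (var 21) (.ofNat (.lit 0))),
    .setNum 5 (var 20) (.ofNat (.lit 1)),
    forTo 21 dimIn (block [
      gramProg,
      .setNum 4 (var 21) (.add (.get 4 (var 21)) (.get 5 (var 20)))])])]

/-- All traces are accumulated at once from the orbits of the basis vectors `e_u` under `Aᴴ A`: the
`u`-th entry of each iterate is a diagonal entry of a power. No matrix product has to be stored. -/
theorem runs_traceProg {s : State} (hA : HasMatrix a b A s) (ha : a ≤ D) (hb : b ≤ D) :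
    Runs traceProg s (D * (D * (D * (D * 6 + 12) + 12) + 11) + 5) fun s' =>
      SameOutside [20, 21, 22, 23] [4, 5, 6] s s' ∧ s'.qubits = s.qubits ∧
      ∀ k < b, s'.num 4 k = gramTrace a b A k := by
  refine Runs.le (Runs.block_cons (Runs.forTo (τ := 1) b D hb
    (fun k s' => SameOutside [20, 21, 22, 23] [4, 5, 6] s s' ∧ s'.qubits = s.qubits ∧
      s'.nat 20 0 = k ∧ ∀ j < k, s'.num 4 j = 0) ?_ ?_ ?_ fun s₁ hs =>
    Runs.block_cons (Runs.forTo (τ := D * (D * (D * 6 + 12) + 12) + 6) b D hb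
    (fun k s' => SameOutside [20, 21, 22, 23] [4, 5, 6] s s' ∧ s'.qubits = s.qubits ∧
      s'.nat 20 0 = k ∧
      ∀ j < b, s'.num 4 j = ∑ u ∈ Finset.range k, gramColumn a b A u (j + 1) u) ?_ ?_ ?_
    fun s' hs => Runs.block_nil ⟨hs.1, hs.2.1, hs.2.2.2⟩))) (by ring_nf; omega)
  · exact ⟨(SameOutside.refl _ _ _).setNat (by simp), rfl, by simp, fun w hw => by omega⟩
  · rintro k s' ⟨hf, -, hk, -⟩
    exact ⟨hk, (hA.same hf (by simp) (by simp)).dimIn⟩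
  · rintro k hk s₁ ⟨hf, hqu, hk', h4⟩
    refine Runs.setNum ⟨by simp [hk'], (hf.setNum (by simp)).setNat (by simp), hqu, by simp, ?_⟩
    intro j hj
    rcases Nat.lt_or_eq_of_le (Nat.lt_succ_iff.1 hj) with hj | rfl
    · simp [NatExp.eval, NumExp.eval, h4 j hj]
    · simp [NatExp.eval, NumExp.eval, hk']
  · obtain ⟨hf, hqu, hk', h4⟩ := hs
    exact ⟨hf.setNat (by simp), hqu, by simp, fun j hj => by simp [h4 j hj]⟩
  · rintro k s' ⟨hf, -, hk, -⟩
    exact ⟨hk, (hA.same hf (by simp) (by simp)).dimIn⟩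
  · rintro u hu s₁ ⟨hf, hqu, hu', h4⟩
    refine Runs.le (Runs.block_cons (Runs.forTo (τ := 1) b D hb
      (fun k s' => SameOutside [20, 21, 22, 23] [4, 5, 6] s s' ∧ s'.qubits = s.qubits ∧
        s'.nat 20 0 = u ∧ s'.nat 21 0 = k ∧ (∀ j, s'.num 4 j = s₁.num 4 j) ∧
        ∀ x < k, s'.num 5 x = 0) ?_ ?_ ?_
      fun s₂ hs => Runs.block_cons (Runs.setNum (Runs.block_cons (Runs.forTo
      (τ := D * (D * 6 + 12) + 7) b D hb
      (fun k s' => SameOutside [20, 21, 22, 23] [4, 5, 6] s s' ∧ s'.qubits = s.qubits ∧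
        s'.nat 20 0 = u ∧ s'.nat 21 0 = k ∧
        (∀ j < b, s'.num 4 j = s₁.num 4 j + if j < k then gramColumn a b A u (j + 1) u else 0) ∧
        ∀ x < b, s'.num 5 x = gramColumn a b A u k x) ?_ ?_ ?_
      fun s₃ hs => Runs.block_nil ?_))))) (by ring_nf; omega)
    · exact ⟨hf.setNat (by simp), hqu, by simp [hu'], by simp, by simp, fun w hw => by omega⟩
    · rintro k s' ⟨hf, -, -, hk, -⟩
      exact ⟨hk, (hA.same hf (by simp) (by simp)).dimIn⟩
    · rintro k hk s' ⟨hf, hqu, hu', hk', h4, h5⟩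
      refine Runs.setNum ⟨by simp [hk'], (hf.setNum (by simp)).setNat (by simp), hqu, by simp [hu'],
        by simp, by simp [h4], ?_⟩
      intro j hj
      rcases Nat.lt_or_eq_of_le (Nat.lt_succ_iff.1 hj) with hj | rfl
      · simp [NatExp.eval, NumExp.eval, h5 j hj]
      · simp [NatExp.eval, NumExp.eval, hk']
    · obtain ⟨hf, hqu, hu', hk', h4, h5⟩ := hs
      refine ⟨(hf.setNum (by simp)).setNat (by simp), hqu, by simp [hu'], by simp, by simp [h4], ?_⟩
      intro x hx
      simp [NatExp.eval, NumExp.eval, hu', h5 x hx, gramColumn]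
    · rintro k s' ⟨hf, -, -, hk, -⟩
      exact ⟨hk, (hA.same hf (by simp) (by simp)).dimIn⟩
    · rintro k hk s' ⟨hf, hqu, hu', hk', h4, h5⟩
      refine Runs.le (Runs.block_cons ((runs_gramProg (hA.same hf (by simp) (by simp)) ha hb
        h5).post ?_)) (τ := (D * (D * 6 + 12) + 5) + 2) (by omega)
      rintro s₂ ⟨hf', hqu', h5'⟩
      refine Runs.block_cons (Runs.setNum (Runs.block_nil ⟨by simp [hf'.1, hk'],
        ((hf.trans (hf'.mono (by simp) (by simp))).setNum (by simp)).setNat (by simp),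
        hqu'.trans hqu, by simp [hf'.1, hu'], by simp, ?_, ?_⟩))
      · intro j hj
        by_cases hjk : j = k
        · simp [NumExp.eval, NatExp.eval, hf'.1, hf'.2, hk', hu', hjk, h4 k hk, h5' u hu,
            gramColumn]
        · have : j < k + 1 ↔ j < k := by omega
          simp [NumExp.eval, NatExp.eval, hf'.1, hf'.2, hk', hjk, h4 j hj, this]
      · intro x hx
        simp [h5' x hx, gramColumn]
    · obtain ⟨hf, hqu, hu', hk', h4', h5⟩ := hs
      refine ⟨hu', hf.setNat (by simp), hqu, by simp, ?_⟩
      intro j hj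
      rw [Finset.sum_range_succ, ← h4 j hj, num_setNat, h4' j hj, if_pos hj]

/-- Writes the coefficients of the characteristic polynomial of `Aᴴ A` to the array `7`. -/
def coeffProg : Prog := block [
  .setNum 7 dimIn (.ofNat (.lit 1)),
  forTo 20 dimIn (block [
    sumProg 21 (.add (var 20) (.lit 1)) 8 (.lit 0)
      (.mul (.get 7 (.add (.sub dimIn (var 20)) (var 21))) (.get 4 (var 21))),
    .setNum 7 (.sub dimIn (.add (var 20) (.lit 1)))
      (.sub (.ofNat (.lit 0)) (.div (.get 8 (.lit 0)) (.ofNat (.add (var 20) (.lit 1)))))])]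

theorem runs_coeffProg {s : State} {p : ℕ → ℂ} (hA : HasMatrix a b A s) (hb : b ≤ D)
    (hp : ∀ k < b, s.num 4 k = p k) :
    Runs coeffProg s (D * (D * 3 + 8) + 4) fun s' =>
      SameOutside [20, 21] [7, 8] s s' ∧ s'.qubits = s.qubits ∧ s'.num 7 b = 1 ∧
      ∀ k < b, s'.num 7 (b - (k + 1)) =
        0 - (∑ i ∈ Finset.range (k + 1), s'.num 7 (b - k + i) * p i) / ((k + 1 : ℕ) : ℂ) := by
  refine Runs.le (Runs.block_cons (Runs.setNum (Runs.block_cons (Runs.forTo (τ := D * 3 + 6) b D hb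
    (fun j s' => SameOutside [20, 21] [7, 8] s s' ∧ s'.qubits = s.qubits ∧ s'.nat 20 0 = j ∧
      s'.num 7 b = 1 ∧ ∀ k < j, s'.num 7 (b - (k + 1)) =
        0 - (∑ i ∈ Finset.range (k + 1), s'.num 7 (b - k + i) * p i) / ((k + 1 : ℕ) : ℂ)) ?_ ?_ ?_
    fun s' hs => Runs.block_nil ⟨hs.1, hs.2.1, hs.2.2.2⟩)))) (by ring_nf; omega)
  · refine ⟨((SameOutside.refl _ _ _).setNum (by simp)).setNat (by simp), rfl, by simp, ?_,
      fun w hw => by omega⟩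
    simp [NatExp.eval, NumExp.eval, hA.dimIn]
  · rintro k s' ⟨hf, -, hk, -⟩
    exact ⟨hk, (hA.same hf (by simp) (by simp)).dimIn⟩
  · rintro k hk s₁ ⟨hf, hqu, hk', h1, h7⟩
    have hA₁ := hA.same hf (by simp) (by simp)
    refine Runs.le (Runs.block_cons ((runs_sumProg (n := k + 1) (i₀ := 0) (D := D)
      (f := fun i => s₁.num 7 (b - k + i) * p i) (by omega) rfl ?_).post ?_))
      (τ := D * 3 + 4 + 2) (by omega)
    · intro j s' h1 h2 h3
      refine ⟨rfl, by simp [NatExp.eval, h1, hk'], fun hj => ?_⟩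
      simp [NumExp.eval, NatExp.eval, h1, h2, h3, hk', hA₁.dimIn, hf.2, hp j (by omega)]
    · rintro s₂ ⟨hf', hqu', h8, -⟩
      have h72 : ∀ j, s₂.num 7 j = s₁.num 7 j := fun j => by simp [hf'.2]
      have hb2 : s₂.nat 10 (s₂.nat 43 0) = b := by simp [hf'.1, hA₁.dimIn]
      refine Runs.block_cons (Runs.setNum (Runs.block_nil ⟨by simp [hf'.1, hk'],
        ((hf.trans (hf'.mono (by simp) (by simp))).setNum (by simp)).setNat (by simp),
        hqu'.trans hqu, by simp, ?_, ?_⟩))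
      · have : b ≠ b - (k + 1) := by omega
        simp [NatExp.eval, hf'.1, hk', this, h72, h1, hA₁.dimIn]
      · intro j hj
        -- Equation `j ≤ k` of the recursion reads only positions from `b - j` upwards, above the
        -- one being written, so it is not disturbed.
        have hne : ∀ i, b - j + i ≠ b - (k + 1) := by omega
        have hsum : ∀ i, (((s₂.setNum 7 (NatExp.eval s₂ (.sub dimIn (.add (var 20) (.lit 1))))
            (NumExp.eval s₂ (.sub (.ofNat (.lit 0)) (.div (.get 8 (.lit 0))
              (.ofNat (.add (var 20) (.lit 1))))))).setNat 20 0 (k + 1)).num 7 (b - j + i)) =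
            s₁.num 7 (b - j + i) := fun i => by
          simp [NatExp.eval, hf'.1, hk', hne i, h72, hA₁.dimIn]
        simp only [hsum]
        rcases Nat.lt_or_eq_of_le (Nat.lt_succ_iff.1 hj) with hj | rfl
        · have : b - (j + 1) ≠ b - (k + 1) := by omega
          rw [← h7 j hj]
          simp [NatExp.eval, hf'.1, hk', this, h72, hA₁.dimIn]
        · simp [NatExp.eval, NumExp.eval, hf'.1, hk', hA₁.dimIn, h8]

open scoped Matrix.Norms.L2Operator

/-- Writes the norm of `A` to position `2` of the array `8` and multiplies the scale (array `9`) by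
it. -/
def normProg : Prog := block [
  traceProg,
  coeffProg,
  .root 7 (.lit 0) dimIn 8 (.lit 1),
  .setNum 8 (.lit 2) (.sqrtRe (.get 8 (.lit 1))),
  .setNum 9 (.lit 0) (.mul (.get 9 (.lit 0)) (.get 8 (.lit 2)))]

theorem runs_normProg {s : State} (hA : HasMatrix a b A s) (ha : a ≤ D) (hb : b ≤ D)
    (hb0 : 0 < b) :
    Runs normProg s ((D * (D * (D * (D * 6 + 12) + 12) + 11) + 5) + (D * (D * 3 + 8) + 4) + (D + 4))
      fun s' =>
      SameOutside [20, 21, 22, 23] [4, 5, 6, 7, 8, 9] s s' ∧ s'.qubits = s.qubits ∧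
      s'.num 8 2 = (‖toMat a b A‖ : ℂ) ∧ s'.num 9 0 = s.num 9 0 * (‖toMat a b A‖ : ℂ) := by
  refine Runs.le (Runs.block_cons ((runs_traceProg hA ha hb).post ?_))
    (τ := (D * (D * (D * (D * 6 + 12) + 12) + 11) + 5) + ((D * (D * 3 + 8) + 4) + ((D + 1) + 3)))
    (by omega)
  rintro s₁ ⟨hf₁, hqu₁, h4⟩
  refine Runs.block_cons ((runs_coeffProg (hA.same hf₁ (by simp) (by simp)) hb h4).post ?_)
  rintro s₂ ⟨hf₂, hqu₂, h7, h7'⟩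
  have hbe : NatExp.eval s₂ dimIn = b := by
    simp [NatExp.eval, hf₂.1, hf₁.1, hA.dimIn]
  have hroot := sqrt_largestRoot_eq_norm hb0 A h7 h7'
  refine Runs.block_cons (Runs.le (Runs.root ?_) (by rw [hbe]; omega))
  refine Runs.block_cons (Runs.setNum (Runs.block_cons (Runs.setNum (Runs.block_nil ⟨?_, ?_, ?_, ?_⟩))))
  · refine ((SameOutside.setNum ?_ (by simp)).setNum (by simp)).setNum (by simp)
    exact (hf₁.mono (by simp) (by simp)).trans (hf₂.mono (by simp) (by simp))
  · exact hqu₂.trans hqu₁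
  · simp [NumExp.eval, NatExp.eval, hf₁.1, hf₂.1, hA.dimIn, hroot]
  · simp [NumExp.eval, NatExp.eval, hf₁.1, hf₂.1, hf₁.2, hf₂.2, hA.dimIn, hroot]

end QRAM

end

/-! ### Gate groups as programs, and their effect on one-hot superpositions. -/

noncomputable section

namespace QRAM

open State

/-! ### Gate sequences -/

@[simp] theorem NatExp.eval_qubits (s : State) (φ : QState) (e : NatExp) :
    e.eval { s with qubits := φ } = e.eval s := by
  induction e with
  | lit k => rfl
  | get a i ih => simp only [NatExp.eval, ih]
  | add e f he hf => simp only [NatExp.eval, he, hf]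
  | sub e f he hf => simp only [NatExp.eval, he, hf]

/-- The array `3` of complex numbers begins with the entries of the NOT gate. -/
def HasGateX (s : State) : Prop :=
  s.num 3 0 = 0 ∧ s.num 3 1 = 1 ∧ s.num 3 2 = 1 ∧ s.num 3 3 = 0

theorem HasGateX.same {s s' : State} {W V : List ℕ} (h : HasGateX s) (hf : SameOutside W V s s')
    (hV : 3 ∉ V) : HasGateX s' := by
  simpa only [HasGateX, hf.2 3 hV] using h

theorem HasGateX.qubits {s : State} (h : HasGateX s) (φ : QState) :
    HasGateX { s with qubits := φ } := h

theorem Runs.gateX {s : State} {cs : List NatExp} {t : NatExp} {C : Finset ℕ} {t₀ : ℕ}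
    {Q : State → Prop} (hX : HasGateX s) (hC : (cs.map (NatExp.eval s)).toFinset = C)
    (ht : t.eval s = t₀) (htC : t₀ ∉ C)
    (h : Q { s with qubits := QState.apply gateX C t₀ s.qubits }) :
    Runs (.gate 3 (.lit 0) cs t) s 1 Q := by
  refine Runs.gate ?_
  have : s.matrixAt 3 (NatExp.eval s (.lit 0)) = QRAM.gateX := by
    obtain ⟨h0, h1, h2, h3⟩ := hX
    simp [State.matrixAt, NatExp.eval, h0, h1, h2, h3, QRAM.gateX]
  rw [this, hC, ht, QState.gate_of_mem gateX_mem htC]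
  exact h

/-- The gates of `QState.mergeGate`. -/
def mergeGateProg (a e c : NatExp) : Prog := block [
  .gate 3 (.lit 0) [a, e] c, .gate 3 (.lit 0) [c] a, .gate 3 (.lit 0) [c] e]

/-- The gates of `QState.splitGate`. -/
def splitGateProg (a e c : NatExp) : Prog := block [
  .gate 3 (.lit 0) [c] a, .gate 3 (.lit 0) [c] e, .gate 3 (.lit 0) [a, e] c]

/-- The gates of `QState.rotGate`, with the matrix in the array `13`. -/
def rotGateProg (a c : NatExp) : Prog := block [
  .gate 3 (.lit 0) [c] a, .gate 13 (.lit 0) [a] c, .gate 3 (.lit 0) [c] a]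

section

variable {s : State} {a e c : NatExp} {a₀ e₀ c₀ : ℕ} {Q : State → Prop}

theorem Runs.mergeGate (hX : HasGateX s) (ha : a.eval s = a₀) (he : e.eval s = e₀)
    (hc : c.eval s = c₀) (hac : a₀ ≠ c₀) (hec : e₀ ≠ c₀)
    (h : Q { s with qubits := QState.mergeGate a₀ e₀ c₀ s.qubits }) :
    Runs (mergeGateProg a e c) s 4 Q := by
  unfold mergeGateProg
  refine Runs.block_cons (τ := 1) (τ' := 3)
    (Runs.gateX hX (C := {a₀, e₀}) (t₀ := c₀) (by simp [ha, he]) hc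
    (by simp [hac.symm, hec.symm]) ?_)
  refine Runs.block_cons (τ := 1) (τ' := 2)
    (Runs.gateX (hX.qubits _) (C := {c₀}) (t₀ := a₀) (by simp [hc])
    (by simp [ha]) (by simp [hac]) ?_)
  refine Runs.block_cons (τ := 1) (τ' := 1)
    (Runs.gateX (hX.qubits _) (C := {c₀}) (t₀ := e₀) (by simp [hc])
    (by simp [he]) (by simp [hec]) ?_)
  exact Runs.block_nil h

theorem Runs.splitGate (hX : HasGateX s) (ha : a.eval s = a₀) (he : e.eval s = e₀)
    (hc : c.eval s = c₀) (hac : a₀ ≠ c₀) (hec : e₀ ≠ c₀)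
    (h : Q { s with qubits := QState.splitGate a₀ e₀ c₀ s.qubits }) :
    Runs (splitGateProg a e c) s 4 Q := by
  unfold splitGateProg
  refine Runs.block_cons (τ := 1) (τ' := 3)
    (Runs.gateX hX (C := {c₀}) (t₀ := a₀) (by simp [hc])
    (by simp [ha]) (by simp [hac]) ?_)
  refine Runs.block_cons (τ := 1) (τ' := 2)
    (Runs.gateX (hX.qubits _) (C := {c₀}) (t₀ := e₀) (by simp [hc])
    (by simp [he]) (by simp [hec]) ?_)
  refine Runs.block_cons (τ := 1) (τ' := 1)
    (Runs.gateX (hX.qubits _) (C := {a₀, e₀}) (t₀ := c₀) (by simp [ha, he])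
    (by simp [hc]) (by simp [hac.symm, hec.symm]) ?_)
  exact Runs.block_nil h

theorem Runs.rotGate {U : Matrix (Fin 2) (Fin 2) ℂ} (hX : HasGateX s)
    (hU : s.matrixAt 13 0 = U) (hU' : U ∈ Matrix.unitaryGroup (Fin 2) ℂ) (ha : a.eval s = a₀)
    (hc : c.eval s = c₀) (hac : a₀ ≠ c₀)
    (h : Q { s with qubits := QState.rotGate U a₀ c₀ s.qubits }) :
    Runs (rotGateProg a c) s 4 Q := by
  unfold rotGateProg
  refine Runs.block_cons (τ := 1) (τ' := 3)
    (Runs.gateX hX (C := {c₀}) (t₀ := a₀) (by simp [hc])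
    (by simp [ha]) (by simp [hac]) ?_)
  refine Runs.block_cons (τ := 1) (τ' := 2) (Runs.gate (Runs.block_cons (τ := 1)
    (τ' := 1) (Runs.gateX (C := {c₀}) (hX.qubits _)
    (by simp [hc]) (t₀ := a₀) (by simp [ha]) (by simp [hac]) (Runs.block_nil ?_))))
  have e1 : (State.matrixAt { s with qubits := QState.apply QRAM.gateX {c₀} a₀ s.qubits } 13
      (NatExp.eval { s with qubits := QState.apply QRAM.gateX {c₀} a₀ s.qubits } (.lit 0))) = U := hU
  rw [e1]
  simp only [NatExp.eval_qubits, hc, List.map_cons, List.map_nil, ha, List.toFinset_cons,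
    List.toFinset_nil, LawfulSingleton.insert_empty_eq]
  rw [QState.gate_of_mem hU' (by simp [hac.symm])]
  exact h

end

/-! ### Dead and live basis vectors -/

/-- The qubits in the block of length `b` at `tok`, and those that were not used yet. -/
def Live (tok b fb x : ℕ) : Prop := tok ≤ x ∧ x < tok + b ∨ fb ≤ x

/-- All basis vectors in `φ` have only zeros at the live qubits. -/
def Dead (tok b fb : ℕ) (φ : QState) : Prop :=
  ∀ S ∈ φ.support, ∀ x ∈ S, ¬ Live tok b fb x

theorem Dead.mono {tok b fb tok' b' fb' : ℕ} {φ : QState} (h : Dead tok b fb φ)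
    (hl : ∀ x, Live tok' b' fb' x → Live tok b fb x) : Dead tok' b' fb' φ :=
  fun S hS x hx hl' => h S hS x hx (hl x hl')

theorem Dead.add {tok b fb : ℕ} {φ ψ : QState} (h : Dead tok b fb φ) (h' : Dead tok b fb ψ) :
    Dead tok b fb (φ + ψ) := by
  classical
  intro S hS
  rcases Finset.mem_union.1 (Finsupp.support_add hS) with hS | hS
  · exact h S hS
  · exact h' S hS

theorem Dead.sum {ι : Type*} {tok b fb : ℕ} {I : Finset ι} {f : ι → QState}
    (h : ∀ i ∈ I, Dead tok b fb (f i)) : Dead tok b fb (∑ i ∈ I, f i) := by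
  classical
  intro S hS
  obtain ⟨i, hi, hS⟩ := Finset.mem_biUnion.1 (Finsupp.support_finsetSum hS)
  exact h i hi S hS

theorem Dead.single {tok b fb : ℕ} {S : Finset ℕ} {z : ℂ} (h : ∀ x ∈ S, ¬ Live tok b fb x) :
    Dead tok b fb (Finsupp.single S z) := by
  intro S' hS'
  rw [Finset.mem_singleton.1 (Finsupp.support_single_subset hS')]
  exact h

/-- Basis vectors with a single one among the qubits `tok + u`, `u < b`, and `fb + w`, `w < a`. -/
def tokenState {ι : Type*} (tok fb a b : ℕ) (I : Finset ι) (J : ι → Finset ℕ) (c : ι → ℂ)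
    (col : ι → ℕ) (α γ : ℕ → ℕ → ℂ) : QState :=
  ∑ i ∈ I, (∑ u ∈ Finset.range b, Finsupp.single (insert (tok + u) (J i)) (c i * α u (col i)) +
    ∑ w ∈ Finset.range a, Finsupp.single (insert (fb + w) (J i)) (c i * γ w (col i)))

/-- For each background `J i` the rotation meets exactly the two summands with the one at `tok + j`
or at `fb + y`. All others have zeros at both qubits and are fixed, so the gate acts on the
coefficients alone. -/
theorem rotGate_tokenState {ι : Type*} {tok fb a b j y : ℕ} {I : Finset ι} {J : ι → Finset ℕ}
    {c : ι → ℂ} {col : ι → ℕ} {α γ α' γ' : ℕ → ℕ → ℂ} {U : Matrix (Fin 2) (Fin 2) ℂ}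
    (htok : tok + b ≤ fb) (hJ : ∀ i ∈ I, ∀ x ∈ J i, ¬ Live tok b fb x) (hj : j < b) (hy : y < a)
    (hα : ∀ u z, α' u z = if u = j then U 0 0 * α j z + U 0 1 * γ y z else α u z)
    (hγ : ∀ w z, γ' w z = if w = y then U 1 0 * α j z + U 1 1 * γ y z else γ w z) :
    QState.rotGate U (tok + j) (fb + y) (tokenState tok fb a b I J c col α γ) =
      tokenState tok fb a b I J c col α' γ' := by
  unfold tokenState
  rw [map_sum]
  refine Finset.sum_congr rfl fun i hi => ?_
  have hJt : ∀ u < b, tok + u ∉ J i := fun u hu h =>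
    hJ i hi _ h (Or.inl ⟨by omega, by omega⟩)
  have hJf : ∀ w, fb + w ∉ J i := fun w h => hJ i hi _ h (Or.inr (by omega))
  rw [map_add, map_sum, map_sum,
    sum_range_change hj (f := fun u => Finsupp.single (insert (tok + u) (J i)) (c i * α u (col i)))
      (g := fun u => QState.rotGate U (tok + j) (fb + y)
        (Finsupp.single (insert (tok + u) (J i)) (c i * α u (col i)))),
    sum_range_change hy (f := fun w => Finsupp.single (insert (fb + w) (J i)) (c i * γ w (col i)))
      (g := fun w => QState.rotGate U (tok + j) (fb + y)
        (Finsupp.single (insert (fb + w) (J i)) (c i * γ w (col i)))),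
    sum_range_change hj (f := fun u => Finsupp.single (insert (tok + u) (J i)) (c i * α u (col i)))
      (g := fun u => Finsupp.single (insert (tok + u) (J i)) (c i * α' u (col i))),
    sum_range_change hy (f := fun w => Finsupp.single (insert (fb + w) (J i)) (c i * γ w (col i)))
      (g := fun w => Finsupp.single (insert (fb + w) (J i)) (c i * γ' w (col i)))]
  · rw [QState.rotGate_left (hJt j hj) (hJf y) (by omega),
      QState.rotGate_right (hJt j hj) (hJf y) (by omega), hα, hγ, if_pos rfl, if_pos rfl]
    have e1 : c i * (U 0 0 * α j (col i) + U 0 1 * γ y (col i)) =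
        U 0 0 * (c i * α j (col i)) + U 0 1 * (c i * γ y (col i)) := by ring
    have e2 : c i * (U 1 0 * α j (col i) + U 1 1 * γ y (col i)) =
        U 1 0 * (c i * α j (col i)) + U 1 1 * (c i * γ y (col i)) := by ring
    rw [e1, e2, Finsupp.single_add, Finsupp.single_add]
    abel
  · intro w _ hw
    rw [hγ, if_neg hw]
  · intro u _ hu
    rw [hα, if_neg hu]
  · intro w _ hw
    refine QState.rotGate_fix ?_ ?_ _
    · rw [Finset.mem_insert]
      rintro (h | h)
      · omega
      · exact hJt j hj h
    · rw [Finset.mem_insert]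
      rintro (h | h)
      · omega
      · exact hJf y h
  · intro u hu' hu
    refine QState.rotGate_fix ?_ ?_ _
    · rw [Finset.mem_insert]
      rintro (h | h)
      · omega
      · exact hJt j hj h
    · rw [Finset.mem_insert]
      rintro (h | h)
      · omega
      · exact hJf y h

theorem Dead.rotGate {tok b fb a c : ℕ} {φ : QState} {U : Matrix (Fin 2) (Fin 2) ℂ}
    (h : Dead tok b fb φ) (ha : Live tok b fb a) (hc : Live tok b fb c) :
    QState.rotGate U a c φ = φ :=
  QState.map_eq_self fun S hS z =>
    QState.rotGate_fix (fun h' => h S hS a h' ha) (fun h' => h S hS c h' hc) z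

/-- Only `a` and `c` need to be live. The qubit `e` lies in an edge block and may well be one in a
dead vector. -/
theorem Dead.mergeGate {tok b fb a e c : ℕ} {φ : QState}
    (h : Dead tok b fb φ) (ha : Live tok b fb a) (hc : Live tok b fb c) :
    QState.mergeGate a e c φ = φ :=
  QState.map_eq_self fun S hS z =>
    QState.mergeGate_fix (fun h' => h S hS c h' hc) (fun h' => h S hS a h'.1 ha) z

theorem Dead.splitGate {tok b fb a e c : ℕ} {φ : QState}
    (h : Dead tok b fb φ) (ha : Live tok b fb a) (hc : Live tok b fb c) :
    QState.splitGate a e c φ = φ :=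
  QState.map_eq_self fun S hS z =>
    QState.splitGate_fix (fun h' => h S hS c h' hc) (fun h' => h S hS a h'.1 ha) z

/-! ### Merging an edge into the token -/

section Merge

variable {ι : Type*} {tok fb P q eb : ℕ} {I : Finset ι} {J : ι → Finset ℕ} {c : ι → ℂ}
  {y u : ι → ℕ} {φ : QState}

/-- For the indices `i` with `y i * P + u i < n`, the ones at `tok + u i` and `eb + y i` are merged
to a one at `fb + (y i * P + u i)`. -/
def mergeState (φ : QState) (tok fb P eb : ℕ) (I : Finset ι) (J : ι → Finset ℕ) (c : ι → ℂ)
    (y u : ι → ℕ) (n : ℕ) : QState :=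
  φ + ∑ i ∈ I, Finsupp.single (if y i * P + u i < n then insert (fb + (y i * P + u i)) (J i)
    else insert (tok + u i) (insert (eb + y i) (J i))) (c i)

/-- The pairs `(k, x)` are processed in the order of `k * P + x`, and division with remainder shows
that exactly the branches with `y i = k` and `u i = x` are hit. Branches merged earlier have no one
left in the token block, and the remaining ones lack one of the two ones. -/
theorem mergeGate_mergeState {k x : ℕ} (hφ : Dead tok P fb φ) (htok : tok + P ≤ fb)
    (heb : eb + q ≤ fb) (hdis : tok + P ≤ eb ∨ eb + q ≤ tok)
    (hJ : ∀ i ∈ I, ∀ z ∈ J i, ¬ Live tok P fb z ∧ ¬ (eb ≤ z ∧ z < eb + q))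
    (hu : ∀ i ∈ I, u i < P) (hy : ∀ i ∈ I, y i < q) (hx : x < P) (hk : k < q) :
    QState.mergeGate (tok + x) (eb + k) (fb + (k * P + x))
      (mergeState φ tok fb P eb I J c y u (k * P + x)) =
    mergeState φ tok fb P eb I J c y u (k * P + (x + 1)) := by
  unfold mergeState
  rw [map_add, map_sum, hφ.mergeGate (Or.inl ⟨by omega, by omega⟩) (Or.inr (by omega))]
  congr 1
  refine Finset.sum_congr rfl fun i hi => ?_
  have hui := hu i hi
  have hyi := hy i hi
  have hJt : ∀ v < P, tok + v ∉ J i := fun v hv h => (hJ i hi _ h).1 (Or.inl ⟨by omega, by omega⟩)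
  have hJf : ∀ v, fb + v ∉ J i := fun v h => (hJ i hi _ h).1 (Or.inr (by omega))
  have hJe : ∀ v < q, eb + v ∉ J i := fun v hv h => (hJ i hi _ h).2 ⟨by omega, by omega⟩
  by_cases h1 : y i * P + u i < k * P + x
  · rw [if_pos h1, if_pos (by omega)]
    refine QState.mergeGate_fix ?_ ?_ _
    · rw [Finset.mem_insert]
      rintro (h | h)
      · omega
      · exact hJf _ h
    · rintro ⟨h, -⟩
      rw [Finset.mem_insert] at h
      rcases h with h | h
      · omega
      · exact hJt x hx h
  · rw [if_neg h1]
    by_cases h2 : y i = k ∧ u i = x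
    · obtain ⟨rfl, rfl⟩ := h2
      rw [if_pos (by omega)]
      exact QState.mergeGate_hit (hJt _ hui) (hJe _ hyi) (hJf _) (by omega) (by omega) (by omega) _
    · have h3 : y i * P + u i ≠ k * P + x := by
        intro h
        apply h2
        have e1 : (u i + P * y i) / P = (x + P * k) / P := by congr 1; linarith
        rw [Nat.add_mul_div_left _ _ (by omega), Nat.add_mul_div_left _ _ (by omega),
          Nat.div_eq_of_lt hui, Nat.div_eq_of_lt hx, zero_add, zero_add] at e1
        exact ⟨e1, by rw [e1] at h; omega⟩
      rw [if_neg (by omega)]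
      refine QState.mergeGate_fix ?_ ?_ _
      · simp only [Finset.mem_insert]
        rintro (h | h | h)
        · omega
        · omega
        · exact hJf _ h
      · simp only [Finset.mem_insert]
        rintro ⟨h, h'⟩
        have := hJt x hx
        have := hJe k hk
        apply h2
        constructor
        · rcases h' with h' | h' | h'
          · omega
          · omega
          · tauto
        · rcases h with h | h | h
          · omega
          · omega
          · tauto

/-- For the indices `i` with `y i * P + u i < n`, the one at `tok + (y i * P + u i)` is split into
ones at `fb + u i` and `fb + P + y i`. -/
def splitState (φ : QState) (tok fb P : ℕ) (I : Finset ι) (J : ι → Finset ℕ) (c : ι → ℂ)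
    (y u : ι → ℕ) (n : ℕ) : QState :=
  φ + ∑ i ∈ I, Finsupp.single (if y i * P + u i < n then
      insert (fb + u i) (insert (fb + P + y i) (J i))
    else insert (tok + (y i * P + u i)) (J i)) (c i)

/-- The mirror image of merging. A branch split earlier has its new ones at a different pair, so it
cannot have both `fb + x` and `fb + P + k` set; a later branch has zeros at all new qubits. -/
theorem splitGate_splitState {k x : ℕ} (hφ : Dead tok (q * P) fb φ) (htok : tok + q * P ≤ fb)
    (hJ : ∀ i ∈ I, ∀ z ∈ J i, ¬ Live tok (q * P) fb z)
    (hu : ∀ i ∈ I, u i < P) (hy : ∀ i ∈ I, y i < q) (hx : x < P) (hk : k < q) :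
    QState.splitGate (fb + x) (fb + P + k) (tok + (k * P + x))
      (splitState φ tok fb P I J c y u (k * P + x)) =
    splitState φ tok fb P I J c y u (k * P + (x + 1)) := by
  have hlt := mul_add_lt hx hk
  unfold splitState
  rw [map_add, map_sum, hφ.splitGate (Or.inr (by omega)) (Or.inl ⟨by omega, by omega⟩)]
  congr 1
  refine Finset.sum_congr rfl fun i hi => ?_
  have hui := hu i hi
  have hyi := hy i hi
  have hlti := mul_add_lt hui hyi
  have hJt : ∀ v < q * P, tok + v ∉ J i := fun v hv h => hJ i hi _ h (Or.inl ⟨by omega, by omega⟩)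
  have hJf : ∀ v, fb + v ∉ J i := fun v h => hJ i hi _ h (Or.inr (by omega))
  have hJe : ∀ v, fb + P + v ∉ J i := fun v h => hJ i hi _ h (Or.inr (by omega))
  have heq : y i * P + u i = k * P + x → y i = k ∧ u i = x := by
    intro h
    have e1 : (u i + P * y i) / P = (x + P * k) / P := by congr 1; linarith
    rw [Nat.add_mul_div_left _ _ (by omega), Nat.add_mul_div_left _ _ (by omega),
      Nat.div_eq_of_lt hui, Nat.div_eq_of_lt hx, zero_add, zero_add] at e1
    exact ⟨e1, by rw [e1] at h; omega⟩
  by_cases h1 : y i * P + u i < k * P + x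
  · rw [if_pos h1, if_pos (by omega)]
    refine QState.splitGate_fix ?_ ?_ _
    · simp only [Finset.mem_insert]
      rintro (h | h | h)
      · omega
      · omega
      · exact hJt _ hlt h
    · simp only [Finset.mem_insert]
      rintro ⟨h, h'⟩
      have := hJf x
      have := hJe k
      have hux : x = u i := by
        rcases h with h | h | h
        · omega
        · omega
        · tauto
      have hyk : k = y i := by
        rcases h' with h' | h' | h'
        · omega
        · omega
        · tauto
      rw [hux, hyk] at h1
      omega
  · rw [if_neg h1]
    by_cases h2 : y i * P + u i = k * P + x
    · obtain ⟨rfl, rfl⟩ := heq h2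
      rw [if_pos (by omega)]
      exact QState.splitGate_hit (hJf _) (hJe _) (hJt _ hlt) (by omega) (by omega) (by omega) _
    · rw [if_neg (by omega)]
      refine QState.splitGate_fix ?_ ?_ _
      · simp only [Finset.mem_insert]
        rintro (h | h)
        · omega
        · exact hJt _ hlt h
      · simp only [Finset.mem_insert]
        rintro ⟨h | h, -⟩
        · omega
        · exact hJf _ h

end Merge

end QRAM

end

/-! ### The elimination executed in memory and on the register in parallel. -/

noncomputable section

namespace QRAM

open State
open Complex (normSq)
open scoped ComplexConjugate

/-! ### Elimination in memory -/

/-- The entry in row `w` and column `u` of the matrix in the array `10`. -/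
abbrev xEntry (w u : NatExp) : NumExp := .get 10 (.add (.get 19 w) u)

/-- The matrix in the array `10` is `X`, with `a` rows and `b` columns. -/
structure HasWorkMatrix (a b : ℕ) (X : ℕ → ℕ → ℂ) (s : State) : Prop where
  dimIn : s.nat 10 (s.nat 43 0) = b
  dimOut : s.nat 10 (s.nat 45 0) = a
  row : ∀ w < a, s.nat 19 w = w * b
  entry : ∀ w < a, ∀ u < b, s.num 10 (w * b + u) = X w u

variable {a b D y j : ℕ} {A X : ℕ → ℕ → ℂ} {s s' : State}

theorem HasWorkMatrix.congr (h : HasWorkMatrix a b X s)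
    (h10 : s'.nat 10 = s.nat 10) (h43 : s'.nat 43 0 = s.nat 43 0) (h45 : s'.nat 45 0 = s.nat 45 0)
    (h19 : s'.nat 19 = s.nat 19) (hX : s'.num 10 = s.num 10) : HasWorkMatrix a b X s' := by
  constructor
  · rw [h10, h43, h.dimIn]
  · rw [h10, h45, h.dimOut]
  · rw [h19]
    exact h.row
  · rw [hX]
    exact h.entry

theorem HasWorkMatrix.same {W V : List ℕ} (h : HasWorkMatrix a b X s) (hf : SameOutside W V s s')
    (hW : ∀ x ∈ W, x ≠ 10 ∧ x ≠ 43 ∧ x ≠ 45 ∧ x ≠ 19) (hV : 10 ∉ V) : HasWorkMatrix a b X s' :=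
  h.congr (funext (hf.1 10 fun h => (hW _ h).1 rfl)) (hf.1 43 (fun h => (hW _ h).2.1 rfl) 0)
    (hf.1 45 (fun h => (hW _ h).2.2.1 rfl) 0) (funext (hf.1 19 fun h => (hW _ h).2.2.2 rfl))
    (funext (hf.2 10 hV))

theorem HasWorkMatrix.entry' (h : HasWorkMatrix a b X s) {w u : ℕ} (hw : w < a) (hu : u < b) :
    s.num 10 (s.nat 19 w + u) = X w u := by
  rw [h.row w hw, h.entry w hw u hu]

theorem mul_add_inj {w u w' u' : ℕ} (hu : u < b) (hu' : u' < b) (h : w * b + u = w' * b + u') :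
    w = w' ∧ u = u' := by
  have e1 : (u + b * w) / b = (u' + b * w') / b := by congr 1; linarith
  rw [Nat.add_mul_div_left _ _ (by omega), Nat.add_mul_div_left _ _ (by omega),
    Nat.div_eq_of_lt hu, Nat.div_eq_of_lt hu', zero_add, zero_add] at e1
  exact ⟨e1, by rw [e1] at h; omega⟩

/-- Writes the matrix of the current vertex, divided by its norm, to the array `10`. -/
def loadProg : Prog :=
  forTo 20 dimOut (forTo 21 dimIn
    (.setNum 10 (.add (.get 19 (var 20)) (var 21))
      (.div (entry (var 20) (var 21)) (.get 8 (.lit 2)))))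

theorem runs_loadProg (hA : HasMatrix a b A s) (ha : a ≤ D) (hb : b ≤ D)
    (hrow : ∀ w < a, s.nat 19 w = w * b) :
    Runs loadProg s (D * (D * 3 + 4) + 2) fun s' =>
      SameOutside [20, 21] [10] s s' ∧ s'.qubits = s.qubits ∧
      HasWorkMatrix a b (fun w u => A w u / s.num 8 2) s' := by
  refine Runs.le (Runs.forTo (τ := D * 3 + 2) a D ha
    (fun k s' => SameOutside [20, 21] [10] s s' ∧ s'.qubits = s.qubits ∧ s'.nat 20 0 = k ∧
      ∀ w < k, ∀ u < b, s'.num 10 (w * b + u) = A w u / s.num 8 2) ?_ ?_ ?_ ?_) (by ring_nf; omega)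
  · exact ⟨(SameOutside.refl _ _ _).setNat (by simp), rfl, by simp, fun w hw => by omega⟩
  · rintro k s' ⟨hf, -, hk, -⟩
    exact ⟨hk, (hA.same hf (by simp) (by simp)).dimOut⟩
  · rintro k hk s₁ ⟨hf, hqu, hk', hX⟩
    refine Runs.le (Runs.forTo (τ := 1) b D hb
      (fun j s' => SameOutside [20, 21] [10] s s' ∧ s'.qubits = s.qubits ∧ s'.nat 20 0 = k ∧
        s'.nat 21 0 = j ∧ (∀ w < k, ∀ u < b, s'.num 10 (w * b + u) = A w u / s.num 8 2) ∧
        ∀ u < j, s'.num 10 (k * b + u) = A k u / s.num 8 2) ?_ ?_ ?_ ?_) (by omega)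
    · exact ⟨hf.setNat (by simp), hqu, by simp [hk'], by simp, by simpa using hX,
        fun u hu => by omega⟩
    · rintro k s' ⟨hf, -, -, hk, -⟩
      exact ⟨hk, (hA.same hf (by simp) (by simp)).dimIn⟩
    · rintro j hj s₂ ⟨hf, hqu, hk', hj', hX, hX'⟩
      have hA₂ := hA.same hf (by simp) (by simp)
      have hi : NatExp.eval s₂ (.add (.get 19 (var 20)) (var 21)) = k * b + j := by
        simp [NatExp.eval, hk', hj', hf.1, hrow k hk]
      have hv : NumExp.eval s₂ (.div (entry (var 20) (var 21)) (.get 8 (.lit 2))) =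
          A k j / s.num 8 2 := by
        simp [NumExp.eval, NatExp.eval, hk', hj', hA₂.entry k hk j hj, hf.2]
      refine Runs.setNum ?_
      rw [hi, hv]
      refine ⟨by simp [hj'], (hf.setNum (by simp)).setNat (by simp), hqu, by simp [hk'], by simp,
        ?_, ?_⟩
      · intro w hw u hu
        have : w * b + u ≠ k * b + j := fun h => by
          have := mul_add_inj hu hj h
          omega
        simp [this, hX w hw u hu]
      · intro u hu
        rcases Nat.lt_or_eq_of_le (Nat.lt_succ_iff.1 hu) with hu | rfl
        · simp [hu.ne, hX' u hu]
        · simp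
    · rintro s₂ ⟨hf, hqu, hk', hj', hX, hX'⟩
      refine ⟨hk', hf.setNat (by simp), hqu, by simp, ?_⟩
      intro w hw u hu
      rcases Nat.lt_or_eq_of_le (Nat.lt_succ_iff.1 hw) with hw | rfl
      · simp [hX w hw u hu]
      · simp [hX' u hu]
  · rintro s₁ ⟨hf, hqu, hk', hX⟩
    have hA₁ := hA.same hf (by simp) (by simp)
    refine ⟨hf, hqu, hA₁.dimIn, hA₁.dimOut, fun w hw => by simp [hf.1, hrow w hw], hX⟩

/-- Writes the additional column for the elimination of the row given by the variable `20` to the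
array `11`. -/
def pivotProg : Prog := block [
  sumProg 21 dimIn 12 (.lit 4)
    (.mul (xEntry (var 20) (var 21)) (.conj (xEntry (var 20) (var 21)))),
  .setNum 12 (.lit 4) (.sqrtRe (.sub (.ofNat (.lit 1)) (.get 12 (.lit 4)))),
  forTo 21 dimOut (block [
    sumProg 22 dimIn 11 (var 21)
      (.mul (xEntry (var 21) (var 22)) (.conj (xEntry (var 20) (var 22)))),
    .setNum 11 (var 21)
      (.div (.sub (.ofNat (.lit 0)) (.get 11 (var 21))) (.get 12 (.lit 4)))]),
  .setNum 11 (var 20) (.get 12 (.lit 4))]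

theorem runs_pivotProg (hX : HasWorkMatrix a b X s) (ha : a ≤ D) (hb : b ≤ D)
    (hy : s.nat 20 0 = y) (hya : y < a) :
    Runs pivotProg s (D * (D * 3 + 11) + 9) fun s' =>
      SameOutside [21, 22] [11, 12] s s' ∧ s'.qubits = s.qubits ∧
      ∀ w < a, s'.num 11 w = if w = y then
          (Real.sqrt (1 - ∑ u ∈ Finset.range b, normSq (X y u)) : ℂ)
        else (0 - ∑ u ∈ Finset.range b, X w u * conj (X y u)) /
          (Real.sqrt (1 - ∑ u ∈ Finset.range b, normSq (X y u)) : ℂ) := by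
  set k : ℝ := Real.sqrt (1 - ∑ u ∈ Finset.range b, normSq (X y u)) with hk
  refine Runs.le (Runs.block_cons (τ' := D * (D * 3 + 8) + 5)
    ((runs_sumProg (n := b) (i₀ := 4) (D := D)
    (f := fun u => X y u * conj (X y u)) hb rfl ?_).post ?_)) (by ring_nf; omega)
  · intro j s' h1 h2 h3
    refine ⟨rfl, by simp [NatExp.eval, h1, hX.dimIn], fun hj => ?_⟩
    simp [NumExp.eval, NatExp.eval, h1, h2, h3, hy, hX.entry' hya hj]
  rintro s₁ ⟨hf₁, hqu₁, h4, -⟩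
  have hX₁ := hX.same hf₁ (by simp) (by simp)
  have hk' : NumExp.eval s₁ (.sqrtRe (.sub (.ofNat (.lit 1)) (.get 12 (.lit 4)))) = (k : ℂ) := by
    simp only [NumExp.eval, NatExp.eval, h4, hk, Complex.mul_conj]
    rw [← Complex.ofReal_sum]
    simp
  refine Runs.le (Runs.block_cons (Runs.setNum ?_)) (τ := 1 + (D * (D * 3 + 8) + 4)) (by omega)
  rw [hk']
  refine Runs.le (Runs.block_cons (Runs.forTo (τ := D * 3 + 6) a D ha
    (fun j s' => SameOutside [21, 22] [11, 12] s s' ∧ s'.qubits = s.qubits ∧ s'.nat 21 0 = j ∧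
      s'.num 12 4 = k ∧
      ∀ w < j, s'.num 11 w = (0 - ∑ u ∈ Finset.range b, X w u * conj (X y u)) / k)
      ?_ ?_ ?_ fun s₂ hs => Runs.block_cons (Runs.setNum (Runs.block_nil ?_)))) (by ring_nf; omega)
  · exact ⟨((hf₁.mono (by simp) (by simp)).setNum (by simp)).setNat (by simp), hqu₁, by simp,
      by simp [NatExp.eval], fun w hw => by omega⟩
  · rintro k s' ⟨hf, -, hk, -⟩
    exact ⟨hk, (hX.same hf (by simp) (by simp)).dimOut⟩
  · rintro w hw s₂ ⟨hf, hqu, hw', h12, h11⟩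
    have hX₂ := hX.same hf (by simp) (by simp)
    refine Runs.le (Runs.block_cons (τ' := 2) ((runs_sumProg (n := b) (i₀ := w) (D := D)
      (f := fun u => X w u * conj (X y u)) hb (by exact hw') ?_).post ?_)) (by omega)
    · intro j s' h1 h2 h3
      refine ⟨by simp [NatExp.eval, h1, hw'], by simp [NatExp.eval, h1, hX₂.dimIn], fun hj => ?_⟩
      simp [NumExp.eval, NatExp.eval, h1, h2, h3, hw', hf.1 20 (by simp) 0, hy, hX₂.entry' hw hj,
        hX₂.entry' hya hj]
    · rintro s₃ ⟨hf', hqu', h5, h6⟩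
      refine Runs.block_cons (Runs.setNum (Runs.block_nil ⟨by simp [hf'.1, hw'],
        ((hf.trans (hf'.mono (by simp) (by simp))).setNum (by simp)).setNat (by simp),
        hqu'.trans hqu, by simp, by simp [hf'.2, h12], fun x hx => ?_⟩))
      rcases Nat.lt_or_eq_of_le (Nat.lt_succ_iff.1 hx) with hx | rfl
      · simp [NatExp.eval, hf'.1, hw', hx.ne, h6 x hx.ne, h11 x hx]
      · simp [NumExp.eval, NatExp.eval, hf'.1, hf'.2, hw', h5, h12]
  · obtain ⟨hf, hqu, hw', h12, h11⟩ := hs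
    refine ⟨hf.setNum (by simp), hqu, fun w hw => ?_⟩
    -- The loop also fills position `y`, with a meaningless quotient; the last instruction replaces
    -- it by the pivot.
    by_cases hwy : w = y
    · simp [NatExp.eval, NumExp.eval, hf.1, hy, hwy, h12]
    · rw [if_neg hwy, ← h11 w hw]
      simp [NatExp.eval, hf.1, hy, hwy]

/-- Applies a rotation to the columns of the matrix, and the corresponding gates to the quantum
register. -/
def rotProg : Prog := block [
  .setNum 12 (.lit 0) (xEntry (var 20) (var 21)),
  .setNum 12 (.lit 1) (.get 11 (var 20)),
  .setNum 12 (.lit 2) (.sqrtRe (.add (.mul (.get 12 (.lit 0)) (.conj (.get 12 (.lit 0))))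
    (.mul (.get 12 (.lit 1)) (.conj (.get 12 (.lit 1)))))),
  .cond (.reLT (.ofNat (.lit 0)) (.get 12 (.lit 2)))
    (block [
      .setNum 13 (.lit 0) (.div (.get 12 (.lit 1)) (.get 12 (.lit 2))),
      .setNum 13 (.lit 1)
        (.div (.sub (.ofNat (.lit 0)) (.conj (.get 12 (.lit 0)))) (.get 12 (.lit 2))),
      .setNum 13 (.lit 2) (.div (.get 12 (.lit 0)) (.get 12 (.lit 2))),
      .setNum 13 (.lit 3) (.div (.get 12 (.lit 1)) (.get 12 (.lit 2))),
      forTo 22 dimOut (block [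
        .setNum 12 (.lit 3) (xEntry (var 22) (var 21)),
        .setNum 10 (.add (.get 19 (var 22)) (var 21))
          (.div (.sub (.mul (.get 12 (.lit 3)) (.get 12 (.lit 1)))
            (.mul (.get 11 (var 22)) (.get 12 (.lit 0)))) (.get 12 (.lit 2))),
        .setNum 11 (var 22)
          (.div (.add (.mul (.get 12 (.lit 3)) (.conj (.get 12 (.lit 0))))
            (.mul (.get 11 (var 22)) (.get 12 (.lit 1)))) (.get 12 (.lit 2)))]),
      rotGateProg (.add (var 6) (var 21)) (.add (var 7) (var 20))])
    .skip]

/-- The first alternative is `r = 0`: then the entry already vanishes, and no rotation can be formed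
by dividing by `r`. -/
theorem runs_rotProg {κ : ℕ → ℂ} {k : ℝ} {tok fb : ℕ} (hX : HasWorkMatrix a b X s) (ha : a ≤ D)
    (hg : HasGateX s) (hκ : ∀ w < a, s.num 11 w = κ w) (hk : κ y = k) (hya : y < a) (hjb : j < b)
    (hy : s.nat 20 0 = y) (hj : s.nat 21 0 = j) (htok : s.nat 6 0 = tok) (hfb : s.nat 7 0 = fb)
    (hle : tok + b ≤ fb) :
    Runs rotProg s (D * 6 + 16) fun s' =>
      SameOutside [22] [10, 11, 12, 13] s s' ∧
      ((X y j = 0 ∧ HasWorkMatrix a b X s' ∧ (∀ w < a, s'.num 11 w = κ w) ∧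
          s'.qubits = s.qubits) ∨
        ∃ r : ℝ, 0 < r ∧ r ^ 2 = normSq (X y j) + k ^ 2 ∧
          HasWorkMatrix a b
            (fun w u => if u = j then (X w j * k - κ w * X y j) / r else X w u) s' ∧
          (∀ w < a, s'.num 11 w = (X w j * conj (X y j) + κ w * k) / r) ∧
          s'.qubits = QState.rotGate (rotMatrix (X y j) k r) (tok + j) (fb + y) s.qubits) := by
  set x := X y j with hx
  set r : ℝ := Real.sqrt (normSq x + k ^ 2) with hr
  have hr2 : r ^ 2 = normSq x + k ^ 2 :=
    Real.sq_sqrt (add_nonneg (Complex.normSq_nonneg _) (sq_nonneg _))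
  have hxe : NumExp.eval s (xEntry (var 20) (var 21)) = x := by
    simp [NumExp.eval, NatExp.eval, hy, hj, hX.entry' hya hjb, hx]
  refine Runs.le (Runs.block_cons (τ' := D * 6 + 15) (Runs.setNum ?_)) (by omega)
  rw [hxe]
  refine Runs.le (Runs.block_cons (τ' := D * 6 + 14) (Runs.setNum ?_)) (by omega)
  have hke : NumExp.eval (s.setNum 12 (NatExp.eval s (.lit 0)) x) (.get 11 (var 20)) = k := by
    simp [NumExp.eval, NatExp.eval, hy, hκ y hya, hk]
  rw [hke]
  refine Runs.le (Runs.block_cons (τ' := D * 6 + 13) (Runs.setNum ?_)) (by omega)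
  have hre : ∀ s : State, s.num 12 0 = x → s.num 12 1 = k →
      NumExp.eval s (.sqrtRe (.add (.mul (.get 12 (.lit 0)) (.conj (.get 12 (.lit 0))))
        (.mul (.get 12 (.lit 1)) (.conj (.get 12 (.lit 1)))))) = r := by
    intro s h0 h1
    simp only [NumExp.eval, NatExp.eval, h0, h1, Complex.mul_conj]
    simp [hr, pow_two, Complex.normSq_ofReal]
  rw [hre _ (by simp [NatExp.eval]) (by simp [NatExp.eval])]
  set s₁ := (((s.setNum 12 (NatExp.eval s (.lit 0)) x).setNum 12
    (NatExp.eval (s.setNum 12 (NatExp.eval s (.lit 0)) x) (.lit 1)) k).setNum 12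
    (NatExp.eval ((s.setNum 12 (NatExp.eval s (.lit 0)) x).setNum 12
    (NatExp.eval (s.setNum 12 (NatExp.eval s (.lit 0)) x) (.lit 1)) k) (.lit 2)) r) with hs₁
  have hf₁ : SameOutside [22] [10, 11, 12, 13] s s₁ :=
    (((SameOutside.refl _ _ _).setNum (by simp)).setNum (by simp)).setNum (by simp)
  have hX₁ : HasWorkMatrix a b X s₁ :=
    hX.congr rfl rfl rfl rfl (by funext i; simp [hs₁])
  have h11₁ : ∀ w < a, s₁.num 11 w = κ w := fun w hw => by simp [hs₁, hκ w hw]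
  have h0₁ : s₁.num 12 0 = x := by simp [hs₁, NatExp.eval]
  have h1₁ : s₁.num 12 1 = k := by simp [hs₁, NatExp.eval]
  have h2₁ : s₁.num 12 2 = r := by simp [hs₁, NatExp.eval]
  refine Runs.le (Runs.block_cons (τ' := 1) (Runs.cond (τ := D * 6 + 11) ?_ ?_)) (by omega)
  swap
  · intro hc
    refine Runs.le (Runs.skip (Runs.block_nil ⟨hf₁, Or.inl ⟨?_, hX₁, h11₁, rfl⟩⟩)) (by omega)
    have : ¬ 0 < r := by simpa [Test.Holds, NumExp.eval, NatExp.eval, h2₁] using hc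
    have hr0 : r = 0 := le_antisymm (not_lt.1 this) (Real.sqrt_nonneg _)
    rw [hr0] at hr2
    have h1 := Complex.normSq_nonneg x
    have h2 := sq_nonneg k
    exact Complex.normSq_eq_zero.1 (by nlinarith)
  intro hc
  have hr0 : 0 < r := by simpa [Test.Holds, NumExp.eval, NatExp.eval, h2₁] using hc
  refine Runs.le (Runs.block_cons (Runs.setNum (Runs.block_cons (Runs.setNum (Runs.block_cons
    (Runs.setNum (Runs.block_cons (Runs.setNum (Runs.block_cons (τ' := 5) (Runs.forTo (τ := 4) a D ha
    (fun v s' => SameOutside [22] [10, 11, 12, 13] s s' ∧ s'.nat 22 0 = v ∧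
      s'.num 12 0 = x ∧ s'.num 12 1 = k ∧ s'.num 12 2 = r ∧
      s'.matrixAt 13 0 = rotMatrix x k r ∧
      (∀ w < a, ∀ u < b, s'.num 10 (w * b + u) =
        if w < v ∧ u = j then (X w j * k - κ w * x) / r else X w u) ∧
      (∀ w < a, s'.num 11 w = if w < v then (X w j * conj x + κ w * k) / r else κ w) ∧
      s'.qubits = s.qubits)
      ?_ ?_ ?_ ?_)))))))))) (by omega)
  · refine ⟨?_, by simp, by simp [h0₁], by simp [h1₁], by simp [h2₁], ?_, ?_, ?_, ?_⟩
    · exact ((((hf₁.setNum (by simp)).setNum (by simp)).setNum (by simp)).setNum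
        (by simp)).setNat (by simp)
    · simp [State.matrixAt, rotMatrix, NumExp.eval, NatExp.eval, h0₁, h1₁, h2₁]
    · intro w hw u hu
      simp [hX₁.entry w hw u hu]
    · intro w hw
      simp [h11₁ w hw]
    · simp [hs₁]
  · rintro v s' ⟨hf, hv, -⟩
    refine ⟨hv, ?_⟩
    simp [NatExp.eval, hf.1, hX.dimOut]
  · rintro v hv s₂ ⟨hf, hv', h0, h1, h2, hm, h10, h11, hqu⟩
    have hrow : ∀ w < a, s₂.nat 19 w = w * b := fun w hw => by rw [hf.1 19 (by simp), hX.row w hw]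
    have hj₂ : s₂.nat 21 0 = j := by rw [hf.1 21 (by simp), hj]
    have hXv : s₂.num 10 (v * b + j) = X v j := by rw [h10 v hv j hjb, if_neg (by omega)]
    have hκv : s₂.num 11 v = κ v := by rw [h11 v hv, if_neg (by omega)]
    refine Runs.block_cons (τ := 1) (τ' := 3) (Runs.setNum ?_)
    refine Runs.block_cons (τ := 1) (τ' := 2) (Runs.setNum ?_)
    refine Runs.block_cons (τ := 1) (τ' := 1) (Runs.setNum (Runs.block_nil ?_))
    refine ⟨by simp [hv'], ?_, by simp, by simp [NatExp.eval, h0], by simp [NatExp.eval, h1],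
      by simp [NatExp.eval, h2], ?_, ?_, ?_, hqu⟩
    · exact (((hf.setNum (by simp)).setNum (by simp)).setNum (by simp)).setNat (by simp)
    · rw [← hm]
      simp [State.matrixAt]
    · intro w hw u hu
      by_cases hwu : w = v ∧ u = j
      · obtain ⟨rfl, rfl⟩ := hwu
        simp [NumExp.eval, NatExp.eval, hv', hj₂, hrow w hw, hXv, hκv, h0, h1, h2]
      · have hne : ¬ (w * b + u = v * b + j) := fun h => hwu (mul_add_inj hu hjb h)
        have : (w ≤ v ∧ u = j) ↔ (w < v ∧ u = j) := by omega
        simp [NatExp.eval, hv', hj₂, hrow v hv, hne, h10 w hw u hu, this]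
    · intro w hw
      by_cases hwv : w = v
      · obtain rfl := hwv
        simp [NumExp.eval, NatExp.eval, hv', hj₂, hrow w hw, hXv, hκv, h0, h1, h2]
      · have : (w < v + 1) ↔ (w < v) := by omega
        simp [NatExp.eval, hv', hwv, h11 w hw, this]
  · rintro s₂ ⟨hf, hv', h0, h1, h2, hm, h10, h11, hqu⟩
    refine Runs.block_cons (τ := 4) (τ' := 1) (Runs.rotGate (a₀ := tok + j) (c₀ := fb + y)
      (hg.same hf (by simp)) hm
      (rotMatrix_mem hr0.ne' hr2) ?_ ?_ (by omega) (Runs.block_nil (Runs.block_nil ?_)))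
    · simp [NatExp.eval, hf.1, htok, hj]
    · simp [NatExp.eval, hf.1, hfb, hy]
    refine ⟨hf, Or.inr ⟨r, hr0, hr2, ⟨?_, ?_, ?_, ?_⟩, ?_, ?_⟩⟩
    · simp [hf.1, hX.dimIn]
    · simp [hf.1, hX.dimOut]
    · intro w hw
      simp [hf.1, hX.row w hw]
    · intro w hw u hu
      have : (w < a ∧ u = j) ↔ u = j := by simp [hw]
      simp only [h10 w hw u hu, this]
    · intro w hw
      simp only [h11 w hw, hw, if_true]
    · simp only [hqu]

/-- Applies the matrix of the current vertex, divided by its norm, to the token. -/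
def elimProg : Prog := block [
  loadProg,
  forTo 20 dimOut (block [pivotProg, forTo 21 dimIn rotProg]),
  .setNat 6 (.lit 0) (var 7),
  .setNat 7 (.lit 0) (.add (var 7) dimOut)]

-- When all rows are eliminated, `X` vanishes and the invariant `value` says that the new qubits
-- carry the entries of `A / ‖A‖`. What is left on the old token is dead from now on, because the
-- old token and the backgrounds avoid the qubits from `fb` on. None of it is at `∅`, since each
-- leftover basis vector contains a one, so the reference keeps its amplitude.
open scoped Matrix.Norms.L2Operator in
theorem runs_elimProg {ι : Type*} {tok fb : ℕ} {I : Finset ι} {J : ι → Finset ℕ} {c : ι → ℂ}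
    {col : ι → ℕ} {φ : QState} (hA : HasMatrix a b A s) (ha : a ≤ D) (hb : b ≤ D)
    (hrow : ∀ w < a, s.nat 19 w = w * b) (hg : HasGateX s) (hν : s.num 8 2 = ‖toMat a b A‖)
    (hν0 : 0 < ‖toMat a b A‖) (htok : s.nat 6 0 = tok) (hfb : s.nat 7 0 = fb) (hle : tok + b ≤ fb)
    (hφ : Dead tok b fb φ) (hJ : ∀ i ∈ I, ∀ x ∈ J i, ¬ Live tok b fb x) (hcol : ∀ i ∈ I, col i < b)
    (hqu : s.qubits = φ + ∑ i ∈ I, Finsupp.single (insert (tok + col i) (J i)) (c i)) :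
    Runs elimProg s (D * (D * (D * 9 + 40) + 40) + 10) fun s' =>
      SameOutside [6, 7, 20, 21, 22] [10, 11, 12, 13] s s' ∧ s'.nat 6 0 = fb ∧
      s'.nat 7 0 = fb + a ∧ ∃ φ', Dead fb a (fb + a) φ' ∧ φ' ∅ = φ ∅ ∧
        s'.qubits = φ' + ∑ i ∈ I, ∑ w ∈ Finset.range a,
          Finsupp.single (insert (fb + w) (J i)) (c i * (A w (col i) / ‖toMat a b A‖)) := by
  set B : ℕ → ℕ → ℂ := fun w u => A w u / ‖toMat a b A‖ with hB
  have hcontr : RowContraction a b B := rowContraction_of_norm hν0 fun _ _ _ _ => rfl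
  unfold elimProg
  refine Runs.le (Runs.block_cons (τ' := D * (D * (D * 9 + 31) + 36) + 5)
    ((runs_loadProg hA ha hb hrow).post ?_)) (by ring_nf; omega)
  rintro s₁ ⟨hf₁, hqu₁, hX₁⟩
  rw [hν] at hX₁
  refine Runs.le (Runs.block_cons (τ' := 3) (Runs.forTo (τ := D * (D * 9 + 31) + 13) a D ha
    (fun y s' => SameOutside [20, 21, 22] [10, 11, 12, 13] s s' ∧ s'.nat 20 0 = y ∧
      ∃ X α γ, ElimOuter a b B y X α γ ∧ HasWorkMatrix a b X s' ∧
        s'.qubits = φ + tokenState tok fb a b I J c col α γ) ?_ ?_ ?_ ?_)) ?_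
  · refine ⟨(hf₁.mono (by simp) (by simp)).setNat (by simp), by simp, B, _, _,
      ElimOuter.init hcontr, hX₁.congr ?_ ?_ ?_ ?_ rfl, ?_⟩
    · funext i; simp
    · simp
    · simp
    · funext i; simp
    · rw [qubits_setNat, hqu₁, hqu]
      congr 1
      refine Finset.sum_congr rfl fun i hi => ?_
      rw [Finset.sum_eq_single_of_mem (col i) (Finset.mem_range.2 (hcol i hi))]
      · simp
      · intro u _ hu
        simp [hu]
  · rintro y s' ⟨hf, hy, X, α, γ, -, hX, -⟩
    exact ⟨hy, hX.dimOut⟩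
  · rintro y hya s₂ ⟨hf, hy, X, α, γ, hE, hX, hq⟩
    refine Runs.le (Runs.block_cons (τ' := D * (D * 6 + 18) + 3)
      ((runs_pivotProg hX ha hb hy hya).post ?_)) (by ring_nf; omega)
    rintro s₃ ⟨hf₃, hqu₃, hκ⟩
    have hE₃ := hE.inner hya rfl hκ
    refine Runs.block_cons (τ' := 1) (Runs.forTo (τ := D * 6 + 16) b D hb
      (fun j s' => SameOutside [20, 21, 22] [10, 11, 12, 13] s s' ∧ s'.nat 20 0 = y ∧
        s'.nat 21 0 = j ∧
        ∃ X κ α γ, ElimInner a b B y j X κ α γ ∧ HasWorkMatrix a b X s' ∧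
          (∀ w < a, s'.num 11 w = κ w) ∧
          s'.qubits = φ + tokenState tok fb a b I J c col α γ) ?_ ?_ ?_ ?_)
    · refine ⟨((hf.trans (hf₃.mono (by simp) (by simp)))).setNat (by simp), by simp [hf₃.1, hy],
        by simp, X, s₃.num 11, α, γ, hE₃, ?_, fun _ _ => rfl, by simp [hqu₃, hq]⟩
      have := hX.same hf₃ (by simp) (by simp)
      refine this.congr ?_ ?_ ?_ ?_ rfl
      · funext i; simp
      · simp
      · simp
      · funext i; simp
    · rintro j s' ⟨-, -, hj, X, κ, α, γ, -, hX, -⟩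
      exact ⟨hj, hX.dimIn⟩
    · rintro j hjb s₄ ⟨hf, hy, hj, X, κ, α, γ, hE, hX, hκ, hq⟩
      obtain ⟨k, hk0, hk⟩ := hE.pivot
      refine (runs_rotProg (tok := tok) (fb := fb) hX ha (hg.same hf (by simp)) hκ hk hya hjb hy hj
        (by rw [hf.1 6 (by simp), htok]) (by rw [hf.1 7 (by simp), hfb]) hle).post ?_
      rintro s₅ ⟨hf₅, h₅⟩
      refine ⟨by rw [hf₅.1 21 (by simp), hj], (hf.trans (hf₅.mono (by simp) (by simp))).setNat
        (by simp), by simp [hf₅.1, hy], by simp, ?_⟩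
      have hset : ∀ X, HasWorkMatrix a b X s₅ → HasWorkMatrix a b X (s₅.setNat 21 0 (j + 1)) := by
        intro X h
        refine h.congr ?_ ?_ ?_ ?_ rfl
        · funext i; simp
        · simp
        · simp
        · funext i; simp
      rcases h₅ with ⟨h0, hX₅, hκ₅, hqu₅⟩ | ⟨r, hr0, hr2, hX₅, hκ₅, hqu₅⟩
      · exact ⟨X, κ, α, γ, hE.skip h0, hset _ hX₅, hκ₅, by rw [qubits_setNat, hqu₅, hq]⟩
      · refine ⟨_, _, _, _, hE.step hjb hk hr0 hr2 (fun _ _ => rfl) (fun _ => rfl)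
          (fun _ _ => rfl) (fun _ _ => rfl), hset _ hX₅, hκ₅, ?_⟩
        rw [qubits_setNat, hqu₅, hq, map_add, hφ.rotGate (Or.inl ⟨by omega, by omega⟩)
          (Or.inr (by omega)), rotGate_tokenState hle hJ hjb hya]
        · intro u z
          simp [rotMatrix]
        · intro w z
          simp [rotMatrix]
    · rintro s₄ ⟨hf, hy, hj, X, κ, α, γ, hE, hX, hκ, hq⟩
      refine Runs.block_nil ⟨hy, hf.setNat (by simp), by simp, X, α, γ, hE.outer hya, ?_, hq⟩
      refine hX.congr ?_ ?_ ?_ ?_ rfl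
      · funext i; simp
      · simp
      · simp
      · funext i; simp
  · rintro s₂ ⟨hf, hy, X, α, γ, hE, hX, hq⟩
    refine Runs.block_cons (Runs.setNat (Runs.block_cons (Runs.setNat (Runs.block_nil
      ⟨((hf.mono (by simp) (by simp)).setNat (by simp)).setNat (by simp), ?_, ?_,
        φ + ∑ i ∈ I, ∑ u ∈ Finset.range b, Finsupp.single (insert (tok + u) (J i))
          (c i * α u (col i)), ?_, ?_, ?_⟩))))
    · simp [NatExp.eval, hf.1, hfb]
    · have := hX.dimOut
      simp [NatExp.eval, hf.1, hfb] at this ⊢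
      exact this
    · refine Dead.add (hφ.mono ?_) (Dead.sum fun i hi => Dead.sum fun u hu => Dead.single ?_)
      · rintro x (h | h)
        · exact Or.inr h.1
        · exact Or.inr (by omega)
      · intro x hx
        have hu := Finset.mem_range.1 hu
        have hl : Live fb a (fb + a) x → fb ≤ x := by
          rintro (h | h)
          · exact h.1
          · omega
        rcases Finset.mem_insert.1 hx with rfl | hx
        · intro h
          have := hl h
          omega
        · exact fun h => hJ i hi x hx (Or.inr (hl h))
    · rw [Finsupp.add_apply, Finsupp.finsetSum_apply, Finset.sum_eq_zero, add_zero]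
      intro i _
      rw [Finsupp.finsetSum_apply, Finset.sum_eq_zero]
      intro u _
      rw [Finsupp.single_apply, if_neg (Finset.insert_ne_empty _ _)]
    · rw [qubits_setNat, qubits_setNat, hq, tokenState, add_assoc, ← Finset.sum_add_distrib]
      congr 1
      refine Finset.sum_congr rfl fun i hi => ?_
      congr 1
      refine Finset.sum_congr rfl fun w hw => ?_
      have hw := Finset.mem_range.1 hw
      have := hE.value w hw (col i) (hcol i hi)
      rw [if_pos hw, Finset.sum_eq_zero, zero_add] at this
      · rw [this]
      · intro u hu
        rw [hE.done w hw u (Finset.mem_range.1 hu), zero_mul]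
  · ring_nf; omega

end QRAM

end

/-! ### Passing between edge labels and the token. -/

noncomputable section

namespace QRAM

open State

/-! ### One-hot encodings -/

/-- The qubits that are one when the edges `e ∈ Z` have the labels `x e`. -/
def tokens (eb : ℕ → ℕ) (Z : Finset ℕ) (x : ℕ → ℕ) : Finset ℕ := Z.image fun e => eb e + x e

theorem insert_tokens (eb : ℕ → ℕ) (Z : Finset ℕ) (x : ℕ → ℕ) (e : ℕ) :
    insert (eb e + x e) (tokens eb Z x) = tokens eb (insert e Z) x :=
  (Finset.image_insert _ _ _).symm

/-- The blocks of `q` qubits for the edges in `Z` and the block of `b` qubits of the token are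
disjoint, and all of them end before `fb`. -/
structure Layout (q tok b fb : ℕ) (eb : ℕ → ℕ) (Z : Finset ℕ) : Prop where
  token_le : tok + b ≤ fb
  edge_le : ∀ e ∈ Z, eb e + q ≤ fb
  token_edge : ∀ e ∈ Z, tok + b ≤ eb e ∨ eb e + q ≤ tok
  edge_edge : ∀ e ∈ Z, ∀ e' ∈ Z, e ≠ e' → eb e + q ≤ eb e' ∨ eb e' + q ≤ eb e

/-- Up to dead basis vectors, `ψ` is the sum over `i ∈ I` of `c i` times the basis vector in which
the token has the value `u i` and the edges `e ∈ Z` have the labels `x i e`. -/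
structure Encodes {ι : Type*} (q tok b fb : ℕ) (eb : ℕ → ℕ) (Z : Finset ℕ) (I : Finset ι)
    (c : ι → ℂ) (u : ι → ℕ) (x : ι → ℕ → ℕ) (δ : ℂ) (ψ : QState) : Prop where
  layout : Layout q tok b fb eb Z
  token_lt : ∀ i ∈ I, u i < b
  label_lt : ∀ i ∈ I, ∀ e, x i e < q
  state : ∃ φ, Dead tok b fb φ ∧ φ ∅ = δ ∧
    ψ = φ + ∑ i ∈ I, Finsupp.single (insert (tok + u i) (tokens eb Z (x i))) (c i)

variable {ι : Type*} {q tok b fb P D e : ℕ} {eb : ℕ → ℕ} {Z : Finset ℕ} {I : Finset ι}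
  {c : ι → ℂ} {u u' : ι → ℕ} {x : ι → ℕ → ℕ} {δ : ℂ} {ψ : QState} {s : State}

theorem Layout.not_live (h : Layout q tok b fb eb Z) {x : ℕ → ℕ} (hx : ∀ e, x e < q) {z : ℕ}
    (hz : z ∈ tokens eb Z x) : ¬ Live tok b fb z := by
  obtain ⟨e, he, rfl⟩ := Finset.mem_image.1 hz
  have h1 := h.edge_le e he
  have h2 := h.token_edge e he
  have h3 := hx e
  rintro (h | h) <;> omega

theorem Layout.edge_disjoint (h : Layout q tok b fb eb Z) {x : ℕ → ℕ} (hx : ∀ e, x e < q)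
    (he : e ∈ Z) {z : ℕ} (hz : z ∈ tokens eb (Z.erase e) x) : ¬ (eb e ≤ z ∧ z < eb e + q) := by
  obtain ⟨e', he', rfl⟩ := Finset.mem_image.1 hz
  obtain ⟨h1, h2⟩ := Finset.mem_erase.1 he'
  have h3 := h.edge_edge e he e' h2 h1.symm
  have h4 := hx e'
  omega

theorem Layout.mono {Z' : Finset ℕ} (h : Layout q tok b fb eb Z) (hZ : Z' ⊆ Z) :
    Layout q tok b fb eb Z' :=
  ⟨h.token_le, fun e he => h.edge_le e (hZ he), fun e he => h.token_edge e (hZ he),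
    fun e he e' he' => h.edge_edge e (hZ he) e' (hZ he')⟩

/-- A new token at the end. -/
theorem Layout.next (h : Layout q tok b fb eb Z) (b' : ℕ) : Layout q fb b' (fb + b') eb Z :=
  ⟨le_rfl, fun e he => (h.edge_le e he).trans (by omega), fun e he => Or.inr (h.edge_le e he),
    h.edge_edge⟩

theorem Dead.next {φ : QState} (h : Dead tok b fb φ) (b' : ℕ) : Dead fb b' (fb + b') φ :=
  h.mono fun x hx => Or.inr (by rcases hx with h | h <;> omega)

/-! ### Merging edges into the token -/

/-- Merges the edge whose number in the list of input edges is the variable `23` into the token. -/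
def mergeEdgeProg : Prog := block [
  .setNat 27 (.lit 0) (.get 9 (.get 11 (var 23))),
  .setNat 24 (.lit 0) (.lit 0),
  forTo 21 (.get 0 (.lit 0)) (block [
    forTo 22 (.get 10 (var 23)) (mergeGateProg (.add (var 6) (var 22)) (.add (var 27) (var 21))
      (.add (var 7) (.add (var 24) (var 22)))),
    .setNat 24 (.lit 0) (.add (var 24) (.get 10 (var 23)))]),
  .setNat 6 (.lit 0) (var 7),
  .setNat 7 (.lit 0) (.add (var 7) (.get 10 (.add (var 23) (.lit 1))))]

/-- The enlarged token takes `q * P` unused qubits, with the label of `e` as its new most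
significant digit. The old token and the block of `e` are abandoned and never reused, which is why
dead vectors need no cleaning. -/
theorem runs_mergeEdgeProg (hX : HasGateX s) (hq : s.nat 0 0 = q)
    (hP : s.nat 10 (s.nat 23 0) = P) (hP' : s.nat 10 (s.nat 23 0 + 1) = q * P)
    (he : s.nat 11 (s.nat 23 0) = e) (heZ : e ∈ Z) (hqD : q ≤ D) (hPD : P ≤ D)
    (hE : Encodes q (s.nat 6 0) P (s.nat 7 0) (s.nat 9) Z I c u x δ s.qubits) :
    Runs mergeEdgeProg s (D * (D * 6 + 6) + 7) fun s' =>
      SameOutside [6, 7, 21, 22, 24, 27] [] s s' ∧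
      Encodes q (s'.nat 6 0) (q * P) (s'.nat 7 0) (s'.nat 9) (Z.erase e) I c
        (fun i => x i e * P + u i) x δ s'.qubits := by
  obtain ⟨hl, hu, hx, φ, hφ, hφ0, hqu⟩ := hE
  set tok := s.nat 6 0 with htok
  set fb := s.nat 7 0 with hfb
  set eb := s.nat 9 with heb
  have hstart : s.qubits = mergeState φ tok fb P (eb e) I (fun i => tokens eb (Z.erase e) (x i)) c
      (fun i => x i e) u 0 := by
    rw [hqu, mergeState]
    congr 1
    refine Finset.sum_congr rfl fun i _ => ?_
    rw [if_neg (by omega)]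
    congr 2
    rw [insert_tokens, Finset.insert_erase heZ]
  have hgate : ∀ k < q, ∀ z < P, _ := fun k hk z hz =>
    mergeGate_mergeState (q := q) (I := I) (J := fun i => tokens eb (Z.erase e) (x i)) (c := c)
      (y := fun i => x i e) (u := u) hφ hl.token_le (hl.edge_le e heZ)
      (hl.token_edge e heZ) (fun i hi z hz => ⟨(hl.mono (Finset.erase_subset _ _)).not_live
        (hx i hi) hz, hl.edge_disjoint (hx i hi) heZ hz⟩) hu (fun i hi => hx i hi e) hz hk
  refine Runs.le (Runs.block_cons (Runs.setNat (Runs.block_cons (Runs.setNat (Runs.block_cons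
    (τ' := 3) (Runs.forTo (τ := D * 6 + 4) q D hqD
      (fun k s' => SameOutside [21, 22, 24, 27] [] s s' ∧ s'.nat 21 0 = k ∧
        s'.nat 24 0 = k * P ∧ s'.nat 27 0 = eb e ∧
        s'.qubits = mergeState φ tok fb P (eb e) I (fun i => tokens eb (Z.erase e) (x i)) c
          (fun i => x i e) u (k * P)) ?_ ?_ ?_ ?_)))))) (by ring_nf; omega)
  · refine ⟨(((SameOutside.refl _ _ _).setNat (by simp)).setNat (by simp)).setNat (by simp),
      by simp, by simp [NatExp.eval], by simp [NatExp.eval, he, heb], ?_⟩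
    rw [zero_mul, ← hstart]
    rfl
  · rintro k s' ⟨hf, hk, -⟩
    exact ⟨hk, by simp [NatExp.eval, hf.1, hq]⟩
  · rintro k hk s₁ ⟨hf, hk', h24, h27, hqu₁⟩
    refine Runs.le (Runs.block_cons (τ' := 2) (Runs.forTo (τ := 4) P D hPD
      (fun z s' => SameOutside [21, 22, 24, 27] [] s s' ∧ s'.nat 21 0 = k ∧ s'.nat 22 0 = z ∧
        s'.nat 24 0 = k * P ∧ s'.nat 27 0 = eb e ∧
        s'.qubits = mergeState φ tok fb P (eb e) I (fun i => tokens eb (Z.erase e) (x i)) c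
          (fun i => x i e) u (k * P + z)) ?_ ?_ ?_ ?_)) (by omega)
    · exact ⟨hf.setNat (by simp), by simp [hk'], by simp, by simp [h24], by simp [h27], hqu₁⟩
    · rintro z s' ⟨hf, -, hz, -⟩
      exact ⟨hz, by simp [NatExp.eval, hf.1, hP]⟩
    · rintro z hz s₂ ⟨hf, hk', hz', h24, h27, hqu₂⟩
      have h1 := hl.token_le
      have h2 := hl.edge_le e heZ
      refine Runs.mergeGate (a₀ := tok + z) (e₀ := eb e + k) (c₀ := fb + (k * P + z))
        (hX.same hf (by simp)) ?_ ?_ ?_ (by omega) (by omega) ?_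
      · simp [NatExp.eval, hf.1, hz', htok]
      · simp [NatExp.eval, h27, hk']
      · simp [NatExp.eval, hf.1, h24, hz', hfb]
      · refine ⟨hz', ?_, by simp [hk'], by simp, by simp [h24], by simp [h27], ?_⟩
        · exact SameOutside.setNat (s' := { s₂ with qubits := _ }) hf (by simp)
        · rw [qubits_setNat, hqu₂]
          exact hgate k hk z hz
    · rintro s₂ ⟨hf, hk', hz', h24, h27, hqu₂⟩
      refine Runs.block_cons (Runs.setNat (Runs.block_nil ⟨by simp [hk'],
        (hf.setNat (by simp)).setNat (by simp), by simp, ?_, by simp [h27], ?_⟩))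
      · simp [NatExp.eval, h24, hf.1, hP]
        ring
      · rw [qubits_setNat, qubits_setNat, hqu₂, add_mul, one_mul]
  · rintro s₁ ⟨hf, hk', h24, h27, hqu₁⟩
    refine Runs.block_cons (Runs.setNat (Runs.block_cons (Runs.setNat (Runs.block_nil
      ⟨((hf.mono (by simp) (by simp)).setNat (by simp)).setNat (by simp), ?_⟩))))
    have e6 : (s₁.setNat 6 0 fb).nat 6 0 = fb := by simp
    simp only [NatExp.eval, hf.1 7 (by simp), ← hfb]
    have e7 : ((s₁.setNat 6 0 fb).setNat 7 0 ((s₁.setNat 6 0 fb).nat 7 0 +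
        (s₁.setNat 6 0 fb).nat 10 ((s₁.setNat 6 0 fb).nat 23 0 + 1))).nat 7 0 = fb + q * P := by
      simp [hf.1, hP', hfb]
    have e9 : ((s₁.setNat 6 0 fb).setNat 7 0 ((s₁.setNat 6 0 fb).nat 7 0 +
        (s₁.setNat 6 0 fb).nat 10 ((s₁.setNat 6 0 fb).nat 23 0 + 1))).nat 9 = eb := by
      funext i
      simp [hf.1, heb]
    have e6' : ((s₁.setNat 6 0 fb).setNat 7 0 ((s₁.setNat 6 0 fb).nat 7 0 +
        (s₁.setNat 6 0 fb).nat 10 ((s₁.setNat 6 0 fb).nat 23 0 + 1))).nat 6 0 = fb := by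
      simp
    rw [e6', e7, e9]
    refine ⟨(hl.mono (Finset.erase_subset _ _)).next _, fun i hi => mul_add_lt (hu i hi) (hx i hi e),
      hx, φ, hφ.next _, hφ0, ?_⟩
    rw [qubits_setNat, qubits_setNat, hqu₁, mergeState]
    congr 1
    refine Finset.sum_congr rfl fun i hi => ?_
    rw [if_pos (mul_add_lt (hu i hi) (hx i hi e))]

/-- Merges all input edges of the current vertex into the token. -/
def mergeProg : Prog := forTo 23 (var 43) mergeEdgeProg

theorem runs_mergeProg {k : ℕ} {inE : ℕ → ℕ} (hX : HasGateX s) (hq : s.nat 0 0 = q)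
    (hq0 : 0 < q) (hk : s.nat 43 0 = k) (hkD : k ≤ D) (hqD : 0 < k → q ≤ D) (hPD : q ^ k ≤ D)
    (hpw : ∀ j ≤ k, s.nat 10 j = q ^ j)
    (hin : ∀ r < k, s.nat 11 r = inE r) (hinZ : ∀ r < k, inE r ∈ Z)
    (hinj : ∀ i < k, ∀ j < k, inE i = inE j → i = j) (hu : ∀ i ∈ I, u i = 0)
    (hE : Encodes q (s.nat 6 0) 1 (s.nat 7 0) (s.nat 9) Z I c u x δ s.qubits) :
    Runs mergeProg s (D * (D * (D * 6 + 6) + 9) + 2) fun s' =>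
      SameOutside [6, 7, 21, 22, 23, 24, 27] [] s s' ∧
      Encodes q (s'.nat 6 0) (q ^ k) (s'.nat 7 0) (s'.nat 9)
        (Z \ (Finset.range k).image inE) I c
        (fun i => ∑ r ∈ Finset.range k, x i (inE r) * q ^ r) x δ s'.qubits := by
  refine Runs.le (Runs.forTo (τ := D * (D * 6 + 6) + 7) k D hkD
    (fun r s' => SameOutside [6, 7, 21, 22, 23, 24, 27] [] s s' ∧ s'.nat 23 0 = r ∧
      Encodes q (s'.nat 6 0) (q ^ r) (s'.nat 7 0) (s'.nat 9)
        (Z \ (Finset.range r).image inE) I c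
        (fun i => ∑ r ∈ Finset.range r, x i (inE r) * q ^ r) x δ s'.qubits) ?_ ?_ ?_ ?_)
    (by ring_nf; omega)
  · refine ⟨(SameOutside.refl _ _ _).setNat (by simp), by simp, ?_⟩
    have e9 : (s.setNat 23 0 0).nat 9 = s.nat 9 := by
      funext i
      simp
    simp only [e9, nat_setNat, qubits_setNat]
    simp only [Finset.range_zero, Finset.image_empty, Finset.sdiff_empty, Finset.sum_empty,
      pow_zero]
    refine ⟨hE.layout, fun _ _ => by simp, hE.label_lt, ?_⟩
    obtain ⟨φ, h1, h2, h3⟩ := hE.state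
    refine ⟨φ, h1, h2, ?_⟩
    rw [h3]
    congr 1
    refine Finset.sum_congr rfl fun i hi => ?_
    rw [hu i hi]
    simp
  · rintro r s' ⟨hf, hr, -⟩
    exact ⟨hr, by simp [NatExp.eval, hf.1, hk]⟩
  · rintro r hr s₁ ⟨hf, hr', hE₁⟩
    have hmem : inE r ∈ Z \ (Finset.range r).image inE := by
      rw [Finset.mem_sdiff]
      refine ⟨hinZ r hr, fun h => ?_⟩
      obtain ⟨j, hj, hjr⟩ := Finset.mem_image.1 h
      rw [Finset.mem_range] at hj
      have := hinj j (by omega) r hr hjr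
      omega
    refine (runs_mergeEdgeProg (P := q ^ r) (hX.same hf (by simp)) (by rw [hf.1 0 (by simp), hq])
      (by rw [hf.1 10 (by simp), hr', hpw r hr.le])
      (by rw [hf.1 10 (by simp), hr', hpw (r + 1) hr, pow_succ'])
      (by rw [hf.1 11 (by simp), hr', hin r hr]) hmem (hqD (by omega))
      ((Nat.pow_le_pow_right hq0 hr.le).trans hPD) hE₁).post ?_
    rintro s₂ ⟨hf₂, hE₂⟩
    refine ⟨by rw [hf₂.1 23 (by simp), hr'],
      (hf.trans (hf₂.mono (by simp) (by simp))).setNat (by simp), by simp, ?_⟩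
    have e9 : (s₂.setNat 23 0 (r + 1)).nat 9 = s₂.nat 9 := by
      funext i
      simp
    rw [e9, pow_succ', Finset.range_add_one, Finset.image_insert, Finset.sdiff_insert]
    simpa [Finset.sum_insert] using hE₂
  · rintro s' ⟨hf, -, h⟩
    exact ⟨hf, h⟩


/-! ### Splitting edges from the token -/

/-- Splits the output edge with the number given by the variable `28` from the token. -/
def splitEdgeProg : Prog := block [
  .setNat 9 (.get 14 (var 28)) (.add (var 7) (.get 10 (var 28))),
  .setNat 24 (.lit 0) (.lit 0),
  forTo 21 (.get 0 (.lit 0)) (block [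
    forTo 22 (.get 10 (var 28)) (splitGateProg (.add (var 7) (var 22))
      (.add (.add (var 7) (.get 10 (var 28))) (var 21)) (.add (var 6) (.add (var 24) (var 22)))),
    .setNat 24 (.lit 0) (.add (var 24) (.get 10 (var 28)))]),
  .setNat 6 (.lit 0) (var 7),
  .setNat 7 (.lit 0) (.add (.add (var 7) (.get 10 (var 28))) (.get 0 (.lit 0)))]

/-- The most significant digit of the token becomes the label of `e`. The shortened token and the
new edge block, one after the other, take `P + q` unused qubits; as `e ∉ Z`, redirecting its block
leaves the other edges alone. -/
theorem runs_splitEdgeProg (hX : HasGateX s) (hq : s.nat 0 0 = q)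
    (hP : s.nat 10 (s.nat 28 0) = P)
    (he : s.nat 14 (s.nat 28 0) = e) (heZ : e ∉ Z) (hqD : q ≤ D) (hPD : P ≤ D)
    (hu' : ∀ i ∈ I, u' i < P) (huu : ∀ i ∈ I, u i = x i e * P + u' i)
    (hE : Encodes q (s.nat 6 0) (q * P) (s.nat 7 0) (s.nat 9) Z I c u x δ s.qubits) :
    Runs splitEdgeProg s (D * (D * 6 + 6) + 7) fun s' =>
      SameOutside [6, 7, 9, 21, 22, 24] [] s s' ∧
      Encodes q (s'.nat 6 0) P (s'.nat 7 0) (s'.nat 9) (insert e Z) I c u' x δ s'.qubits := by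
  obtain ⟨hl, hu, hx, φ, hφ, hφ0, hqu⟩ := hE
  set tok := s.nat 6 0 with htok
  set fb := s.nat 7 0 with hfb
  set eb := s.nat 9 with heb
  have hstart : s.qubits = splitState φ tok fb P I (fun i => tokens eb Z (x i)) c
      (fun i => x i e) u' 0 := by
    rw [hqu, splitState]
    congr 1
    refine Finset.sum_congr rfl fun i hi => ?_
    rw [if_neg (by omega), huu i hi]
  have hgate : ∀ k < q, ∀ z < P, _ := fun k hk z hz =>
    splitGate_splitState (q := q) (I := I) (J := fun i => tokens eb Z (x i)) (c := c)
      (y := fun i => x i e) (u := u') hφ hl.token_le (fun i hi z hz => hl.not_live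
        (hx i hi) hz) hu' (fun i hi => hx i hi e) hz hk
  refine Runs.le (Runs.block_cons (Runs.setNat (Runs.block_cons (Runs.setNat (Runs.block_cons
    (τ' := 3) (Runs.forTo (τ := D * 6 + 4) q D hqD
      (fun k s' => SameOutside [9, 21, 22, 24] [] s s' ∧ s'.nat 21 0 = k ∧
        s'.nat 24 0 = k * P ∧ (∀ i, s'.nat 9 i = if i = e then fb + P else eb i) ∧
        s'.qubits = splitState φ tok fb P I (fun i => tokens eb Z (x i)) c
          (fun i => x i e) u' (k * P)) ?_ ?_ ?_ ?_)))))) (by ring_nf; omega)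
  · refine ⟨(((SameOutside.refl _ _ _).setNat (by simp)).setNat (by simp)).setNat (by simp),
      by simp, by simp [NatExp.eval], by simp [NatExp.eval, he, hP, heb, hfb], ?_⟩
    rw [zero_mul, ← hstart]
    rfl
  · rintro k s' ⟨hf, hk, -⟩
    exact ⟨hk, by simp [NatExp.eval, hf.1, hq]⟩
  · rintro k hk s₁ ⟨hf, hk', h24, h9, hqu₁⟩
    refine Runs.le (Runs.block_cons (τ' := 2) (Runs.forTo (τ := 4) P D hPD
      (fun z s' => SameOutside [9, 21, 22, 24] [] s s' ∧ s'.nat 21 0 = k ∧ s'.nat 22 0 = z ∧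
        s'.nat 24 0 = k * P ∧ (∀ i, s'.nat 9 i = if i = e then fb + P else eb i) ∧
        s'.qubits = splitState φ tok fb P I (fun i => tokens eb Z (x i)) c
          (fun i => x i e) u' (k * P + z)) ?_ ?_ ?_ ?_)) (by omega)
    · exact ⟨hf.setNat (by simp), by simp [hk'], by simp, by simp [h24], by simp [h9], hqu₁⟩
    · rintro z s' ⟨hf, -, hz, -⟩
      exact ⟨hz, by simp [NatExp.eval, hf.1, hP]⟩
    · rintro z hz s₂ ⟨hf, hk', hz', h24, h9, hqu₂⟩
      have h1 := hl.token_le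
      have h2 := mul_add_lt hz hk
      refine Runs.splitGate (a₀ := fb + z) (e₀ := fb + P + k) (c₀ := tok + (k * P + z))
        (hX.same hf (by simp)) ?_ ?_ ?_ (by omega) (by omega) ?_
      · simp [NatExp.eval, hf.1, hz', hfb]
      · simp [NatExp.eval, hf.1, hk', hfb, hP]
      · simp [NatExp.eval, hf.1, h24, hz', htok]
      · refine ⟨hz', ?_, by simp [hk'], by simp, by simp [h24], by simp [h9], ?_⟩
        · exact SameOutside.setNat (s' := { s₂ with qubits := _ }) hf (by simp)
        · rw [qubits_setNat, hqu₂]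
          exact hgate k hk z hz
    · rintro s₂ ⟨hf, hk', hz', h24, h9, hqu₂⟩
      refine Runs.block_cons (Runs.setNat (Runs.block_nil ⟨by simp [hk'],
        (hf.setNat (by simp)).setNat (by simp), by simp, ?_, by simp [h9], ?_⟩))
      · simp [NatExp.eval, h24, hf.1, hP]
        ring
      · rw [qubits_setNat, qubits_setNat, hqu₂, add_mul, one_mul]
  · rintro s₁ ⟨hf, hk', h24, h9, hqu₁⟩
    refine Runs.block_cons (Runs.setNat (Runs.block_cons (Runs.setNat (Runs.block_nil
      ⟨((hf.mono (by simp) (by simp)).setNat (by simp)).setNat (by simp), ?_⟩))))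
    generalize hs₂ : (s₁.setNat 6 (NatExp.eval s₁ (.lit 0)) (NatExp.eval s₁ (var 7))) = s₂
    generalize hs₃ : (s₂.setNat 7 (NatExp.eval s₂ (.lit 0)) (NatExp.eval s₂
      (.add (.add (var 7) (.get 10 (var 28))) (.get 0 (.lit 0))))) = s₃
    have e6 : s₃.nat 6 0 = fb := by simp [← hs₃, ← hs₂, NatExp.eval, hf.1, hfb]
    have e7 : s₃.nat 7 0 = fb + P + q := by simp [← hs₃, ← hs₂, NatExp.eval, hf.1, hfb, hP, hq]
    have e9 : ∀ i, s₃.nat 9 i = if i = e then fb + P else eb i := by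
      intro i
      simp [← hs₃, ← hs₂, h9]
    have e9' : ∀ i ∈ Z, s₃.nat 9 i = eb i := fun i hi => by
      rw [e9, if_neg (by rintro rfl; exact heZ hi)]
    have e9e : s₃.nat 9 e = fb + P := by simp [e9]
    have hq₃ : s₃.qubits = s₁.qubits := by rw [← hs₃, ← hs₂]; rfl
    rw [e6, e7]
    refine ⟨⟨by omega, ?_, ?_, ?_⟩, hu', hx, φ, hφ.mono ?_, hφ0, ?_⟩
    · intro i hi
      rcases Finset.mem_insert.1 hi with rfl | hi
      · rw [e9e]
      · rw [e9' i hi]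
        have := hl.edge_le i hi
        omega
    · intro i hi
      rcases Finset.mem_insert.1 hi with rfl | hi
      · rw [e9e]
        omega
      · rw [e9' i hi]
        exact Or.inr (hl.edge_le i hi)
    · intro i hi j hj hij
      rcases Finset.mem_insert.1 hi with hi | hi <;> rcases Finset.mem_insert.1 hj with hj | hj
      · exact absurd (hi.trans hj.symm) hij
      · rw [hi, e9e, e9' j hj]
        have := hl.edge_le j hj
        omega
      · rw [hj, e9e, e9' i hi]
        have := hl.edge_le i hi
        omega
      · rw [e9' i hi, e9' j hj]
        exact hl.edge_edge i hi j hj hij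
    · rintro z (hz | hz)
      · exact Or.inr hz.1
      · exact Or.inr (by omega)
    · rw [hq₃, hqu₁, splitState]
      congr 1
      refine Finset.sum_congr rfl fun i hi => ?_
      rw [if_pos (mul_add_lt (hu' i hi) (hx i hi e)), ← insert_tokens, e9e]
      congr 3
      exact Finset.image_congr fun z hz => by simp only [e9' z hz]

/-- Splits all output edges of the current vertex from the token. -/
def expandProg : Prog := forTo 23 (var 45) (block [
  .setNat 28 (.lit 0) (.sub (.sub (var 45) (.lit 1)) (var 23)),
  splitEdgeProg])

/-- A split removes the top digit, so the output edges leave the token in decreasing order; after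
`r` rounds those with numbers in `Finset.Ico (k - r) k` have been split off. -/
theorem runs_expandProg {k : ℕ} {outE : ℕ → ℕ} (hX : HasGateX s) (hq : s.nat 0 0 = q)
    (hq0 : 0 < q) (hk : s.nat 45 0 = k) (hkD : k ≤ D) (hqD : 0 < k → q ≤ D) (hPD : q ^ k ≤ D)
    (hpw : ∀ j ≤ k, s.nat 10 j = q ^ j)
    (hout : ∀ r < k, s.nat 14 r = outE r) (houtZ : ∀ r < k, outE r ∉ Z)
    (hinj : ∀ i < k, ∀ j < k, outE i = outE j → i = j)
    (hE : Encodes q (s.nat 6 0) (q ^ k) (s.nat 7 0) (s.nat 9) Z I c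
      (fun i => ∑ r ∈ Finset.range k, x i (outE r) * q ^ r) x δ s.qubits) :
    Runs expandProg s (D * (D * (D * 6 + 6) + 11) + 2) fun s' =>
      SameOutside [6, 7, 9, 21, 22, 23, 24, 28] [] s s' ∧
      Encodes q (s'.nat 6 0) 1 (s'.nat 7 0) (s'.nat 9)
        (Z ∪ (Finset.range k).image outE) I c (fun _ => 0) x δ s'.qubits := by
  have hlt : ∀ i ∈ I, ∀ r, ∑ j ∈ Finset.range r, x i (outE j) * q ^ j < q ^ r := by
    intro i hi r
    induction r with
    | zero => simp
    | succ r ih =>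
      rw [Finset.sum_range_succ, pow_succ', add_comm]
      exact mul_add_lt ih (hE.label_lt i hi _)
  refine Runs.le (Runs.forTo (τ := D * (D * 6 + 6) + 9) k D hkD
    (fun r s' => r ≤ k ∧ SameOutside [6, 7, 9, 21, 22, 23, 24, 28] [] s s' ∧ s'.nat 23 0 = r ∧
      Encodes q (s'.nat 6 0) (q ^ (k - r)) (s'.nat 7 0) (s'.nat 9)
        (Z ∪ (Finset.Ico (k - r) k).image outE) I c
        (fun i => ∑ j ∈ Finset.range (k - r), x i (outE j) * q ^ j) x δ s'.qubits) ?_ ?_ ?_ ?_)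
    (by ring_nf; omega)
  · refine ⟨by omega, (SameOutside.refl _ _ _).setNat (by simp), by simp, ?_⟩
    have e9 : (s.setNat 23 0 0).nat 9 = s.nat 9 := by
      funext i
      simp
    rw [e9]
    simpa using hE
  · rintro r s' ⟨-, hf, hr, -⟩
    exact ⟨hr, by simp [NatExp.eval, hf.1, hk]⟩
  · rintro r hr s₁ ⟨-, hf, hr', hE₁⟩
    obtain ⟨t, ht⟩ : ∃ t, k - r = t + 1 := ⟨k - r - 1, by omega⟩
    have ht' : k - (r + 1) = t := by omega
    have htk : t < k := by omega
    rw [ht] at hE₁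
    refine Runs.le (Runs.block_cons (τ := 1) (τ' := D * (D * 6 + 6) + 8) (Runs.setNat ?_))
      (by omega)
    generalize hs₂ : s₁.setNat 28 _ _ = s₂
    have hf₂ : SameOutside [6, 7, 9, 21, 22, 23, 24, 28] [] s s₂ := by
      rw [← hs₂]
      exact hf.setNat (by simp)
    have h28 : s₂.nat 28 0 = t := by
      simp [← hs₂, NatExp.eval, hf.1, hk, hr']
      omega
    have hmem : outE t ∉ Z ∪ (Finset.Ico (t + 1) k).image outE := by
      rw [Finset.mem_union]
      rintro (h | h)
      · exact houtZ t htk h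
      · obtain ⟨j, hj, hjr⟩ := Finset.mem_image.1 h
        rw [Finset.mem_Ico] at hj
        have := hinj j (by omega) t htk hjr
        omega
    have e9 : s₂.nat 9 = s₁.nat 9 := by
      funext i
      simp [← hs₂]
    have e6 : s₂.nat 6 0 = s₁.nat 6 0 := by simp [← hs₂]
    have e7 : s₂.nat 7 0 = s₁.nat 7 0 := by simp [← hs₂]
    have eq₂ : s₂.qubits = s₁.qubits := by rw [← hs₂]; rfl
    have e23 : s₂.nat 23 0 = r := by simp [← hs₂, hr']
    rw [← e9, ← e6, ← e7, ← eq₂, pow_succ'] at hE₁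
    refine Runs.block_cons (τ := D * (D * 6 + 6) + 7) (τ' := 1)
      ((runs_splitEdgeProg (P := q ^ t) (u' := fun i => ∑ j ∈ Finset.range t, x i (outE j) * q ^ j)
      (hX.same hf₂ (by simp)) (by rw [hf₂.1 0 (by simp), hq])
      (by rw [hf₂.1 10 (by simp), h28, hpw t htk.le])
      (by rw [hf₂.1 14 (by simp), h28, hout t htk]) hmem (hqD (by omega))
      ((Nat.pow_le_pow_right hq0 htk.le).trans hPD) (fun i hi => hlt i hi t)
      (fun i hi => by rw [Finset.sum_range_succ, add_comm]) hE₁).post ?_)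
    rintro s₃ ⟨hf₃, hE₃⟩
    refine Runs.block_nil ⟨by rw [hf₃.1 23 (by simp), e23], by omega,
      (hf₂.trans (hf₃.mono (by simp) (by simp))).setNat (by simp), by simp, ?_⟩
    have e9 : (s₃.setNat 23 0 (r + 1)).nat 9 = s₃.nat 9 := by
      funext i
      simp
    rw [e9, ht', ← Finset.insert_Ico_add_one_left_eq_Ico htk, Finset.image_insert,
      Finset.union_insert]
    simpa using hE₃
  · rintro s' ⟨-, hf, -, h⟩
    refine ⟨hf, ?_⟩
    rw [Nat.sub_self, ← Finset.range_eq_Ico] at h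
    simpa using h

end QRAM

end

/-! ### Base `q` digits, and a complete swallowing step. -/

noncomputable section

namespace QRAM

open State

/-! ### Digits -/

theorem digitSum_lt {q k : ℕ} {y : ℕ → ℕ} (hy : ∀ r < k, y r < q) :
    ∑ r ∈ Finset.range k, y r * q ^ r < q ^ k := by
  induction k with
  | zero => simp
  | succ k ih =>
    rw [Finset.sum_range_succ, pow_succ', add_comm]
    exact mul_add_lt (ih fun r hr => hy r (by omega)) (hy k (by omega))

theorem digit_digitSum {q k : ℕ} {y : ℕ → ℕ} (hy : ∀ r < k, y r < q) {j : ℕ} (hj : j < k) :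
    (∑ r ∈ Finset.range k, y r * q ^ r) / q ^ j % q = y j := by
  induction k with
  | zero => omega
  | succ k ih =>
    have hy' : ∀ r < k, y r < q := fun r hr => hy r (by omega)
    rw [Finset.sum_range_succ, add_comm]
    rcases Nat.lt_or_eq_of_le (Nat.lt_succ_iff.1 hj) with h | rfl
    · rw [div_pow_mod_add (by have := hy j hj; omega) h, ih hy' h]
    · exact div_pow_mod_top (digitSum_lt hy') (hy j hj)

theorem digitSum_digit {q : ℕ} (hq : 0 < q) {k w : ℕ} (hw : w < q ^ k) :
    ∑ r ∈ Finset.range k, w / q ^ r % q * q ^ r = w := by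
  induction k generalizing w with
  | zero =>
    have : w = 0 := by simpa using hw
    simp [this]
  | succ k ih =>
    have hk : 0 < q ^ k := by positivity
    have hlt : w / q ^ k < q := by
      rw [Nat.div_lt_iff_lt_mul hk]
      rwa [pow_succ'] at hw
    rw [Finset.sum_range_succ, Nat.mod_eq_of_lt hlt]
    have h1 : ∀ r ∈ Finset.range k, w / q ^ r % q * q ^ r = w % q ^ k / q ^ r % q * q ^ r := by
      intro r hr
      conv_lhs => rw [← Nat.div_add_mod' w (q ^ k)]
      rw [div_pow_mod_add hq (Finset.mem_range.1 hr)]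
    rw [Finset.sum_congr rfl h1, ih (Nat.mod_lt _ hk), add_comm, Nat.div_add_mod']

theorem offset_digitSum {q k : ℕ} {y : ℕ → ℕ} (hy : ∀ r < k, y r < q) (P : ℕ → ℕ) :
    offset q k P (∑ r ∈ Finset.range k, y r * q ^ r) = ∑ r ∈ Finset.range k, y r * q ^ P r :=
  Finset.sum_congr rfl fun r hr => by rw [digit_digitSum hy (Finset.mem_range.1 hr)]

namespace EdgeSplit

variable {d : ℕ} {ed mk : ℕ → ℕ} {kin : ℕ} {inE inP : ℕ → ℕ} {kout : ℕ} {outE outP : ℕ → ℕ}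

/-- Applying `sum_eq` to the indicator of `p` shows that each edge number occurs exactly once in the
two lists together; injectivity and exhaustiveness of the lists follow. -/
theorem count (h : EdgeSplit d ed mk kin inE inP kout outE outP) {p : ℕ} (hp : p < d) :
    ((Finset.range kin).filter fun r => inP r = p).card +
      ((Finset.range kout).filter fun r => outP r = p).card = 1 := by
  have := h.sum_eq fun j => if j = p then 1 else 0
  rw [Finset.sum_ite_eq', if_pos (Finset.mem_range.2 hp)] at this
  rw [Finset.card_filter, Finset.card_filter]
  exact this.symm

theorem inP_inj (h : EdgeSplit d ed mk kin inE inP kout outE outP) {r r' : ℕ} (hr : r < kin)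
    (hr' : r' < kin) (hrr : inP r = inP r') : r = r' := by
  have := h.count (h.inEdge r hr).1
  exact Finset.card_le_one.1 (Nat.le.intro this) r (by simp [hr]) r' (by simp [hr', hrr])

theorem outP_inj (h : EdgeSplit d ed mk kin inE inP kout outE outP) {r r' : ℕ} (hr : r < kout)
    (hr' : r' < kout) (hrr : outP r = outP r') : r = r' := by
  have := h.count (h.outEdge r hr).1
  exact Finset.card_le_one.1 (Nat.le.intro ((add_comm _ _).trans this)) r (by simp [hr]) r'
    (by simp [hr', hrr])

theorem exists_eq (h : EdgeSplit d ed mk kin inE inP kout outE outP) {p : ℕ} (hp : p < d) :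
    (∃ r < kin, inE r = ed p) ∨ ∃ r < kout, outE r = ed p := by
  have := h.count hp
  by_contra! hc
  rw [Finset.filter_false_of_mem, Finset.filter_false_of_mem] at this
  · simp at this
  · intro r hr hrp
    rw [Finset.mem_range] at hr
    exact hc.2 r hr (by rw [(h.outEdge r hr).2.1, hrp])
  · intro r hr hrp
    rw [Finset.mem_range] at hr
    exact hc.1 r hr (by rw [(h.inEdge r hr).2.1, hrp])

theorem inE_inj (h : EdgeSplit d ed mk kin inE inP kout outE outP)
    (hed : ∀ i < d, ∀ j < d, ed i = ed j → i = j) {r r' : ℕ} (hr : r < kin) (hr' : r' < kin)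
    (hrr : inE r = inE r') : r = r' := by
  obtain ⟨h1, h2, -⟩ := h.inEdge r hr
  obtain ⟨h3, h4, -⟩ := h.inEdge r' hr'
  exact h.inP_inj hr hr' (hed _ h1 _ h3 (by rw [← h2, ← h4, hrr]))

theorem outE_inj (h : EdgeSplit d ed mk kin inE inP kout outE outP)
    (hed : ∀ i < d, ∀ j < d, ed i = ed j → i = j) {r r' : ℕ} (hr : r < kout) (hr' : r' < kout)
    (hrr : outE r = outE r') : r = r' := by
  obtain ⟨h1, h2, -⟩ := h.outEdge r hr
  obtain ⟨h3, h4, -⟩ := h.outEdge r' hr'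
  exact h.outP_inj hr hr' (hed _ h1 _ h3 (by rw [← h2, ← h4, hrr]))

theorem image_inE (h : EdgeSplit d ed mk kin inE inP kout outE outP) {Z : Finset ℕ}
    (hmk : ∀ e, 0 < mk e ↔ e ∈ Z) :
    (Finset.range kin).image inE = (Finset.range d).image ed ∩ Z := by
  ext e
  simp only [Finset.mem_image, Finset.mem_inter, Finset.mem_range, ← hmk]
  constructor
  · rintro ⟨r, hr, rfl⟩
    obtain ⟨h1, h2, h3⟩ := h.inEdge r hr
    exact ⟨⟨_, h1, h2.symm⟩, h3⟩
  · rintro ⟨⟨p, hp, rfl⟩, h3⟩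
    rcases h.exists_eq hp with ⟨r, hr, hrp⟩ | ⟨r, hr, hrp⟩
    · exact ⟨r, hr, hrp⟩
    · exact absurd h3 (hrp ▸ (h.outEdge r hr).2.2)

theorem image_outE (h : EdgeSplit d ed mk kin inE inP kout outE outP) {Z : Finset ℕ}
    (hmk : ∀ e, 0 < mk e ↔ e ∈ Z) :
    (Finset.range kout).image outE = (Finset.range d).image ed \ Z := by
  ext e
  simp only [Finset.mem_image, Finset.mem_sdiff, Finset.mem_range, ← hmk]
  constructor
  · rintro ⟨r, hr, rfl⟩
    obtain ⟨h1, h2, h3⟩ := h.outEdge r hr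
    exact ⟨⟨_, h1, h2.symm⟩, h3⟩
  · rintro ⟨⟨p, hp, rfl⟩, h3⟩
    rcases h.exists_eq hp with ⟨r, hr, hrp⟩ | ⟨r, hr, hrp⟩
    · exact absurd (hrp ▸ (h.inEdge r hr).2.2) h3
    · exact ⟨r, hr, hrp⟩

/-- Offsets give each digit of the row and column index back the weight it has in the stored tensor.
Their sum is therefore the position of the entry. -/
theorem position (h : EdgeSplit d ed mk kin inE inP kout outE outP) {q : ℕ} {x : ℕ → ℕ}
    (hx : ∀ e, x e < q) :
    offset q kout outP (∑ r ∈ Finset.range kout, x (outE r) * q ^ r) +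
      offset q kin inP (∑ r ∈ Finset.range kin, x (inE r) * q ^ r) =
      ∑ j ∈ Finset.range d, x (ed j) * q ^ j := by
  rw [offset_digitSum fun _ _ => hx _, offset_digitSum fun _ _ => hx _, h.sum_eq, add_comm]
  congr 1
  · exact Finset.sum_congr rfl fun r hr => by rw [(h.inEdge r (Finset.mem_range.1 hr)).2.1]
  · exact Finset.sum_congr rfl fun r hr => by rw [(h.outEdge r (Finset.mem_range.1 hr)).2.1]

/-- Every pair of row and column belongs to a labeling. -/
theorem exists_label (h : EdgeSplit d ed mk kin inE inP kout outE outP)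
    (hed : ∀ i < d, ∀ j < d, ed i = ed j → i = j) {q w u : ℕ} (hq : 0 < q) (hw : w < q ^ kout)
    (hu : u < q ^ kin) : ∃ x : ℕ → ℕ, (∀ e, x e < q) ∧
      ∑ r ∈ Finset.range kout, x (outE r) * q ^ r = w ∧
      ∑ r ∈ Finset.range kin, x (inE r) * q ^ r = u := by
  classical
  refine ⟨fun e => if hr : ∃ r < kout, outE r = e then w / q ^ hr.choose % q else
    if hr : ∃ r < kin, inE r = e then u / q ^ hr.choose % q else 0, ?_, ?_, ?_⟩
  · intro e
    dsimp only
    split_ifs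
    · exact Nat.mod_lt _ hq
    · exact Nat.mod_lt _ hq
    · exact hq
  · conv_rhs => rw [← digitSum_digit hq hw]
    refine Finset.sum_congr rfl fun r hr => ?_
    rw [Finset.mem_range] at hr
    have hex : ∃ r' < kout, outE r' = outE r := ⟨r, hr, rfl⟩
    dsimp only
    rw [dif_pos hex, h.outE_inj hed hex.choose_spec.1 hr hex.choose_spec.2]
  · conv_rhs => rw [← digitSum_digit hq hu]
    refine Finset.sum_congr rfl fun r hr => ?_
    rw [Finset.mem_range] at hr
    have hnex : ¬ ∃ r' < kout, outE r' = inE r := by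
      rintro ⟨r', hr', hrr⟩
      exact (h.outEdge r' hr').2.2 (hrr ▸ (h.inEdge r hr).2.2)
    have hex : ∃ r' < kin, inE r' = inE r := ⟨r, hr, rfl⟩
    dsimp only
    rw [dif_neg hnex, dif_pos hex, h.inE_inj hed hex.choose_spec.1 hr hex.choose_spec.2]

theorem position_lt (h : EdgeSplit d ed mk kin inE inP kout outE outP)
    (hed : ∀ i < d, ∀ j < d, ed i = ed j → i = j) {q w u : ℕ} (hq : 0 < q) (hw : w < q ^ kout)
    (hu : u < q ^ kin) : offset q kout outP w + offset q kin inP u < q ^ d := by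
  obtain ⟨x, hx, rfl, rfl⟩ := h.exists_label hed hq hw hu
  rw [h.position hx]
  exact digitSum_lt fun _ _ => hx _

end EdgeSplit

/-! ### Swallowing a vertex -/

/-- Swallows the current vertex. -/
def vertexProg : Prog := block [
  powersProg, splitProg, offsetProg 42 43 40, offsetProg 44 45 41, rowProg, mergeProg, normProg,
  elimProg, expandProg,
  .setNat 4 (.lit 0) (.add (var 4) (.get 1 (var 3))),
  .setNat 5 (.lit 0) (.add (var 5) (.get 10 (.get 1 (var 3)))),
  .setNat 3 (.lit 0) (.add (var 3) (.lit 1))]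

/-- A bound for the time that `vertexProg` takes. -/
def vertexTime (D : ℕ) : ℕ :=
  (D * (D * 3 + 6) + 4) + ((D * 10 + 5) + ((D * (D * (D * 3 + 7) + 7) + 4) +
  ((D * (D * (D * 3 + 7) + 7) + 4) + ((D * 3 + 4) + ((D * (D * (D * 6 + 6) + 9) + 2) +
  (((D * (D * (D * (D * 6 + 12) + 12) + 11) + 5) + (D * (D * 3 + 8) + 4) + (D + 4)) +
  ((D * (D * (D * 9 + 40) + 40) + 10) + ((D * (D * (D * 6 + 6) + 11) + 2) + 4))))))))

-- `I` and `I'` stand for the partial labelings before and after the step, and `ρ` forgets the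
-- labels of the output edges. `hsum` expresses that a new partial labeling amounts to an old one
-- together with a row index of the vertex matrix. `hν` and `hsum` quantify over all splits because
-- the order of the edges in the two lists is produced by the program.
open scoped Matrix.Norms.L2Operator in
theorem runs_vertexProg {ι ι' : Type*} {q d D : ℕ} {ed : ℕ → ℕ} {f : ℕ → ℂ} {s : State}
    {Z : Finset ℕ} {I : Finset ι} {I' : Finset ι'} {c : ι → ℂ} {c' : ι' → ℂ} {x : ι → ℕ → ℕ}
    {x' : ι' → ℕ → ℕ} {ρ : ι' → ι} {δ : ℂ} {ν : ℝ} (hX : HasGateX s) (hq : s.nat 0 0 = q)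
    (hq0 : 0 < q) (hd : s.nat 1 (s.nat 3 0) = d) (hdD : d ≤ D) (hqD : 0 < d → q ≤ D)
    (hpD : q ^ d ≤ D) (hed : ∀ j < d, s.nat 2 (s.nat 4 0 + j) = ed j)
    (hinj : ∀ i < d, ∀ j < d, ed i = ed j → i = j)
    (hf : ∀ p < q ^ d, s.num 1 (s.nat 5 0 + p) = f p) (hmk : ∀ e, 0 < s.nat 8 e ↔ e ∈ Z)
    (hE : Encodes q (s.nat 6 0) 1 (s.nat 7 0) (s.nat 9) Z I c (fun _ => 0) x δ s.qubits)
    (hν0 : 0 < ν)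
    (hν : ∀ kin inE inP kout outE outP,
      EdgeSplit d ed (s.nat 8) kin inE inP kout outE outP →
      ‖toMat (q ^ kout) (q ^ kin) fun w u => f (offset q kout outP w + offset q kin inP u)‖ = ν)
    (hsum : ∀ kin inE inP kout outE outP,
      EdgeSplit d ed (s.nat 8) kin inE inP kout outE outP → ∀ g : ι → ℕ → QState,
      ∑ i ∈ I, ∑ w ∈ Finset.range (q ^ kout), g i w =
        ∑ i ∈ I', g (ρ i) (∑ r ∈ Finset.range kout, x' i (outE r) * q ^ r))
    (hx' : ∀ i ∈ I', ∀ e, x' i e < q)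
    (hxx' : ∀ i ∈ I', ∀ e ∈ Z, x' i e = x (ρ i) e)
    (hc' : ∀ i ∈ I', c' i = c (ρ i) * (f (∑ j ∈ Finset.range d, x' i (ed j) * q ^ j) / ν)) :
    Runs vertexProg s (vertexTime D) fun s' =>
      SameOutside [3, 4, 5, 6, 7, 8, 9, 10, 11, 14, 19, 20, 21, 22, 23, 24, 25, 26, 27, 28, 40, 41,
        42, 43, 44, 45] [4, 5, 6, 7, 8, 9, 10, 11, 12, 13] s s' ∧
      s'.nat 3 0 = s.nat 3 0 + 1 ∧ s'.nat 4 0 = s.nat 4 0 + d ∧ s'.nat 5 0 = s.nat 5 0 + q ^ d ∧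
      s'.num 9 0 = s.num 9 0 * ν ∧
      (∀ e, 0 < s'.nat 8 e ↔ e ∈ (Z \ (Finset.range d).image ed) ∪ ((Finset.range d).image ed \ Z)) ∧
      Encodes q (s'.nat 6 0) 1 (s'.nat 7 0) (s'.nat 9)
        ((Z \ (Finset.range d).image ed) ∪ ((Finset.range d).image ed \ Z)) I' c' (fun _ => 0) x' δ
        s'.qubits := by
  unfold vertexProg vertexTime
  -- powers
  refine Runs.block_cons ((runs_powersProg hq hd hdD hqD).post ?_)
  rintro s₁ ⟨hf₁, hqu₁, hpw₁⟩
  -- edges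
  refine Runs.block_cons ((runs_splitProg (ed := ed) (D := D)
    (by rw [hf₁.1 1 (by simp), hf₁.1 3 (by simp), hd]) hdD
    (fun j hj => by rw [hf₁.1 2 (by simp), hf₁.1 4 (by simp), hed j hj]) hinj).post ?_)
  rintro s₂ ⟨hf₂, hqu₂, hsp, hmk₂⟩
  have e8 : s₁.nat 8 = s.nat 8 := funext (hf₁.1 8 (by simp))
  rw [e8] at hsp hmk₂
  generalize hkin : s₂.nat 43 0 = kin at hsp
  generalize hinE : s₂.nat 11 = inE at hsp
  generalize hinP : s₂.nat 42 = inP at hsp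
  generalize hkout : s₂.nat 45 0 = kout at hsp
  generalize houtE : s₂.nat 14 = outE at hsp
  generalize houtP : s₂.nat 44 = outP at hsp
  have hcard := hsp.card_eq
  have hpw₂ : ∀ j ≤ d, s₂.nat 10 j = q ^ j := fun j hj => by rw [hf₂.1 10 (by simp), hpw₁ j hj]
  have hF₂ : SameOutside [8, 10, 11, 14, 20, 21, 26, 42, 43, 44, 45] [] s s₂ :=
    (hf₁.mono (by simp) (by simp)).trans (hf₂.mono (by simp) (by simp))
  -- positions
  refine Runs.block_cons ((runs_offsetProg (q := q) (d := d) (D := D) (k := kin) (by norm_num)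
    (by norm_num) (by norm_num) (by norm_num) (by norm_num) (by rw [hF₂.1 0 (by simp), hq]) hqD hq0
    (by omega) hdD hpw₂ hpD hkin (fun r hr => by rw [hinP]; exact (hsp.inEdge r hr).1.le)).post ?_)
  rintro s₃ ⟨hf₃, hqu₃, h40⟩
  rw [hinP] at h40
  have hpw₃ : ∀ j ≤ d, s₃.nat 10 j = q ^ j := fun j hj => by rw [hf₃.1 10 (by simp), hpw₂ j hj]
  have houtP₃ : s₃.nat 44 = outP := by rw [← houtP]; exact funext (hf₃.1 44 (by simp))
  refine Runs.block_cons ((runs_offsetProg (q := q) (d := d) (D := D) (k := kout) (by norm_num)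
    (by norm_num) (by norm_num) (by norm_num) (by norm_num)
    (by rw [hf₃.1 0 (by simp), hF₂.1 0 (by simp), hq]) hqD hq0
    (by omega) hdD hpw₃ hpD (by rw [hf₃.1 45 (by simp), hkout])
    (fun r hr => by rw [houtP₃]; exact (hsp.outEdge r hr).1.le)).post ?_)
  rintro s₄ ⟨hf₄, hqu₄, h41⟩
  rw [houtP₃] at h41
  have hF₄ : SameOutside [20, 21, 22, 24, 25, 40, 41] [] s₂ s₄ :=
    (hf₃.mono (by simp) (by simp)).trans (hf₄.mono (by simp) (by simp))
  have hpow : ∀ k ≤ d, q ^ k ≤ D := fun k hk => (Nat.pow_le_pow_right hq0 hk).trans hpD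
  refine Runs.block_cons ((runs_rowProg (a := q ^ kout) (b := q ^ kin) (D := D)
    (by rw [hF₄.1 10 (by simp), hF₄.1 45 (by simp), hkout, hpw₂ _ (by omega)])
    (hpow _ (by omega))
    (by rw [hF₄.1 10 (by simp), hF₄.1 43 (by simp), hkin, hpw₂ _ (by omega)])).post ?_)
  rintro s₅ ⟨hf₅, hqu₅, h19⟩
  have hF₅ : SameOutside [19, 20, 21, 22, 24, 25, 40, 41] [] s₂ s₅ :=
    (hF₄.mono (by simp) (by simp)).trans (hf₅.mono (by simp) (by simp))
  have hG₅ : SameOutside [8, 10, 11, 14, 19, 20, 21, 22, 24, 25, 26, 40, 41, 42, 43, 44, 45] []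
      s s₅ := (hF₂.mono (by simp) (by simp)).trans (hF₅.mono (by simp) (by simp))
  -- merging
  have hE₅ : Encodes q (s₅.nat 6 0) 1 (s₅.nat 7 0) (s₅.nat 9) Z I c (fun _ => 0) x δ s₅.qubits := by
    rw [hG₅.1 6 (by simp), hG₅.1 7 (by simp), funext (hG₅.1 9 (by simp)), hqu₅, hqu₄, hqu₃, hqu₂,
      hqu₁]
    exact hE
  have hinZ : ∀ r < kin, inE r ∈ Z := fun r hr => (hmk _).1 (hsp.inEdge r hr).2.2
  have hpw₅ : ∀ j ≤ d, s₅.nat 10 j = q ^ j := fun j hj => by rw [hF₅.1 10 (by simp), hpw₂ j hj]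
  refine Runs.block_cons ((runs_mergeProg (k := kin) (D := D) (inE := inE) (hX.same hG₅ (by simp))
    (by rw [hG₅.1 0 (by simp), hq]) hq0 (by rw [hF₅.1 43 (by simp), hkin]) (by omega)
    (fun h => hqD (by omega)) (hpow _ (by omega)) (fun j hj => hpw₅ j (by omega))
    (fun r _ => by rw [hF₅.1 11 (by simp), hinE]) hinZ
    (fun i hi j hj h => hsp.inE_inj hinj hi hj h) (fun _ _ => rfl) hE₅).post ?_)
  rintro s₆ ⟨hf₆, hE₆⟩
  have hF₆ : SameOutside [6, 7, 19, 20, 21, 22, 23, 24, 25, 27, 40, 41] [] s₂ s₆ :=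
    (hF₅.mono (by simp) (by simp)).trans (hf₆.mono (by simp) (by simp))
  -- the norm
  set A : ℕ → ℕ → ℂ := fun w u => f (offset q kout outP w + offset q kin inP u) with hA
  have hAn : ‖toMat (q ^ kout) (q ^ kin) A‖ = ν := hν _ _ _ _ _ _ hsp
  have hA₆ : HasMatrix (q ^ kout) (q ^ kin) A s₆ := by
    refine ⟨?_, ?_, ?_⟩
    · rw [hF₆.1 10 (by simp), hF₆.1 43 (by simp), hkin, hpw₂ _ (by omega)]
    · rw [hF₆.1 10 (by simp), hF₆.1 45 (by simp), hkout, hpw₂ _ (by omega)]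
    · intro w hw u hu
      rw [hF₆.2 1 (by simp), hF₂.2 1 (by simp), hF₆.1 5 (by simp), hF₂.1 5 (by simp),
        hf₆.1 41 (by simp), hf₅.1 41 (by simp), h41 w hw, hf₆.1 40 (by simp), hf₅.1 40 (by simp),
        hf₄.1 40 (by simp), h40 u hu, hf _ (hsp.position_lt hinj hq0 hw hu)]
  refine Runs.block_cons ((runs_normProg hA₆ (hpow _ (by omega)) (hpow _ (by omega))
    (by positivity)).post ?_)
  rintro s₇ ⟨hf₇, hqu₇, hnorm, hdelta⟩
  rw [hAn] at hdelta
  have hF₇ : SameOutside [6, 7, 19, 20, 21, 22, 23, 24, 25, 27, 40, 41] [4, 5, 6, 7, 8, 9] s₂ s₇ :=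
    (hF₆.mono (by simp) (by simp)).trans (hf₇.mono (by simp) (by simp))
  have hG₇ : SameOutside [6, 7, 8, 10, 11, 14, 19, 20, 21, 22, 23, 24, 25, 26, 27, 40, 41, 42, 43,
      44, 45] [4, 5, 6, 7, 8, 9] s s₇ :=
    (hF₂.mono (by simp) (by simp)).trans (hF₇.mono (by simp) (by simp))
  -- applying the matrix
  obtain ⟨hl, hu, hx, φ, hφ, hφ0, hqu₆⟩ := hE₆
  have e6₇ : s₇.nat 6 0 = s₆.nat 6 0 := hf₇.1 6 (by simp) 0
  have e7₇ : s₇.nat 7 0 = s₆.nat 7 0 := hf₇.1 7 (by simp) 0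
  refine Runs.block_cons ((runs_elimProg (D := D) (hA₆.same hf₇ (by simp) (by simp))
    (hpow _ (by omega)) (hpow _ (by omega))
    (fun w hw => by rw [hf₇.1 19 (by simp), hf₆.1 19 (by simp), h19 w hw.le])
    (hX.same hG₇ (by simp)) hnorm (by rw [hAn]; exact hν0) e6₇ e7₇ hl.token_le hφ
    (fun i hi z hz => hl.not_live (hx i hi) hz) hu (hqu₇.trans hqu₆)).post ?_)
  rintro s₈ ⟨hf₈, h6₈, h7₈, φ', hφ', hφ'0, hqu₈⟩
  -- The superposition over old branches and row indices is reindexed by the new branches.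
  rw [hAn, hsum _ _ _ _ _ _ hsp fun i w => Finsupp.single (insert (s₆.nat 7 0 + w) (tokens (s₆.nat 9)
    (Z \ (Finset.range kin).image inE) (x i))) (c i * (A w
      (∑ r ∈ Finset.range kin, x i (inE r) * q ^ r) / ν))] at hqu₈
  have hG₈ : SameOutside [6, 7, 8, 10, 11, 14, 19, 20, 21, 22, 23, 24, 25, 26, 27, 40, 41, 42, 43,
      44, 45] [4, 5, 6, 7, 8, 9, 10, 11, 12, 13] s s₈ :=
    (hG₇.mono (by simp) (by simp)).trans (hf₈.mono (by simp) (by simp))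
  have hF₈ : SameOutside [6, 7, 19, 20, 21, 22, 23, 24, 25, 27, 40, 41]
      [4, 5, 6, 7, 8, 9, 10, 11, 12, 13] s₂ s₈ :=
    (hF₇.mono (by simp) (by simp)).trans (hf₈.mono (by simp) (by simp))
  have e9₈ : s₈.nat 9 = s₆.nat 9 := funext fun i => by
    rw [hf₈.1 9 (by simp), hf₇.1 9 (by simp)]
  have hE₈ : Encodes q (s₈.nat 6 0) (q ^ kout) (s₈.nat 7 0) (s₈.nat 9)
      (Z \ (Finset.range kin).image inE) I' c'
      (fun i => ∑ r ∈ Finset.range kout, x' i (outE r) * q ^ r) x' δ s₈.qubits := by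
    rw [h6₈, h7₈, e9₈]
    refine ⟨hl.next _, fun i hi => digitSum_lt fun _ _ => hx' i hi _, hx', φ', hφ', by rw [hφ'0, hφ0],
      ?_⟩
    rw [hqu₈]
    congr 1
    refine Finset.sum_congr rfl fun i hi => ?_
    congr 2
    · refine Finset.image_congr fun e he => ?_
      rw [hxx' i hi e (Finset.mem_sdiff.1 he).1]
    · have : ∑ r ∈ Finset.range kin, x (ρ i) (inE r) * q ^ r =
          ∑ r ∈ Finset.range kin, x' i (inE r) * q ^ r :=
        Finset.sum_congr rfl fun r hr => by rw [hxx' i hi _ (hinZ r (Finset.mem_range.1 hr))]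
      rw [hc' i hi, ← hsp.position (hx' i hi), this]
  -- expanding
  refine Runs.block_cons ((runs_expandProg (k := kout) (D := D) (outE := outE)
    (hX.same hG₈ (by simp)) (by rw [hG₈.1 0 (by simp), hq]) hq0 (by rw [hF₈.1 45 (by simp), hkout])
    (by omega) (fun h => hqD (by omega)) (hpow _ (by omega))
    (fun j hj => by rw [hF₈.1 10 (by simp), hpw₂ j (by omega)])
    (fun r _ => by rw [hF₈.1 14 (by simp), houtE])
    (fun r hr h => (hsp.outEdge r hr).2.2 ((hmk _).2 (Finset.mem_sdiff.1 h).1))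
    (fun i hi j hj h => hsp.outE_inj hinj hi hj h) hE₈).post ?_)
  rintro s₉ ⟨hf₉, hE₉⟩
  have hF₉ : SameOutside [6, 7, 9, 19, 20, 21, 22, 23, 24, 25, 27, 28, 40, 41]
      [4, 5, 6, 7, 8, 9, 10, 11, 12, 13] s₂ s₉ :=
    (hF₈.mono (by simp) (by simp)).trans (hf₉.mono (by simp) (by simp))
  have hG₉ : SameOutside [6, 7, 8, 9, 10, 11, 14, 19, 20, 21, 22, 23, 24, 25, 26, 27, 28, 40, 41,
      42, 43, 44, 45] [4, 5, 6, 7, 8, 9, 10, 11, 12, 13] s s₉ :=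
    (hG₈.mono (by simp) (by simp)).trans (hf₉.mono (by simp) (by simp))
  have hZ : Z \ (Finset.range kin).image inE ∪ (Finset.range kout).image outE =
      (Z \ (Finset.range d).image ed) ∪ ((Finset.range d).image ed \ Z) := by
    rw [hsp.image_inE hmk, hsp.image_outE hmk, Finset.sdiff_inter_self_right]
  rw [hZ] at hE₉
  refine Runs.block_cons (Runs.setNat (Runs.block_cons (Runs.setNat (Runs.block_cons (Runs.setNat
    (Runs.block_nil ?_))))))
  refine ⟨(((hG₉.mono (by simp) (by simp)).setNat (by simp)).setNat (by simp)).setNat (by simp),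
    ?_, ?_, ?_, ?_, ?_, ?_⟩
  · simp [NatExp.eval, hG₉.1]
  · simp [NatExp.eval, hG₉.1, hd]
  · have := hF₉.1 10 (by simp) d
    simp [NatExp.eval, hG₉.1, hd, this, hpw₂ d le_rfl]
  · simp only [num_setNat]
    rw [hf₉.2 9 (by simp), hf₈.2 9 (by simp), hdelta, hF₆.2 9 (by simp), hF₂.2 9 (by simp)]
  · intro e
    have h8 : s₉.nat 8 e = s₂.nat 8 e := hF₉.1 8 (by simp) e
    have hex : (∃ j < d, ed j = e) ↔ e ∈ (Finset.range d).image ed := by simp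
    simp only [nat_setNat, h8, hmk₂, hex]
    rw [Finset.mem_union, Finset.mem_sdiff, Finset.mem_sdiff, ← hmk]
    by_cases h1 : e ∈ (Finset.range d).image ed <;> by_cases h2 : 0 < s.nat 8 e <;> simp [h1, h2]
  · generalize hs : State.setNat _ 3 _ _ = s₁₀
    have e6 : s₁₀.nat 6 0 = s₉.nat 6 0 := by simp [← hs]
    have e7 : s₁₀.nat 7 0 = s₉.nat 7 0 := by simp [← hs]
    have e9 : s₁₀.nat 9 = s₉.nat 9 := by
      funext i
      simp [← hs]
    have eq : s₁₀.qubits = s₉.qubits := by rw [← hs]; rfl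
    rw [e6, e7, e9, eq]
    exact hE₉

end QRAM

end

/-! ### The input format and the evolution of the cut. -/

noncomputable section

namespace QRAM

/-! ### Reading the input -/

theorem getD_flatten_ofFn {α : Type*} {n : ℕ} (f : Fin n → List α) (a : α) (i : Fin n) {p : ℕ}
    (hp : p < (f i).length) :
    (List.ofFn f).flatten.getD
      ((∑ j ∈ Finset.range i, (if h : j < n then (f ⟨j, h⟩).length else 0)) + p) a =
      (f i).getD p a := by
  induction n with
  | zero => exact i.elim0
  | succ n ih =>
    rw [List.ofFn_succ, List.flatten_cons]
    rcases i.eq_zero_or_eq_succ with rfl | ⟨i, rfl⟩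
    · simp only [Fin.val_zero, Finset.range_zero, Finset.sum_empty, zero_add]
      rw [List.getD_append _ _ _ _ hp]
    · rw [Fin.val_succ, Finset.sum_range_succ', dif_pos (Nat.succ_pos n)]
      have h0 : (⟨0, Nat.succ_pos n⟩ : Fin (n + 1)) = 0 := rfl
      rw [h0, List.getD_append_right _ _ _ _ (by omega), ← ih (fun i => f i.succ) i hp]
      congr 1
      have : ∀ j, (if h : j + 1 < n + 1 then (f ⟨j + 1, h⟩).length else 0) =
          if h : j < n then (f (Fin.succ ⟨j, h⟩)).length else 0 := by
        intro j
        simp only [Nat.add_lt_add_iff_right]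
        rfl
      simp only [this]
      omega

variable {n m q : ℕ} (N : TensorNetwork (Fin n) (Fin m) q) (B : Fin n ≃ Fin n)

/-- The label of the edge with the number `e`. -/
def label (l : Fin m → Fin q) (e : ℕ) : ℕ := if h : e < m then l ⟨e, h⟩ else 0

theorem label_lt (hq : 0 < q) (l : Fin m → Fin q) (e : ℕ) : label l e < q := by
  unfold label
  split_ifs
  · exact Fin.is_lt _
  · exact hq

@[simp] theorem label_val (l : Fin m → Fin q) (e : Fin m) : label l e = l e := by
  simp [label]

/-- The edges at `v` in increasing order. -/
def edgeIso (v : Fin n) : Fin (N.degree v) ≃o N.edgesAt v := (N.edgesAt v).orderIsoOfFin rfl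

/-- The number of the `j`-th edge at `v`. -/
def edgeAt (v : Fin n) (j : ℕ) : ℕ := (edgeList N v).getD j 0

theorem length_edgeList (v : Fin n) : (edgeList N v).length = N.degree v := by simp [edgeList]

theorem length_entryList (v : Fin n) : (entryList N v).length = q ^ N.degree v := by
  simp [entryList]

theorem edgeAt_val (v : Fin n) (j : Fin (N.degree v)) : edgeAt N v j = (edgeIso N v j).1 := by
  rw [edgeAt, List.getD_eq_getElem _ _ (by rw [length_edgeList]; exact j.2)]
  exact List.getElem_ofFn _

theorem edgeAt_inj (v : Fin n) {i j : ℕ} (hi : i < N.degree v) (hj : j < N.degree v)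
    (h : edgeAt N v i = edgeAt N v j) : i = j := by
  have h' := (edgeAt_val N v ⟨i, hi⟩).symm.trans (h.trans (edgeAt_val N v ⟨j, hj⟩))
  exact Fin.mk.inj ((edgeIso N v).injective (Subtype.ext (Fin.ext h')))

theorem mem_image_edgeAt (v : Fin n) {e : ℕ} :
    e ∈ (Finset.range (N.degree v)).image (edgeAt N v) ↔
      ∃ h : e < m, (⟨e, h⟩ : Fin m) ∈ N.edgesAt v := by
  simp only [Finset.mem_image, Finset.mem_range]
  constructor
  · rintro ⟨j, hj, rfl⟩
    rw [edgeAt_val N v ⟨j, hj⟩]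
    exact ⟨Fin.is_lt _, Subtype.prop _⟩
  · rintro ⟨h, he⟩
    refine ⟨(edgeIso N v).symm ⟨⟨e, h⟩, he⟩, Fin.is_lt _, ?_⟩
    rw [edgeAt_val N v, OrderIso.apply_symm_apply]

theorem entryList_getD (v : Fin n) (l : Fin m → Fin q) :
    (entryList N v).getD (∑ j ∈ Finset.range (N.degree v), label l (edgeAt N v j) * q ^ j) 0 =
      N.tensor v fun e => l e := by
  have : (∑ j ∈ Finset.range (N.degree v), label l (edgeAt N v j) * q ^ j) =
      (finFunctionFinEquiv fun j : Fin (N.degree v) => l (edgeIso N v j).1 : Fin _) := by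
    rw [finFunctionFinEquiv_apply, Finset.sum_range]
    refine Finset.sum_congr rfl fun j _ => ?_
    rw [edgeAt_val N v j, label_val]
  rw [this, List.getD_eq_getElem _ _ (by rw [length_entryList]; exact Fin.is_lt _)]
  refine (List.getElem_ofFn _).trans ?_
  congr 1
  funext e
  rw [Fin.eta, Equiv.symm_apply_apply]
  exact congrArg l (congrArg Subtype.val ((edgeIso N v).apply_symm_apply e))

/-- The position of the edges at the `i`-th vertex in the input. -/
def edgePos (i : ℕ) : ℕ :=
  ∑ j ∈ Finset.range i, if h : j < n then N.degree (B ⟨j, h⟩) else 0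

/-- The position of the entries of the `i`-th tensor in the input. -/
def entryPos (i : ℕ) : ℕ :=
  ∑ j ∈ Finset.range i, if h : j < n then q ^ N.degree (B ⟨j, h⟩) else 0

theorem input_degree (ε : ℝ) (i : Fin n) : (input N B ε).nat 1 i = N.degree (B i) := by
  change (List.ofFn fun j => N.degree (B j)).getD i 0 = _
  rw [List.getD_eq_getElem _ _ (by simp), List.getElem_ofFn]

theorem input_edge (ε : ℝ) (i : Fin n) {p : ℕ} (hp : p < N.degree (B i)) :
    (input N B ε).nat 2 (edgePos N B i + p) = edgeAt N (B i) p := by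
  change (List.ofFn fun j => edgeList N (B j)).flatten.getD _ 0 = _
  have := getD_flatten_ofFn (fun j => edgeList N (B j)) 0 i (p := p)
    (by rwa [length_edgeList])
  simp only [length_edgeList] at this
  exact this

theorem input_entry (ε : ℝ) (i : Fin n) {p : ℕ} (hp : p < q ^ N.degree (B i)) :
    (input N B ε).num 1 (entryPos N B i + p) = (entryList N (B i)).getD p 0 := by
  change (List.ofFn fun j => entryList N (B j)).flatten.getD _ 0 = _
  have := getD_flatten_ofFn (fun j => entryList N (B j)) 0 i (p := p)
    (by rwa [length_entryList])
  simp only [length_entryList] at this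
  exact this

theorem edgePos_succ (i : Fin n) : edgePos N B (i + 1) = edgePos N B i + N.degree (B i) := by
  rw [edgePos, Finset.sum_range_succ, dif_pos i.2]
  rfl

theorem entryPos_succ (i : Fin n) :
    entryPos N B (i + 1) = entryPos N B i + q ^ N.degree (B i) := by
  rw [entryPos, Finset.sum_range_succ, dif_pos i.2]
  rfl

/-! ### Cuts -/

/-- The numbers of the edges in the cut. -/
def cutNat (i : ℕ) : Finset ℕ := (N.cut B i).map Fin.valEmbedding

theorem mem_cutNat {i e : ℕ} : e ∈ cutNat N B i ↔ ∃ h : e < m, (⟨e, h⟩ : Fin m) ∈ N.cut B i := by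
  simp only [cutNat, Finset.mem_map, Fin.valEmbedding_apply]
  constructor
  · rintro ⟨e, he, rfl⟩
    exact ⟨e.2, he⟩
  · rintro ⟨h, he⟩
    exact ⟨_, he, rfl⟩

/-- The edges with an end among the first `i` vertices. -/
def touched (i : ℕ) (e : Fin m) : Prop :=
  TensorNetwork.Swallowed B i (N.end₁ e) ∨ TensorNetwork.Swallowed B i (N.end₂ e)

instance (i : ℕ) : DecidablePred (touched N B i) := fun e => by
  unfold touched
  infer_instance

/-- Without loops an edge at `B i` has exactly one end there, so swallowing `B i` changes the number
of its swallowed ends by one and toggles its membership in the cut. Other edges are unaffected. -/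
theorem mem_cut_succ (i : Fin n) (e : Fin m) :
    e ∈ N.cut B (i + 1) ↔
      (e ∈ N.cut B i ∧ e ∉ N.edgesAt (B i)) ∨ (e ∈ N.edgesAt (B i) ∧ e ∉ N.cut B i) := by
  have hl := N.loopless e
  have hB : ¬ TensorNetwork.Swallowed B i (B i) := by simp [TensorNetwork.Swallowed]
  simp only [TensorNetwork.cut, TensorNetwork.edgesAt, Finset.mem_filter, Finset.mem_univ, true_and,
    TensorNetwork.swallowed_succ]
  by_cases h1 : N.end₁ e = B i <;> by_cases h2 : N.end₂ e = B i
  · exact absurd (h1.trans h2.symm) hl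
  · simp [h1, h2, hB]
  · simp [h1, h2, hB]
  · simp [h1, h2]

theorem cutNat_succ (i : Fin n) :
    cutNat N B (i + 1) =
      (cutNat N B i \ (Finset.range (N.degree (B i))).image (edgeAt N (B i))) ∪
        ((Finset.range (N.degree (B i))).image (edgeAt N (B i)) \ cutNat N B i) := by
  ext e
  rw [Finset.mem_union, Finset.mem_sdiff, Finset.mem_sdiff, mem_image_edgeAt, mem_cutNat,
    mem_cutNat]
  by_cases h : e < m
  · simp [h, mem_cut_succ]
  · simp [h]

theorem cutNat_zero : cutNat N B 0 = ∅ := by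
  simp [cutNat, TensorNetwork.cut, TensorNetwork.Swallowed]

theorem cutNat_last : cutNat N B n = ∅ := by
  simp [cutNat, TensorNetwork.cut, TensorNetwork.Swallowed]

theorem touched_succ (i : Fin n) (e : Fin m) :
    touched N B (i + 1) e ↔ touched N B i e ∨ (e ∈ N.edgesAt (B i) ∧ e ∉ N.cut B i) := by
  have hl := N.loopless e
  have hB : ¬ TensorNetwork.Swallowed B i (B i) := by simp [TensorNetwork.Swallowed]
  simp only [touched, TensorNetwork.cut, TensorNetwork.edgesAt, Finset.mem_filter, Finset.mem_univ,
    true_and, TensorNetwork.swallowed_succ]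
  by_cases h1 : N.end₁ e = B i <;> by_cases h2 : N.end₂ e = B i
  · exact absurd (h1.trans h2.symm) hl
  · simp [h1, h2, hB]
    tauto
  · simp [h1, h2, hB]
    tauto
  · simp [h1, h2]

theorem not_touched_of_out (i : Fin n) {e : Fin m} (h : e ∈ N.edgesAt (B i))
    (h' : e ∉ N.cut B i) : ¬ touched N B i e := by
  have hB : ¬ TensorNetwork.Swallowed B i (B i) := by simp [TensorNetwork.Swallowed]
  simp only [touched, TensorNetwork.cut, TensorNetwork.edgesAt, Finset.mem_filter, Finset.mem_univ,
    true_and] at h h' ⊢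
  rcases h with h | h <;> rw [h] at h' ⊢ <;> tauto

theorem touched_of_mem_cut {i : ℕ} {e : Fin m} (h : e ∈ N.cut B i) : touched N B i e := by
  simp only [touched, TensorNetwork.cut, Finset.mem_filter, Finset.mem_univ, true_and] at h ⊢
  tauto

theorem touched_of_mem_edgesAt {i : ℕ} {j : Fin n} (hj : (j : ℕ) < i) {e : Fin m}
    (h : e ∈ N.edgesAt (B j)) : touched N B i e := by
  simp only [touched, TensorNetwork.edgesAt, Finset.mem_filter, Finset.mem_univ, true_and] at h ⊢
  rcases h with h | h <;> rw [h] <;> simp [TensorNetwork.Swallowed, hj]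

theorem touched_last (e : Fin m) : touched N B n e := by
  simp [touched, TensorNetwork.Swallowed]

end QRAM

end

/-! ### Comparison of norms, and sums over partial labelings. -/

noncomputable section

namespace QRAM

open scoped Matrix.Norms.L2Operator

/-! ### Norms of submatrices -/

/-- Extend the vector by zero outside the chosen columns, which preserves its norm, and discard the
coordinates outside the chosen rows. -/
theorem norm_submatrix_le {m n m' n' : Type*} [Fintype m] [Fintype n] [Fintype m'] [Fintype n']
    [DecidableEq n] [DecidableEq n'] (M : Matrix m n ℂ) {f : m' → m} {g : n' → n}
    (hf : f.Injective) (hg : g.Injective) : ‖M.submatrix f g‖ ≤ ‖M‖ := by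
  rw [Matrix.l2_opNorm_def (M.submatrix f g)]
  refine ContinuousLinearMap.opNorm_le_bound _ (norm_nonneg _) fun x => ?_
  set x' : EuclideanSpace ℂ n := WithLp.toLp 2 (Function.extend g x.ofLp 0) with hx'
  have h1 : ‖x'‖ = ‖x‖ := by
    rw [EuclideanSpace.norm_eq, EuclideanSpace.norm_eq]
    congr 1
    refine (Fintype.sum_of_injective g hg _ _ ?_ ?_).symm
    · intro k hk
      simp [hx', Function.extend_apply' _ _ _ hk]
    · intro j
      simp [hx', hg.extend_apply]
  have h2 : ∀ i, Matrix.mulVec M x'.ofLp (f i) = Matrix.mulVec (M.submatrix f g) x.ofLp i := by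
    intro i
    refine (Fintype.sum_of_injective g hg _ _ ?_ ?_).symm
    · intro k hk
      simp [hx', Function.extend_apply' _ _ _ hk]
    · intro j
      simp [hx', hg.extend_apply]
  have h3 := Matrix.l2_opNorm_mulVec M x'
  rw [h1] at h3
  refine le_trans ?_ h3
  change ‖WithLp.toLp 2 (Matrix.mulVec (M.submatrix f g) x.ofLp)‖ ≤
    ‖WithLp.toLp 2 (Matrix.mulVec M x'.ofLp)‖
  rw [EuclideanSpace.norm_eq, EuclideanSpace.norm_eq]
  refine Real.sqrt_le_sqrt ?_
  simp only [← h2]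
  refine (Finset.sum_map Finset.univ ⟨f, hf⟩ fun k => ‖Matrix.mulVec M x'.ofLp k‖ ^ 2).symm.le.trans ?_
  exact Finset.sum_le_univ_sum_of_nonneg fun k => by positivity

theorem norm_submatrix_of_bijective {m n m' n' : Type*} [Fintype m] [Fintype n] [Fintype m']
    [Fintype n'] [DecidableEq n] [DecidableEq n'] (M : Matrix m n ℂ) {f : m' → m} {g : n' → n}
    (hf : f.Bijective) (hg : g.Bijective) : ‖M.submatrix f g‖ = ‖M‖ := by
  refine le_antisymm (norm_submatrix_le M hf.1 hg.1) ?_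
  have h := norm_submatrix_le (M.submatrix f g) (Equiv.ofBijective f hf).symm.injective
    (Equiv.ofBijective g hg).symm.injective
  have e : (M.submatrix f g).submatrix (Equiv.ofBijective f hf).symm (Equiv.ofBijective g hg).symm
      = M := by
    ext i j
    simp only [Matrix.submatrix_apply]
    rw [Equiv.ofBijective_apply_symm_apply f hf, Equiv.ofBijective_apply_symm_apply g hg]
  rwa [e] at h

variable {n m q : ℕ} (N : TensorNetwork (Fin n) (Fin m) q) (B : Fin n ≃ Fin n)

/-- Extension of a labeling of the edges in `S` by zero. -/
def extendLabel [NeZero q] {S : Finset (Fin m)} (y : S → Fin q) (e : Fin m) : Fin q :=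
  if h : e ∈ S then y ⟨e, h⟩ else 0

@[simp] theorem extendLabel_coe [NeZero q] {S : Finset (Fin m)} (y : S → Fin q) (e : S) :
    extendLabel y e = y e := by
  simp [extendLabel]

theorem mem_outEdges (i : Fin n) (e : Fin m) :
    e ∈ N.outEdges B i ↔ e ∈ N.edgesAt (B i) ∧ e ∉ N.cut B i := by
  rw [TensorNetwork.outEdges, Finset.mem_inter, mem_cut_succ]
  tauto

theorem mem_inEdges (i : Fin n) (e : Fin m) :
    e ∈ N.inEdges B i ↔ e ∈ N.edgesAt (B i) ∧ e ∈ N.cut B i := by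
  rw [TensorNetwork.inEdges, Finset.mem_inter, and_comm]

theorem mem_idleEdges (i : Fin n) (e : Fin m) :
    e ∈ N.idleEdges B i ↔ e ∈ N.cut B i ∧ e ∉ N.edgesAt (B i) := Finset.mem_sdiff

/-- The vertex matrix is the block of the swallowing operator in which all idle edges have the label
0. -/
theorem norm_vertexMatrix_le [NeZero q] (i : Fin n) : ‖N.vertexMatrix B i‖ ≤ ‖N.swallowOp B i‖ := by
  have h : N.vertexMatrix B i = (N.swallowMatrix B i).submatrix
      (fun y e => extendLabel y e.1) (fun x e => extendLabel x e.1) := by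
    ext y x
    rw [Matrix.submatrix_apply, TensorNetwork.swallowMatrix, Matrix.of_apply, if_pos]
    · congr 1
      · funext e
        exact (extendLabel_coe y e).symm
      · funext e
        exact (extendLabel_coe x e).symm
    · intro e
      have he := (mem_idleEdges N B i e.1).1 e.2
      change extendLabel y e.1 = extendLabel x e.1
      rw [extendLabel, extendLabel, dif_neg (fun h => he.2 ((mem_outEdges N B i _).1 h).1),
        dif_neg (fun h => he.2 ((mem_inEdges N B i _).1 h).1)]
  rw [h]
  refine norm_submatrix_le _ ?_ ?_
  · intro y y' hy
    funext e
    have := congrFun hy ⟨e.1, N.outEdges_subset B i e.2⟩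
    simpa using this
  · intro x x' hx
    funext e
    have := congrFun hx ⟨e.1, N.inEdges_subset B i e.2⟩
    simpa using this

theorem norm_vertexMatrix_pos (i : Fin n) (h : 0 < ‖N.swallowOp B i‖) :
    0 < ‖N.vertexMatrix B i‖ := by
  rw [norm_pos_iff]
  intro h0
  have : N.swallowMatrix B i = 0 := by
    ext y x
    rw [TensorNetwork.swallowMatrix, Matrix.of_apply, h0]
    simp
  rw [TensorNetwork.swallowOp, this] at h
  simp at h

/-! ### The matrix of a vertex in memory -/

section Split

variable {i : Fin n} {mk : ℕ → ℕ} {kin : ℕ} {inE inP : ℕ → ℕ} {kout : ℕ} {outE outP : ℕ → ℕ}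

theorem exists_outE (h : EdgeSplit (N.degree (B i)) (edgeAt N (B i)) mk kin inE inP kout outE outP)
    (hmk : ∀ e, 0 < mk e ↔ e ∈ cutNat N B i) {e : Fin m} (he : e ∈ N.outEdges B i) :
    ∃ r < kout, outE r = e := by
  have := h.image_outE hmk
  have he' : (e : ℕ) ∈ (Finset.range kout).image outE := by
    rw [this, Finset.mem_sdiff, mem_image_edgeAt, mem_cutNat]
    obtain ⟨h1, h2⟩ := (mem_outEdges N B i e).1 he
    exact ⟨⟨e.2, h1⟩, fun ⟨_, h⟩ => h2 h⟩
  simpa using he'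

theorem exists_inE (h : EdgeSplit (N.degree (B i)) (edgeAt N (B i)) mk kin inE inP kout outE outP)
    (hmk : ∀ e, 0 < mk e ↔ e ∈ cutNat N B i) {e : Fin m} (he : e ∈ N.inEdges B i) :
    ∃ r < kin, inE r = e := by
  have := h.image_inE hmk
  have he' : (e : ℕ) ∈ (Finset.range kin).image inE := by
    rw [this, Finset.mem_inter, mem_image_edgeAt, mem_cutNat]
    obtain ⟨h1, h2⟩ := (mem_inEdges N B i e).1 he
    exact ⟨⟨e.2, h1⟩, e.2, h2⟩
  simpa using he'

theorem outE_mem (h : EdgeSplit (N.degree (B i)) (edgeAt N (B i)) mk kin inE inP kout outE outP)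
    (hmk : ∀ e, 0 < mk e ↔ e ∈ cutNat N B i) {r : ℕ} (hr : r < kout) :
    ∃ e : N.outEdges B i, outE r = (e.1 : ℕ) := by
  have := h.image_outE hmk
  have he' : outE r ∈ (Finset.range kout).image outE :=
    Finset.mem_image_of_mem _ (Finset.mem_range.2 hr)
  rw [this, Finset.mem_sdiff, mem_image_edgeAt, mem_cutNat] at he'
  obtain ⟨⟨h1, h2⟩, h3⟩ := he'
  exact ⟨⟨⟨outE r, h1⟩, (mem_outEdges N B i _).2 ⟨h2, fun h => h3 ⟨h1, h⟩⟩⟩, rfl⟩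

theorem inE_mem (h : EdgeSplit (N.degree (B i)) (edgeAt N (B i)) mk kin inE inP kout outE outP)
    (hmk : ∀ e, 0 < mk e ↔ e ∈ cutNat N B i) {r : ℕ} (hr : r < kin) :
    ∃ e : N.inEdges B i, inE r = (e.1 : ℕ) := by
  have := h.image_inE hmk
  have he' : inE r ∈ (Finset.range kin).image inE :=
    Finset.mem_image_of_mem _ (Finset.mem_range.2 hr)
  rw [this, Finset.mem_inter, mem_image_edgeAt, mem_cutNat] at he'
  obtain ⟨⟨h1, h2⟩, _, h3⟩ := he'
  exact ⟨⟨⟨inE r, h1⟩, (mem_inEdges N B i _).2 ⟨h2, h3⟩⟩, rfl⟩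

/-- Numbering of labelings by digits. -/
theorem bijective_digitSum [NeZero q] {S : Finset (Fin m)} {k : ℕ} {E : ℕ → ℕ}
    (hE : ∀ r < k, ∃ e : S, E r = (e.1 : ℕ)) (hS : ∀ e ∈ S, ∃ r < k, E r = (e : ℕ))
    (hex : ∀ w < q ^ k, ∃ x : ℕ → ℕ, (∀ e, x e < q) ∧ ∑ r ∈ Finset.range k, x (E r) * q ^ r = w) :
    Function.Bijective fun y : S → Fin q =>
      (⟨∑ r ∈ Finset.range k, label (extendLabel y) (E r) * q ^ r,
        digitSum_lt fun _ _ => label_lt (NeZero.pos q) _ _⟩ : Fin (q ^ k)) := by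
  constructor
  · intro y y' h
    rw [Fin.mk.injEq] at h
    funext e
    obtain ⟨r, hr, hre⟩ := hS e.1 e.2
    have h1 := digit_digitSum (k := k)
      (fun r _ => label_lt (NeZero.pos q) (extendLabel y) (E r)) hr
    have h2 := digit_digitSum (k := k)
      (fun r _ => label_lt (NeZero.pos q) (extendLabel y') (E r)) hr
    rw [h, h2, hre, label_val, label_val, extendLabel_coe, extendLabel_coe] at h1
    exact (Fin.ext h1).symm
  · intro w
    obtain ⟨x, hx, hw⟩ := hex w w.2
    refine ⟨fun e => ⟨x e.1, hx _⟩, ?_⟩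
    ext
    simp only
    rw [← hw]
    refine Finset.sum_congr rfl fun r hr => ?_
    obtain ⟨e, he⟩ := hE r (Finset.mem_range.1 hr)
    rw [he, label_val, extendLabel_coe]

/-- The program numbers rows and columns by digit sums in the order in which it found the edges. By
`bijective_digitSum` this only renames the rows and columns of the vertex matrix, so the norm does
not depend on that order. -/
theorem norm_toMat_eq [NeZero q]
    (h : EdgeSplit (N.degree (B i)) (edgeAt N (B i)) mk kin inE inP kout outE outP)
    (hmk : ∀ e, 0 < mk e ↔ e ∈ cutNat N B i) :
    ‖toMat (q ^ kout) (q ^ kin) fun w u =>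
      (entryList N (B i)).getD (offset q kout outP w + offset q kin inP u) 0‖ =
      ‖N.vertexMatrix B i‖ := by
  have hq : 0 < q := NeZero.pos q
  have hed : ∀ j < N.degree (B i), ∀ k < N.degree (B i),
      edgeAt N (B i) j = edgeAt N (B i) k → j = k := fun j hj k hk => edgeAt_inj N (B i) hj hk
  have hF := bijective_digitSum (q := q) (fun r hr => outE_mem N B h hmk hr)
    (fun e he => exists_outE N B h hmk he) fun w hw => by
      obtain ⟨x, hx, hw, -⟩ := h.exists_label hed hq hw (u := 0) (by positivity)
      exact ⟨x, hx, hw⟩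
  have hG := bijective_digitSum (q := q) (fun r hr => inE_mem N B h hmk hr)
    (fun e he => exists_inE N B h hmk he) fun u hu => by
      obtain ⟨x, hx, -, hu⟩ := h.exists_label hed hq (w := 0) (by positivity) hu
      exact ⟨x, hx, hu⟩
  rw [← norm_submatrix_of_bijective _ hF hG]
  congr 1
  ext y x
  -- One labeling combining the row and the column, since positions of entries are computed from a
  -- labeling of all edges.
  set l : Fin m → Fin q := fun e => if e ∈ N.inEdges B i then extendLabel x e else extendLabel y e
    with hl
  have hin : ∀ e ∈ N.inEdges B i, l e = extendLabel x e := fun e he => by rw [hl]; simp only [he, if_true]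
  have hout : ∀ e ∈ N.outEdges B i, l e = extendLabel y e := fun e he => by
    have : e ∉ N.inEdges B i := fun h =>
      ((mem_outEdges N B i e).1 he).2 ((mem_inEdges N B i e).1 h).2
    rw [hl]
    simp only [this, if_false]
  have e1 : ∑ r ∈ Finset.range kout, label (extendLabel y) (outE r) * q ^ r =
      ∑ r ∈ Finset.range kout, label l (outE r) * q ^ r := Finset.sum_congr rfl fun r hr => by
    obtain ⟨e, he⟩ := outE_mem N B h hmk (Finset.mem_range.1 hr)
    rw [he, label_val, label_val, hout e.1 e.2]
  have e2 : ∑ r ∈ Finset.range kin, label (extendLabel x) (inE r) * q ^ r =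
      ∑ r ∈ Finset.range kin, label l (inE r) * q ^ r := Finset.sum_congr rfl fun r hr => by
    obtain ⟨e, he⟩ := inE_mem N B h hmk (Finset.mem_range.1 hr)
    rw [he, label_val, label_val, hin e.1 e.2]
  simp only [Matrix.submatrix_apply, toMat, Matrix.of_apply, e1, e2]
  rw [h.position (label_lt hq l), entryList_getD, TensorNetwork.vertexMatrix, Matrix.of_apply]
  congr 1
  funext e
  split_ifs with he
  · rw [hin e.1 he]
    exact extendLabel_coe x ⟨e.1, he⟩
  · have he' := N.mem_outEdges_of_notMem B i e.2 he
    rw [hout e.1 he']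
    exact extendLabel_coe y ⟨e.1, he'⟩

/-! ### Paths -/

/-- The labelings that are zero at the edges without an end among the first `i` vertices. -/
def paths [NeZero q] (i : ℕ) : Finset (Fin m → Fin q) :=
  Finset.univ.filter fun l => ∀ e, ¬ touched N B i e → l e = 0

/-- Replace the labels of the edges without an end among the first `i` vertices by zero. -/
def cutOff [NeZero q] (i : ℕ) (l : Fin m → Fin q) (e : Fin m) : Fin q :=
  if touched N B i e then l e else 0

/-- The edges touched for the first time in step `i` are the output edges, so a path after the step
is the same as a path before it (by `cutOff`) together with the output labels, read as digits. -/
theorem sum_paths_succ [NeZero q] {M : Type*} [AddCommMonoid M]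
    (h : EdgeSplit (N.degree (B i)) (edgeAt N (B i)) mk kin inE inP kout outE outP)
    (hmk : ∀ e, 0 < mk e ↔ e ∈ cutNat N B i) (g : (Fin m → Fin q) → ℕ → M) :
    ∑ l ∈ paths N B i, ∑ w ∈ Finset.range (q ^ kout), g l w =
      ∑ l ∈ paths N B (i + 1), g (cutOff N B i l)
        (∑ r ∈ Finset.range kout, label l (outE r) * q ^ r) := by
  have hq : 0 < q := NeZero.pos q
  have hed : ∀ j < N.degree (B i), ∀ k < N.degree (B i),
      edgeAt N (B i) j = edgeAt N (B i) k → j = k := fun j hj k hk => edgeAt_inj N (B i) hj hk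
  rw [← Finset.sum_product']
  symm
  refine Finset.sum_nbij (fun l => (cutOff N B i l,
    ∑ r ∈ Finset.range kout, label l (outE r) * q ^ r)) ?_ ?_ ?_ fun _ _ => rfl
  · intro l _
    rw [Finset.mem_product, Finset.mem_range]
    refine ⟨?_, digitSum_lt fun _ _ => label_lt hq _ _⟩
    simp only [paths, Finset.mem_filter, Finset.mem_univ, true_and]
    intro e he
    rw [cutOff, if_neg he]
  · intro l hl l' hl' heq
    rw [Prod.mk.injEq] at heq
    simp only [paths, Finset.coe_filter, Set.mem_ofPred_eq, Finset.mem_univ, true_and] at hl hl'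
    funext e
    by_cases ht : touched N B i e
    · have := congrFun heq.1 e
      rwa [cutOff, cutOff, if_pos ht, if_pos ht] at this
    · by_cases ho : e ∈ N.outEdges B i
      · obtain ⟨r, hr, hre⟩ := exists_outE N B h hmk ho
        have h1 := digit_digitSum (k := kout) (fun r _ => label_lt hq l (outE r)) hr
        have h2 := digit_digitSum (k := kout) (fun r _ => label_lt hq l' (outE r)) hr
        rw [heq.2, h2, hre, label_val, label_val] at h1
        exact (Fin.ext h1).symm
      · have : ¬ touched N B (i + 1) e := by
          rw [touched_succ, ← mem_outEdges]
          tauto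
        rw [hl e this, hl' e this]
  · rintro ⟨l, w⟩ hlw
    simp only [Finset.coe_product, Set.mem_prod, Finset.mem_coe, Finset.mem_range, paths,
      Finset.mem_filter, Finset.mem_univ, true_and] at hlw
    obtain ⟨x, hx, hw, -⟩ := h.exists_label hed hq hlw.2 (u := 0) (by positivity)
    refine ⟨fun e => if touched N B i e then l e else
      if e ∈ N.outEdges B i then ⟨x e, hx _⟩ else 0, ?_, ?_⟩
    · simp only [paths, Finset.coe_filter, Set.mem_ofPred_eq, Finset.mem_univ, true_and]
      intro e he
      rw [touched_succ, ← mem_outEdges] at he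
      rw [if_neg (by tauto), if_neg (by tauto)]
    · rw [Prod.mk.injEq]
      constructor
      · funext e
        rw [cutOff]
        split_ifs with ht
        · rfl
        · exact (hlw.1 e ht).symm
      · rw [← hw]
        refine Finset.sum_congr rfl fun r hr => ?_
        obtain ⟨e, he⟩ := outE_mem N B h hmk (Finset.mem_range.1 hr)
        have h1 := (mem_outEdges N B i e.1).1 e.2
        rw [he, label_val, if_neg (not_touched_of_out N B i h1.1 h1.2), if_pos e.2]

end Split

/-- The norm of the matrix of the `i`-th vertex. -/
def vertexNorm (i : ℕ) : ℝ := if h : i < n then ‖N.vertexMatrix B ⟨i, h⟩‖ else 1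

/-- The entry of the `i`-th tensor at the labeling `l`. -/
def vertexEntry (i : ℕ) (l : Fin m → Fin q) : ℂ :=
  if h : i < n then N.tensor (B ⟨i, h⟩) fun e => l e else 1

/-- The amplitude of the labeling `l` after `i` steps. -/
def amplitude (i : ℕ) (l : Fin m → Fin q) : ℂ :=
  (Real.sqrt 2 : ℂ)⁻¹ * ∏ j ∈ Finset.range i, vertexEntry N B j l / vertexNorm N B j

theorem vertexEntry_cutOff [NeZero q] {i j : ℕ} (hj : j < i) (l : Fin m → Fin q) :
    vertexEntry N B j (cutOff N B i l) = vertexEntry N B j l := by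
  unfold vertexEntry
  split_ifs with h
  · congr 1
    funext e
    rw [cutOff, if_pos (touched_of_mem_edgesAt N B (j := ⟨j, h⟩) hj e.2)]
  · rfl

/-- The tensors of the first `i` vertices read only labels of touched edges. -/
theorem amplitude_cutOff [NeZero q] (i : ℕ) (l : Fin m → Fin q) :
    amplitude N B i (cutOff N B i l) = amplitude N B i l := by
  unfold amplitude
  congr 1
  refine Finset.prod_congr rfl fun j hj => ?_
  rw [vertexEntry_cutOff N B (Finset.mem_range.1 hj)]

theorem amplitude_succ [NeZero q] (i : Fin n) (l : Fin m → Fin q) :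
    amplitude N B (i + 1) l = amplitude N B i (cutOff N B i l) *
      ((entryList N (B i)).getD (∑ j ∈ Finset.range (N.degree (B i)),
        label l (edgeAt N (B i) j) * q ^ j) 0 / vertexNorm N B i) := by
  rw [amplitude_cutOff, entryList_getD, amplitude, amplitude, Finset.prod_range_succ, vertexEntry,
    dif_pos i.2, mul_assoc]

theorem paths_zero [NeZero q] : paths N B 0 = {0} := by
  ext l
  simp only [paths, touched, TensorNetwork.Swallowed, Finset.mem_filter, Finset.mem_univ, true_and,
    not_lt_zero, or_self, not_false_eq_true, true_implies, Finset.mem_singleton]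
  exact funext_iff.symm

theorem paths_last [NeZero q] : paths N B n = Finset.univ := by
  ext l
  simp [paths, touched_last]

/-- After the last step every edge is touched, so the paths are all labelings, and reordering the
vertices by `B` gives the defining sum of the value. -/
theorem sum_amplitude [NeZero q] :
    ∑ l ∈ paths N B n, amplitude N B n l =
      (Real.sqrt 2 : ℂ)⁻¹ * (N.value / (∏ j ∈ Finset.range n, vertexNorm N B j : ℝ)) := by
  rw [paths_last, TensorNetwork.value, Finset.sum_div, Finset.mul_sum]
  refine Finset.sum_congr rfl fun l _ => ?_
  rw [amplitude, Finset.prod_div_distrib, Complex.ofReal_prod]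
  congr 2
  rw [Finset.prod_range, ← B.prod_comp fun v => N.tensor v fun e => l e]
  refine Finset.prod_congr rfl fun j _ => ?_
  rw [vertexEntry, dif_pos j.2]

theorem vertexNorm_pos (h : 0 < N.scale B) (i : ℕ) : 0 < vertexNorm N B i := by
  unfold vertexNorm
  split_ifs with hi
  · refine norm_vertexMatrix_pos N B _ (lt_of_le_of_ne (norm_nonneg _) fun h0 => h.ne' ?_)
    exact Finset.prod_eq_zero (Finset.mem_univ _) h0.symm
  · exact one_pos

theorem prod_vertexNorm_le [NeZero q] :
    ∏ j ∈ Finset.range n, vertexNorm N B j ≤ N.scale B := by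
  rw [Finset.prod_range, TensorNetwork.scale]
  refine Finset.prod_le_prod (fun j _ => ?_) fun j _ => ?_
  · rw [vertexNorm, dif_pos j.2]
    exact norm_nonneg _
  · rw [vertexNorm, dif_pos j.2]
    exact norm_vertexMatrix_le N B j

end QRAM

end

/-! ### One coherent run through the bubbling. -/

noncomputable section

namespace QRAM

open State

/-! ### Preservation of the norm -/

/-- The program neither measures nor discards qubits. -/
def Coherent : Prog → Prop
  | .skip => True
  | .setNat _ _ _ => True
  | .setNum _ _ _ => True
  | .root _ _ _ _ _ => True
  | .fresh => False
  | .gate _ _ _ _ => True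
  | .measure _ _ _ => False
  | .seq P Q => Coherent P ∧ Coherent Q
  | .cond _ P Q => Coherent P ∧ Coherent Q
  | .loop _ P => Coherent P

/-- The final test needs a register of norm one. This provides it from unitarity of the gates,
without computing the norm of the dead part. -/
theorem Exec.weight_eq {P : Prog} {s : State} {μ : PMF State} {τ : ℕ} (h : Exec P s μ τ)
    (hP : Coherent P) : ∀ s' ∈ μ.support, s'.qubits.weight = s.qubits.weight := by
  induction h with
  | skip s => simp
  | setNat a i v s => simp
  | setNum a i v s => simp
  | root a i k b j s => simp
  | fresh s => exact hP.elim
  | gate a i cs t s => simp [QState.weight_gate]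
  | measure t a i s => exact hP.elim
  | seq P Q s μ ν τ₁ τ₂ _ _ ih₁ ih₂ =>
    intro s' hs'
    obtain ⟨s₁, h₁, h₂⟩ := (PMF.mem_support_bind_iff _ _ _).1 hs'
    rw [ih₂ s₁ h₁ hP.2 s' h₂, ih₁ hP.1 s₁ h₁]
  | cond_true c P Q s μ τ _ _ ih => exact ih hP.1
  | cond_false c P Q s μ τ _ _ ih => exact ih hP.2
  | loop_true c P s μ ν τ₁ τ₂ _ _ _ ih₁ ih₂ =>
    intro s' hs'
    obtain ⟨s₁, h₁, h₂⟩ := (PMF.mem_support_bind_iff _ _ _).1 hs'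
    rw [ih₂ s₁ h₁ hP s' h₂, ih₁ hP s₁ h₁]
  | loop_false c P s _ => simp
  | weaken P s μ τ τ' _ _ ih => exact ih hP

theorem Runs.weight {P : Prog} {s : State} {τ : ℕ} {Q : State → Prop} (h : Runs P s τ Q)
    (hP : Coherent P) : Runs P s τ fun s' => Q s' ∧ s'.qubits.weight = s.qubits.weight := by
  obtain ⟨s', h, hQ⟩ := h
  exact ⟨s', h, hQ, h.weight_eq hP s' (by simp)⟩

theorem coherent_vertexProg : Coherent vertexProg := by
  simp [vertexProg, powersProg, splitProg, offsetProg, rowProg, mergeProg, mergeEdgeProg, normProg,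
    traceProg, gramProg, coeffProg, sumProg, elimProg, loadProg, pivotProg, rotProg, rotGateProg,
    mergeGateProg, splitGateProg, expandProg, splitEdgeProg, forTo, block, Coherent]

/-! ### A run through all vertices -/

variable {n m q : ℕ} (N : TensorNetwork (Fin n) (Fin m) q) (B : Fin n ≃ Fin n) (ε : ℝ)

/-- The memory holds the input and the gates, and no edge is marked. -/
structure Ready (s : State) : Prop where
  nat_zero : ∀ i, s.nat 0 i = (input N B ε).nat 0 i
  nat_one : ∀ i, s.nat 1 i = (input N B ε).nat 1 i
  nat_two : ∀ i, s.nat 2 i = (input N B ε).nat 2 i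
  num_zero : ∀ i, s.num 0 i = (input N B ε).num 0 i
  num_one : ∀ i, s.num 1 i = (input N B ε).num 1 i
  gateX : HasGateX s
  hadamard : s.matrixAt 3 4 = QState.testGate 1
  phase : s.matrixAt 3 8 = QState.testGate (-Complex.I)
  mark : ∀ e, s.nat 8 e = 0

theorem Ready.same {s s' : State} (h : Ready N B ε s) {W V : List ℕ} (hf : SameOutside W V s s')
    (hW : ∀ a ∈ W, a ≠ 0 ∧ a ≠ 1 ∧ a ≠ 2) (hV : ∀ a ∈ V, a ≠ 0 ∧ a ≠ 1 ∧ a ≠ 3)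
    (hm : ∀ e, s'.nat 8 e = 0) : Ready N B ε s' where
  nat_zero i := by rw [hf.1 0 fun h => (hW _ h).1 rfl, h.nat_zero]
  nat_one i := by rw [hf.1 1 fun h => (hW _ h).2.1 rfl, h.nat_one]
  nat_two i := by rw [hf.1 2 fun h => (hW _ h).2.2 rfl, h.nat_two]
  num_zero i := by rw [hf.2 0 fun h => (hV _ h).1 rfl, h.num_zero]
  num_one i := by rw [hf.2 1 fun h => (hV _ h).2.1 rfl, h.num_one]
  gateX := h.gateX.same hf fun h => (hV _ h).2.2 rfl
  hadamard := by
    rw [← h.hadamard]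
    simp only [State.matrixAt, hf.2 3 fun h => (hV _ h).2.2 rfl]
  phase := by
    rw [← h.phase]
    simp only [State.matrixAt, hf.2 3 fun h => (hV _ h).2.2 rfl]
  mark := hm

/-- Prepares the register and swallows all vertices. -/
def prepareProg : Prog := block [
  .setNat 6 (.lit 0) (.lit 0),
  .setNat 7 (.lit 0) (.lit 1),
  .setNat 3 (.lit 0) (.lit 0),
  .setNat 4 (.lit 0) (.lit 0),
  .setNat 5 (.lit 0) (.lit 0),
  .setNum 9 (.lit 0) (.ofNat (.lit 1)),
  .gate 3 (.lit 4) [] (.lit 0),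
  .loop (.natLT (var 3) (.get 0 (.lit 1))) vertexProg]

theorem coherent_prepareProg : Coherent prepareProg := by
  simp [prepareProg, block, Coherent, coherent_vertexProg]

/-- The product of the norms of the matrices of the vertices. -/
def totalNorm : ℝ := ∏ j ∈ Finset.range n, vertexNorm N B j

variable {N B ε}

/-- The degree itself is bounded by `d < q ^ d`, which fails for `q = 1`; this is why dimensions
below two are treated by a different program. -/
theorem degree_bounds (hq : 2 ≤ q) (v : Fin n) :
    N.degree v ≤ q ^ N.maxDegree ∧ (0 < N.degree v → q ≤ q ^ N.maxDegree) ∧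
      q ^ N.degree v ≤ q ^ N.maxDegree := by
  have h1 : N.degree v ≤ N.maxDegree := Finset.le_sup (Finset.mem_univ v)
  have h2 : q ^ N.degree v ≤ q ^ N.maxDegree := Nat.pow_le_pow_right (by omega) h1
  refine ⟨(Nat.lt_pow_self hq).le.trans h2, fun h => ?_, h2⟩
  exact (Nat.le_self_pow h.ne' q).trans h2

/-- The loop invariant says that after `k` steps the register encodes the paths with their
amplitudes, and the reference is the dead vector `∅`. The final cut is empty, so all marks are
cleared and the next run starts from a memory that needs no reset. -/
theorem runs_prepareProg {s : State} (hq : 2 ≤ q) (hs : 0 < N.scale B) (h : Ready N B ε s)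
    (hz : s.qubits = QState.zero) :
    Runs prepareProg s (n * (vertexTime (q ^ N.maxDegree) + 1) + 9) fun s' =>
      SameOutside [3, 4, 5, 6, 7, 8, 9, 10, 11, 14, 19, 20, 21, 22, 23, 24, 25, 26, 27, 28, 40, 41,
        42, 43, 44, 45] [4, 5, 6, 7, 8, 9, 10, 11, 12, 13] s s' ∧
      (∀ e, s'.nat 8 e = 0) ∧ s'.num 9 0 = totalNorm N B ∧
      ∃ φ : QState, (∀ S ∈ φ.support, s'.nat 6 0 ∉ S) ∧ φ ∅ = (Real.sqrt 2 : ℂ)⁻¹ ∧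
        s'.qubits = φ + Finsupp.single {s'.nat 6 0}
          ((Real.sqrt 2 : ℂ)⁻¹ * (N.value / totalNorm N B)) := by
  have : NeZero q := ⟨by omega⟩
  have hq0 : 0 < q := by omega
  unfold prepareProg
  refine Runs.le (Runs.block_cons (Runs.setNat (Runs.block_cons (Runs.setNat (Runs.block_cons
    (Runs.setNat (Runs.block_cons (Runs.setNat (Runs.block_cons (Runs.setNat (Runs.block_cons
    (τ' := n * (vertexTime (q ^ N.maxDegree) + 1) + 3) (Runs.setNum ?_)))))))))))) (by omega)
  generalize hs₀ : State.setNum _ 9 _ _ = s₀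
  have hf₀ : SameOutside [3, 4, 5, 6, 7] [9] s s₀ := by
    rw [← hs₀]
    refine SameOutside.setNum ?_ (by simp)
    iterate 5 refine SameOutside.setNat ?_ (by simp)
    exact SameOutside.refl _ _ _
  have h3₀ : s₀.nat 3 0 = 0 := by simp [← hs₀, NatExp.eval]
  have h4₀ : s₀.nat 4 0 = 0 := by simp [← hs₀, NatExp.eval]
  have h5₀ : s₀.nat 5 0 = 0 := by simp [← hs₀, NatExp.eval]
  have h6₀ : s₀.nat 6 0 = 0 := by simp [← hs₀, NatExp.eval]
  have h7₀ : s₀.nat 7 0 = 1 := by simp [← hs₀, NatExp.eval]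
  have h9₀ : s₀.num 9 0 = 1 := by simp [← hs₀, NatExp.eval, NumExp.eval]
  have hz₀ : s₀.qubits = QState.zero := by
    rw [← hz, ← hs₀]
    rfl
  have hm₀ : s₀.matrixAt 3 4 = QState.testGate 1 := by
    rw [← h.hadamard]
    simp only [State.matrixAt, hf₀.2 3 (by simp)]
  refine Runs.le (Runs.block_cons (τ' := n * (vertexTime (q ^ N.maxDegree) + 1) + 1 + 1)
    (Runs.gate (Runs.block_cons (τ' := 1)
    ((Runs.loop (τ := vertexTime (q ^ N.maxDegree)) (N := n) (fun k s' =>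
      SameOutside [3, 4, 5, 6, 7, 8, 9, 10, 11, 14, 19, 20, 21, 22, 23, 24, 25, 26, 27, 28, 40, 41,
        42, 43, 44, 45] [4, 5, 6, 7, 8, 9, 10, 11, 12, 13] s s' ∧
      s'.nat 3 0 = k ∧ s'.nat 4 0 = edgePos N B k ∧ s'.nat 5 0 = entryPos N B k ∧
      s'.num 9 0 = (∏ j ∈ Finset.range k, vertexNorm N B j : ℝ) ∧
      (∀ e, 0 < s'.nat 8 e ↔ e ∈ cutNat N B k) ∧
      Encodes q (s'.nat 6 0) 1 (s'.nat 7 0) (s'.nat 9) (cutNat N B k) (paths N B k)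
        (amplitude N B k) (fun _ => 0) label (Real.sqrt 2 : ℂ)⁻¹ s'.qubits)
      ?_ ?_ _ ?_).post ?_)))) (by omega)
  · rintro k hk s₁ ⟨hf, h3, h4, h5, h9, hmk, hE⟩
    set i : Fin n := ⟨k, hk⟩ with hi
    obtain ⟨hD1, hD2, hD3⟩ := degree_bounds (N := N) hq (B i)
    refine ⟨?_, ?_⟩
    · have : s₁.nat 0 1 = n := by
        rw [hf.1 0 (by simp), h.nat_zero]
        rfl
      simp [Test.Holds, NatExp.eval, h3, this, hk]
    · refine (runs_vertexProg (q := q) (d := N.degree (B i)) (D := q ^ N.maxDegree)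
        (ed := edgeAt N (B i)) (f := fun p => (entryList N (B i)).getD p 0)
        (I' := paths N B (k + 1)) (c' := amplitude N B (k + 1)) (x' := label)
        (ρ := cutOff N B k) (ν := vertexNorm N B k) (h.gateX.same hf (by simp))
        ?_ hq0 ?_ hD1 hD2 hD3 ?_ ?_ ?_ hmk hE (vertexNorm_pos N B hs k) ?_ ?_ ?_ ?_ ?_).post ?_
      · rw [hf.1 0 (by simp), h.nat_zero]
        rfl
      · rw [hf.1 1 (by simp), h3, h.nat_one]
        exact input_degree N B ε i
      · intro j hj
        rw [hf.1 2 (by simp), h4, h.nat_two]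
        exact input_edge N B ε i hj
      · exact fun j hj j' hj' => edgeAt_inj N (B i) hj hj'
      · intro p hp
        rw [hf.2 1 (by simp), h5, h.num_one]
        exact input_entry N B ε i hp
      · intro kin inE inP kout outE outP hsp
        rw [vertexNorm, dif_pos hk]
        exact norm_toMat_eq N B hsp hmk
      · intro kin inE inP kout outE outP hsp g
        exact sum_paths_succ N B hsp hmk g
      · exact fun l _ e => label_lt hq0 l e
      · intro l _ e he
        obtain ⟨hem, he⟩ := (mem_cutNat N B).1 he
        rw [label, label, dif_pos hem, dif_pos hem, cutOff, if_pos (touched_of_mem_cut N B he)]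
      · intro l _
        exact amplitude_succ N B i l
      · rintro s₂ ⟨hf₂, h3₂, h4₂, h5₂, h9₂, hmk₂, hE₂⟩
        refine ⟨hf.trans hf₂, by rw [h3₂, h3], ?_, ?_, ?_, ?_, ?_⟩
        · rw [h4₂, h4]
          exact (edgePos_succ N B i).symm
        · rw [h5₂, h5]
          exact (entryPos_succ N B i).symm
        · rw [h9₂, h9, Finset.prod_range_succ, Complex.ofReal_mul]
        · rw [show k + 1 = (i : ℕ) + 1 from rfl, cutNat_succ]
          exact hmk₂
        · rw [show cutNat N B (k + 1) = _ from cutNat_succ N B i]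
          exact hE₂
  · rintro s₁ ⟨hf, h3, -⟩
    have : s₁.nat 0 1 = n := by
      rw [hf.1 0 (by simp), h.nat_zero]
      rfl
    simp [Test.Holds, NatExp.eval, h3, this]
  · refine ⟨hf₀.mono (by simp) (by simp), h3₀, by simp [h4₀, edgePos], by simp [h5₀, entryPos],
      by simp [h9₀], fun e => by simp [hf₀.1, h.mark, cutNat_zero], ?_⟩
    simp only [NatExp.eval, h6₀, h7₀, hz₀, hm₀, List.map_nil, List.toFinset_nil, cutNat_zero,
      paths_zero]
    -- Initially qubit 0 is a token with a single possible value and there is one path. The half of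
    -- the register in which the token is absent is the reference.
    refine ⟨⟨le_rfl, by simp, by simp, by simp⟩, by simp, fun l _ e => label_lt hq0 l e,
      Finsupp.single ∅ (Real.sqrt 2 : ℂ)⁻¹, Dead.single (by simp), by simp, ?_⟩
    rw [QState.gate_of_mem (QState.testGate_mem (by simp)) (by simp), QState.zero,
      QState.apply_single_of_notMem (by simp) (by simp)]
    simp [QState.testGate, amplitude, tokens]
  · rintro s₁ ⟨hf, h3, h4, h5, h9, hmk, hE⟩
    rw [cutNat_last] at hmk hE
    obtain ⟨-, -, -, φ, hφ, hφ0, hqu⟩ := hE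
    refine Runs.block_nil ⟨hf, fun e => ?_, h9, φ, ?_, hφ0, ?_⟩
    · have := hmk e
      simp only [Finset.notMem_empty, iff_false] at this
      omega
    · intro S hS hmem
      exact hφ S hS _ hmem (Or.inl ⟨le_rfl, by omega⟩)
    · rw [hqu, totalNorm, ← sum_amplitude N B, Finsupp.single_finsetSum]
      simp [tokens]

end QRAM

end

/-! ### Bias and variance of one sample. -/

noncomputable section

namespace QRAM

open State
open scoped ComplexConjugate

/-! ### Sampling -/

variable {n m q : ℕ} {N : TensorNetwork (Fin n) (Fin m) q} {B : Fin n ≃ Fin n} {ε : ℝ}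

/-- Both interfering amplitudes carry the factor `1/√2`. In `‖1 - η t‖² = 1 + ‖t‖² - 2 Re (η t)` the
squares cancel against the weights subtracted in `probOne_testGate`. -/
theorem probOne_testGate_of_amplitudes {η t : ℂ} (hη : ‖η‖ = 1) {r : ℕ} {φ : QState}
    (hφ : ∀ S ∈ φ.support, r ∉ S) (hφ0 : φ ∅ = (Real.sqrt 2 : ℂ)⁻¹)
    (hw : (φ + Finsupp.single {r} ((Real.sqrt 2 : ℂ)⁻¹ * t)).weight = 1) :
    ((QState.probOne r (QState.gate (QState.testGate η) ∅ r
      (φ + Finsupp.single {r} ((Real.sqrt 2 : ℂ)⁻¹ * t)))) : ℝ) = (1 - (η * t).re) / 2 := by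
  rw [QState.probOne_testGate hη hφ hw, hφ0]
  have h1 : ‖(Real.sqrt 2 : ℂ)⁻¹‖ ^ 2 = 1 / 2 := by
    rw [norm_inv, Complex.norm_real, Real.norm_of_nonneg (by positivity), inv_pow,
      Real.sq_sqrt (by norm_num)]
    norm_num
  have h2 : (Real.sqrt 2 : ℂ)⁻¹ - η * ((Real.sqrt 2 : ℂ)⁻¹ * t) =
      (Real.sqrt 2 : ℂ)⁻¹ * (1 - η * t) := by ring
  have h3 : ‖1 - η * t‖ ^ 2 = 1 + ‖t‖ ^ 2 - 2 * (η * t).re := by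
    rw [← Complex.normSq_eq_norm_sq, Complex.normSq_sub, Complex.normSq_eq_norm_sq,
      Complex.normSq_eq_norm_sq, norm_mul, hη]
    simp
  rw [h2, norm_mul, norm_mul, mul_pow, mul_pow, h1, h3]
  ring

/-- One run, followed by the comparison of the amplitudes with the gate at the position `g` of the
array `3`. The outcome, with the factor `z`, is added to the variable `14`. -/
def sampleProg (g : ℕ) (z : NumExp) : Prog :=
  .seq .fresh (.seq prepareProg (.seq (.gate 3 (.lit g) [] (var 6))
    (.seq (.measure (var 6) 31 (.lit 0))
      (.setNum 14 (.lit 0) (.add (.get 14 (.lit 0))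
        (.mul z (.sub (.ofNat (.lit 1)) (.ofNat (.add (var 31) (var 31))))))))))

open Classical in
/-- The squared distance of the variable `14` to `a`, plus `C`. -/
def potential (N : TensorNetwork (Fin n) (Fin m) q) (B : Fin n ≃ Fin n) (ε : ℝ) (p : Prop) (k : ℕ)
    (a : ℂ) (C : ℝ) (s : State) : ℝ≥0∞ :=
  if Ready N B ε s ∧ s.nat 30 0 = k ∧ (p → s.num 9 0 = totalNorm N B) then
    ENNReal.ofReal (‖s.num 14 0 - a‖ ^ 2 + C) else ∞

variable {p : Prop} {k : ℕ} {a : ℂ} {C : ℝ} {s : State}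

theorem potential_of_mem (h : Ready N B ε s) (hk : s.nat 30 0 = k)
    (hp : p → s.num 9 0 = totalNorm N B) :
    potential N B ε p k a C s = ENNReal.ofReal (‖s.num 14 0 - a‖ ^ 2 + C) :=
  if_pos ⟨h, hk, hp⟩

theorem mem_of_potential (h : potential N B ε p k a C s ≠ ∞) :
    Ready N B ε s ∧ s.nat 30 0 = k ∧ (p → s.num 9 0 = totalNorm N B) := by
  unfold potential at h
  split_ifs at h with hs
  · exact hs
  · exact absurd rfl h

theorem norm_sub_mul_real_sq {w z : ℂ} (hz : ‖z‖ = 1) (r : ℝ) :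
    ‖w - z * r‖ ^ 2 = ‖w‖ ^ 2 - 2 * r * (w * conj z).re + r ^ 2 := by
  rw [← Complex.normSq_eq_norm_sq, Complex.normSq_sub, Complex.normSq_eq_norm_sq,
    Complex.normSq_eq_norm_sq, norm_mul, hz, Complex.norm_real, one_mul, Real.norm_eq_abs, sq_abs,
    map_mul, Complex.conj_ofReal, ← mul_assoc, Complex.re_mul_ofReal]
  ring

/-- A sign with mean `x`, times the unit number `z`, is added to the sum while the target moves by
`z * x`. The cross terms cancel, and the variance is `1 - x ^ 2 ≤ 1`. -/
theorem variance_bound {w z : ℂ} (hz : ‖z‖ = 1) (x C : ℝ) :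
    (1 - x) / 2 * (‖w - z * ((1 + x : ℝ) : ℂ)‖ ^ 2 + C) +
      (1 - (1 - x) / 2) * (‖w - z * ((x - 1 : ℝ) : ℂ)‖ ^ 2 + C) ≤ ‖w‖ ^ 2 + (C + 1) := by
  rw [norm_sub_mul_real_sq hz, norm_sub_mul_real_sq hz]
  nlinarith [sq_nonneg x]

/-- The constant in the potential is a budget for the variance still to come; a sample spends 1 of
it. The proposition `p` allows for the start, when the product of norms has not been computed yet.
-/
theorem runsExpect_sampleProg {g : ℕ} {z : NumExp} {η : ℂ} (hq : 2 ≤ q) (hs : 0 < N.scale B)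
    (hη : ‖η‖ = 1) (hg : ∀ s, Ready N B ε s → s.matrixAt 3 g = QState.testGate η)
    (hz : ∀ s, z.eval s = conj η) (hC : 0 ≤ C) (h : potential N B ε p k a (C + 1) s ≠ ∞) :
    RunsExpect (sampleProg g z) s (n * (vertexTime (q ^ N.maxDegree) + 1) + 13)
      (potential N B ε True k
        (a + conj η * ((η * (N.value / totalNorm N B)).re : ℂ)) C)
      (potential N B ε p k a (C + 1) s) := by
  obtain ⟨hR, hk, hp9⟩ := mem_of_potential h
  set t := N.value / totalNorm N B with ht
  set x := (η * t).re with hx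
  have hR' : Ready N B ε { s with qubits := QState.zero } :=
    hR.same N B ε (W := []) (V := []) ⟨fun _ _ _ => rfl, fun _ _ _ => rfl⟩ (by simp) (by simp)
      hR.mark
  refine RunsExpect.mono (RunsExpect.seq_runs (Runs.fresh (Q := fun s' => s' = _) rfl) ?_)
    (τ := 1 + (n * (vertexTime (q ^ N.maxDegree) + 1) + 9 + (1 + (1 + 1)))) (by omega) le_rfl
  rintro s₀ rfl
  refine RunsExpect.seq_runs ((runs_prepareProg hq hs hR' rfl).weight coherent_prepareProg) ?_
  rintro s₁ ⟨⟨hf, hmk, h9, φ, hφ, hφ0, hqu⟩, hw⟩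
  change SameOutside _ _ s s₁ at hf
  have hR₁ : Ready N B ε s₁ := hR.same N B ε hf (by simp) (by simp) hmk
  rw [QState.weight_zero_state, hqu] at hw
  have hm : s₁.matrixAt 3 g = QState.testGate η := hg s₁ hR₁
  have hpr := probOne_testGate_of_amplitudes hη hφ hφ0 hw
  refine RunsExpect.seq_runs (Runs.gate (Q := fun s' => SameOutside [] [] s₁ s' ∧
    s'.qubits = QState.gate (QState.testGate η) ∅ (s₁.nat 6 0) s₁.qubits)
    ⟨⟨fun _ _ _ => rfl, fun _ _ _ => rfl⟩, by simp [NatExp.eval, hm]⟩) ?_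
  rintro s₂ ⟨hf₂, hq₂⟩
  rw [hqu] at hq₂
  -- The outcome `b` adds `conj η * (1 - 2 b)` to the sum, and the target moves by `conj η * x`.
  have hval : ∀ b : Bool, potential N B ε True k (a + conj η * (x : ℂ)) C
      ((s₂.collapse (s₂.nat 6 0) 31 0 b).setNum 14 0
        ((s₂.collapse (s₂.nat 6 0) 31 0 b).num 14 0 + conj η *
          (1 - (((s₂.collapse (s₂.nat 6 0) 31 0 b).nat 31 0 +
            (s₂.collapse (s₂.nat 6 0) 31 0 b).nat 31 0 : ℕ) : ℂ)))) =
      ENNReal.ofReal (‖s.num 14 0 - a - conj η *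
        ((x - 1 + (b.toNat + b.toNat : ℕ) : ℝ) : ℂ)‖ ^ 2 + C) := by
    intro b
    generalize hS : s₂.collapse (s₂.nat 6 0) 31 0 b = S
    have h31 : S.nat 31 0 = b.toNat := by simp [← hS, State.collapse]
    have h14 : S.num 14 0 = s.num 14 0 := by
      rw [← hf.2 14 (by simp), ← hf₂.2 14 (by simp), ← hS]
      rfl
    have hfS : SameOutside [31] [14] s₁ (S.setNum 14 0
        (S.num 14 0 + conj η * (1 - ((S.nat 31 0 + S.nat 31 0 : ℕ) : ℂ)))) := by
      refine SameOutside.setNum ?_ (by simp)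
      rw [← hS]
      exact SameOutside.setNat (s' := { s₂ with qubits := _ })
        (hf₂.mono (by simp) (by simp)) (by simp)
    rw [potential_of_mem
      (hR₁.same N B ε hfS (by simp) (by simp) fun e => by rw [hfS.1 8 (by simp), hmk])
      (by rw [hfS.1 30 (by simp), hf.1 30 (by simp), hk])
      (fun _ => by rw [hfS.2 9 (by simp), h9])]
    congr 4
    simp only [num_setNum, and_self, if_true, h14, h31]
    push_cast
    ring
  refine RunsExpect.seq (g := fun s' => potential N B ε True k (a + conj η * (x : ℂ)) C
    (s'.setNum 14 0 (s'.num 14 0 + conj η * (1 - ((s'.nat 31 0 + s'.nat 31 0 : ℕ) : ℂ)))))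
    (RunsExpect.measure ?_) h ?_
  · simp only [NatExp.eval]
    rw [hval true, hval false, potential_of_mem hR hk hp9, hq₂, hf₂.1 6 (by simp)]
    have hle := QState.probOne_le_one (s₁.nat 6 0) (QState.gate (QState.testGate η) ∅ (s₁.nat 6 0)
      (φ + Finsupp.single {s₁.nat 6 0} ((Real.sqrt 2 : ℂ)⁻¹ * t)))
    generalize QState.probOne _ _ = pr at hpr hle ⊢
    rw [← ENNReal.ofReal_coe_nnreal, ← ENNReal.ofReal_coe_nnreal, NNReal.coe_sub hle,
      NNReal.coe_one, ← ENNReal.ofReal_mul pr.coe_nonneg,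
      ← ENNReal.ofReal_mul (sub_nonneg.2 (by exact_mod_cast hle)),
      ← ENNReal.ofReal_add (mul_nonneg pr.coe_nonneg (by positivity))
        (mul_nonneg (sub_nonneg.2 (by exact_mod_cast hle)) (by positivity)), hpr]
    refine ENNReal.ofReal_le_ofReal ?_
    have h1 : x - 1 + ((true.toNat + true.toNat : ℕ) : ℝ) = 1 + x := by
      norm_num
      ring
    have h0 : x - 1 + ((false.toNat + false.toNat : ℕ) : ℝ) = x - 1 := by norm_num
    rw [h1, h0]
    exact variance_bound (by simpa using hη) x C
  · intro s' _
    refine RunsExpect.of_runs (Runs.setNum (Q := fun s'' => s'' = _) rfl) ?_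
    rintro s'' rfl
    simp [NumExp.eval, NatExp.eval, hz]

end QRAM

end

/-! ### Averaging samples and bounding the failure probability. -/

noncomputable section

namespace QRAM

open State
open scoped ComplexConjugate

/-! ### Estimation of the value -/

/-- Markov's inequality with the threshold `4 * c`. -/
theorem RunsExpect.outer_le {P : Prog} {s : State} {τ : ℕ} {S : Set ℂ} {c : ℝ≥0∞} (hc : c ≠ 0)
    (hc' : c ≠ ∞) (h : RunsExpect P s τ ((State.output ⁻¹' S).indicator fun _ => 4 * c) c) :
    ∃ μ, Exec P s μ τ ∧ (μ.map State.output).toOuterMeasure S ≤ 1 / 4 := by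
  obtain ⟨μ, h1, h2⟩ := h
  refine ⟨μ, h1, ?_⟩
  rw [PMF.toOuterMeasure_map_apply, PMF.toOuterMeasure_apply]
  have h3 : expect μ ((State.output ⁻¹' S).indicator fun _ => 4 * c) =
      4 * c * ∑' a, (State.output ⁻¹' S).indicator μ a := by
    rw [expect, ← ENNReal.tsum_mul_left]
    refine tsum_congr fun a => ?_
    by_cases ha : a ∈ State.output ⁻¹' S
    · rw [Set.indicator_of_mem ha, Set.indicator_of_mem ha, mul_comm]
    · rw [Set.indicator_of_notMem ha, Set.indicator_of_notMem ha, mul_zero, mul_zero]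
  rw [h3, mul_comm 4, mul_assoc] at h2
  rw [ENNReal.le_div_iff_mul_le (by simp) (by simp), mul_comm]
  rw [← ENNReal.mul_le_mul_iff_right hc hc', mul_one]
  exact h2

variable {n m q : ℕ} {N : TensorNetwork (Fin n) (Fin m) q} {B : Fin n ≃ Fin n} {ε : ℝ}

/-- Writes the gates to the array `3`. -/
def setupProg : Prog := block [
  .setNum 3 (.lit 1) (.ofNat (.lit 1)),
  .setNum 3 (.lit 2) (.ofNat (.lit 1)),
  .setNum 3 (.lit 4) (.div (.ofNat (.lit 1)) (.sqrtRe (.ofNat (.lit 2)))),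
  .setNum 3 (.lit 5) (.get 3 (.lit 4)),
  .setNum 3 (.lit 6) (.get 3 (.lit 4)),
  .setNum 3 (.lit 7) (.sub (.ofNat (.lit 0)) (.get 3 (.lit 4))),
  .setNum 3 (.lit 8) (.get 3 (.lit 4)),
  .setNum 3 (.lit 9) (.mul .imUnit (.get 3 (.lit 7))),
  .setNum 3 (.lit 10) (.get 3 (.lit 4)),
  .setNum 3 (.lit 11) (.mul .imUnit (.get 3 (.lit 4)))]

theorem runs_setupProg : Runs setupProg (input N B ε) 11 fun s =>
    Ready N B ε s ∧ s.nat 30 0 = 0 ∧ s.num 14 0 = 0 := by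
  have h3 : ∀ i, (input N B ε).num 3 i = 0 := fun _ => rfl
  unfold setupProg
  refine Runs.le (τ := 1 + (1 + (1 + (1 + (1 + (1 + (1 + (1 + (1 + (1 + 1)))))))))) ?_ (by omega)
  iterate 10 refine Runs.block_cons (Runs.setNum ?_)
  refine Runs.block_nil ⟨?_, rfl, by simp [NatExp.eval, input]⟩
  refine ⟨fun _ => rfl, fun _ => rfl, fun _ => rfl, fun i => by simp [NatExp.eval],
    fun i => by simp [NatExp.eval], ?_, ?_, ?_, fun _ => rfl⟩
  · simp [HasGateX, NatExp.eval, NumExp.eval, h3]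
  · simp [State.matrixAt, NatExp.eval, NumExp.eval, QState.testGate, neg_div]
  · simp [State.matrixAt, NatExp.eval, NumExp.eval, QState.testGate, div_eq_mul_inv]

/-- One sample of the real part and one of the imaginary part. -/
def roundProg : Prog :=
  .seq (sampleProg 4 (.ofNat (.lit 1))) (.seq (sampleProg 8 .imUnit)
    (.setNat 30 (.lit 0) (.add (var 30) (.lit 1))))

/-- The two samples move the target by `Re t` and, for `η = -i`, by `i * Re (-i t) = i * Im t`;
together this is `t`, at the cost of variance 2. -/
theorem runsExpect_roundProg {p : Prop} {k : ℕ} {a : ℂ} {C : ℝ} {s : State} (hq : 2 ≤ q)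
    (hs : 0 < N.scale B) (hC : 0 ≤ C) (h : potential N B ε p k a (C + 2) s ≠ ∞) :
    RunsExpect roundProg s (2 * (n * (vertexTime (q ^ N.maxDegree) + 1)) + 27)
      (potential N B ε True (k + 1) (a + N.value / totalNorm N B) C)
      (potential N B ε p k a (C + 2) s) := by
  rw [show C + 2 = C + 1 + 1 by ring] at h ⊢
  refine RunsExpect.mono (RunsExpect.seq (runsExpect_sampleProg (η := 1) hq hs (by simp)
    (fun s h => h.hadamard) (fun s => by simp [NumExp.eval, NatExp.eval])
    (by linarith) h) h fun s' hs' => RunsExpect.seq (runsExpect_sampleProg (η := -Complex.I) hq hs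
    (by simp) (fun s h => h.phase) (fun s => by simp [NumExp.eval]) hC hs') hs' (τ' := 1) ?_)
    (by omega) le_rfl
  intro s'' hs''
  obtain ⟨hR, hk, h9⟩ := mem_of_potential hs''
  refine RunsExpect.of_runs (Runs.setNat (Q := fun t => t = _) rfl) ?_
  rintro _ rfl
  have hf : SameOutside [30] [] s'' (s''.setNat 30 (NatExp.eval s'' (.lit 0))
      (NatExp.eval s'' (.add (var 30) (.lit 1)))) := SameOutside.setNat (.refl _ _ _) (by simp)
  rw [potential_of_mem hR hk h9, potential_of_mem (hR.same N B ε hf (by simp) (by simp)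
    fun e => by rw [hf.1 8 (by simp), hR.mark]) (by simp [NatExp.eval, hk]) h9]
  refine le_of_eq ?_
  congr 4
  rw [num_setNat, add_assoc]
  congr 2
  rw [← Complex.re_add_im (N.value / totalNorm N B)]
  generalize N.value / (totalNorm N B : ℂ) = t
  simp [mul_comm]

/-- Estimates the value by the mean of `k` samples, where `k` is the least number with
`8 ≤ k * ε ^ 2`. -/
def estimateProg : Prog :=
  .seq setupProg (.seq
    (.loop (.reLT (.mul (.mul (.ofNat (var 30)) (.get 0 (.lit 0))) (.get 0 (.lit 0)))
      (.ofNat (.lit 8))) roundProg)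
    (.setNum 2 (.lit 0) (.div (.mul (.get 9 (.lit 0)) (.get 14 (.lit 0))) (.ofNat (var 30)))))

/-- The error of the output is `totalNorm / k` times the error of the sum, and `totalNorm ≤ scale`.
Thus an output error of `ε * scale` forces a deviation of at least `k * ε` in the sum. -/
theorem le_norm_sub_of_scale_le {k : ℕ} (hk : 0 < k) (hε : 0 < ε) (hq : 2 ≤ q)
    (hs : 0 < N.scale B) {z : ℂ}
    (h : ε * N.scale B ≤ ‖N.value - totalNorm N B * z / k‖) :
    k * ε ≤ ‖z - k * (N.value / totalNorm N B)‖ := by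
  have : NeZero q := ⟨by omega⟩
  have hT : 0 < totalNorm N B := Finset.prod_pos fun i _ => vertexNorm_pos N B hs i
  have hle : totalNorm N B ≤ N.scale B := prod_vertexNorm_le N B
  have hk' : (0 : ℝ) < k := by exact_mod_cast hk
  have hkc : (k : ℂ) ≠ 0 := by exact_mod_cast hk.ne'
  have hTc : (totalNorm N B : ℂ) ≠ 0 := by exact_mod_cast hT.ne'
  have h1 : N.value - totalNorm N B * z / k =
      -(totalNorm N B / k * (z - k * (N.value / totalNorm N B))) := by
    field_simp
    ring
  rw [h1, norm_neg, norm_mul, norm_div, Complex.norm_real, Complex.norm_natCast,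
    Real.norm_of_nonneg hT.le, div_mul_eq_mul_div, le_div_iff₀ hk'] at h
  refine le_of_mul_le_mul_left ?_ hT
  calc totalNorm N B * (k * ε) = ε * totalNorm N B * k := by ring
    _ ≤ ε * N.scale B * k := by gcongr
    _ ≤ _ := h

/-- The machine cannot round, but the test `k * ε ^ 2 < 8` stops the loop after exactly `⌈8/ε²⌉`
rounds. The potential starts at `2 * K`, the total variance budget, and ends as the squared
deviation of the sum. -/
theorem exec_estimateProg (hq : 2 ≤ q) (hs : 0 < N.scale B) (hε : 0 < ε) :
    ∃ μ, Exec estimateProg (input N B ε) μ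
        (⌈8 / ε ^ 2⌉₊ * (2 * (n * (vertexTime (q ^ N.maxDegree) + 1)) + 28) + 13) ∧
      (μ.map State.output).toOuterMeasure {r : ℂ | ε * N.scale B ≤ ‖N.value - r‖} ≤ 1 / 4 := by
  set K := ⌈8 / ε ^ 2⌉₊ with hK
  have hε2 : 0 < ε ^ 2 := by positivity
  have hK0 : 0 < K := Nat.ceil_pos.2 (by positivity)
  have hKε : 8 ≤ K * ε ^ 2 := by
    rw [← div_le_iff₀ hε2]
    exact Nat.le_ceil _
  have hK' : (0 : ℝ) < K := by exact_mod_cast hK0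
  refine RunsExpect.outer_le (c := ENNReal.ofReal (2 * K)) (by simpa using hK0.ne')
    ENNReal.ofReal_ne_top ?_
  refine RunsExpect.mono (RunsExpect.seq_runs runs_setupProg (τ' :=
    K * (2 * (n * (vertexTime (q ^ N.maxDegree) + 1)) + 27 + 1) + 1 + 1) ?_)
    (by ring_nf; omega) le_rfl
  rintro s ⟨hR, h30, h14⟩
  have htest : ∀ k s, Ready N B ε s → s.nat 30 0 = k → (Test.Holds s
      (.reLT (.mul (.mul (.ofNat (var 30)) (.get 0 (.lit 0))) (.get 0 (.lit 0)))
      (.ofNat (.lit 8))) ↔ k * ε ^ 2 < 8) := by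
    intro k s hR hk
    have h0 : s.num 0 0 = ε := hR.num_zero 0
    simp only [Test.Holds, NumExp.eval, NatExp.eval, hk, h0]
    rw [← Complex.ofReal_natCast, ← Complex.ofReal_mul, ← Complex.ofReal_mul, Complex.ofReal_re,
      mul_assoc, sq]
    norm_num
  have h0 : potential N B ε (0 ≠ 0) 0 ((0 : ℕ) * (N.value / totalNorm N B))
      (2 * (K - (0 : ℕ))) s = ENNReal.ofReal (2 * K) := by
    rw [potential_of_mem hR h30 (fun h => absurd rfl h), h14]
    simp
  have hloop := RunsExpect.loop (P := roundProg)
    (b := .reLT (.mul (.mul (.ofNat (var 30)) (.get 0 (.lit 0))) (.get 0 (.lit 0)))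
      (.ofNat (.lit 8))) (N := K) (τ := 2 * (n * (vertexTime (q ^ N.maxDegree) + 1)) + 27)
    (fun k => potential N B ε (k ≠ 0) k (k * (N.value / totalNorm N B)) (2 * (K - k))) ?_ ?_ s
    (by simpa only [h0] using ENNReal.ofReal_ne_top)
  · rw [h0] at hloop
    refine RunsExpect.seq hloop ENNReal.ofReal_ne_top ?_
    intro s' hs'
    obtain ⟨hR', hk', h9⟩ := mem_of_potential hs'
    refine RunsExpect.of_runs (Runs.setNum (Q := fun t => t = _) rfl) ?_
    rintro _ rfl
    rw [potential_of_mem hR' hk' h9]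
    by_cases hbad : ε * N.scale B ≤ ‖N.value - totalNorm N B * s'.num 14 0 / K‖
    · have hle := le_norm_sub_of_scale_le hK0 hε hq hs hbad
      refine (Set.indicator_le_self _ _ _).trans ?_
      rw [show (4 : ℝ≥0∞) = ENNReal.ofReal 4 by simp, ← ENNReal.ofReal_mul (by norm_num)]
      refine ENNReal.ofReal_le_ofReal ?_
      -- On the bad event the squared deviation is at least `K² ε² ≥ 8 K`, four times the
      -- expectation bound `2 K`.
      have := pow_le_pow_left₀ (by positivity) hle 2
      rw [sub_self, mul_zero, add_zero]
      refine le_trans ?_ this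
      nlinarith
    · rw [Set.indicator_of_notMem]
      · exact zero_le
      · simpa [State.output, NumExp.eval, NatExp.eval, hk', h9 hK0.ne'] using hbad
  · intro k hk s hs'
    obtain ⟨hR', hk', h9⟩ := mem_of_potential hs'
    refine ⟨(htest k s hR' hk').2 ?_, ?_⟩
    · rw [← lt_div_iff₀ hε2]
      exact Nat.lt_ceil.1 hk
    · have hC : (2 * (K - k) : ℝ) = 2 * (K - (k + 1 : ℕ)) + 2 := by
        push_cast
        ring
      have hk1 : ((k + 1 : ℕ) : ℝ) ≤ K := by exact_mod_cast hk
      rw [hC] at hs' ⊢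
      have := runsExpect_roundProg hq hs (by linarith) hs'
      convert this using 2
      · simp
      · push_cast
        ring
  · intro s hs'
    obtain ⟨hR', hk', h9⟩ := mem_of_potential hs'
    rw [htest K s hR' hk', not_lt]
    exact hKε

end QRAM

end

/-! ### Dimensions zero and one, and the final time bound. -/

noncomputable section

namespace QRAM

open State

/-! ### Networks of dimension at most one -/

variable {n m q : ℕ} {N : TensorNetwork (Fin n) (Fin m) q} {B : Fin n ≃ Fin n} {ε : ℝ}

/-- For `q = 0` an edge at a vertex lies in the cut before or after that vertex is swallowed. One of
the two label spaces is then empty, so the swallowing operator is zero and the scale vanishes. -/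
theorem ne_zero_of_scale_pos (hs : 0 < N.scale B) (e : Fin m) : q ≠ 0 := by
  rintro rfl
  refine hs.ne' (Finset.prod_eq_zero (Finset.mem_univ (B.symm (N.end₁ e))) ?_)
  generalize hi : B.symm (N.end₁ e) = i
  have he : e ∈ N.edgesAt (B i) := by simp [TensorNetwork.edgesAt, ← hi]
  have h0 : N.swallowMatrix B i = 0 := by
    ext y x
    by_cases h : e ∈ N.cut B i
    · exact (x ⟨e, h⟩).elim0
    · exact (y ⟨e, (mem_cut_succ N B i e).2 (Or.inr ⟨he, h⟩)⟩).elim0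
  rw [TensorNetwork.swallowOp, h0]
  simp

theorem exists_labeling (hs : 0 < N.scale B) : Nonempty (Fin m → Fin q) := by
  rcases Nat.eq_zero_or_pos q with rfl | hq
  · exact ⟨fun e => absurd rfl (ne_zero_of_scale_pos hs e)⟩
  · exact ⟨fun _ => ⟨0, hq⟩⟩

theorem pow_degree_eq_one (hq : q < 2) (hs : 0 < N.scale B) (v : Fin n) : q ^ N.degree v = 1 := by
  by_cases h0 : q = 0
  · have : N.edgesAt v = ∅ := Finset.eq_empty_of_forall_notMem fun e _ =>
      ne_zero_of_scale_pos hs e h0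
    rw [TensorNetwork.degree, this, Finset.card_empty, pow_zero]
  · obtain rfl : q = 1 := by omega
    exact one_pow _

theorem entryPos_eq (hq : q < 2) (hs : 0 < N.scale B) {i : ℕ} (hi : i ≤ n) :
    entryPos N B i = i := by
  induction i with
  | zero => simp [entryPos]
  | succ i ih =>
    have := entryPos_succ N B ⟨i, hi⟩
    rw [pow_degree_eq_one hq hs, ih (by omega)] at this
    exact this

theorem input_entry_of_lt_two (hq : q < 2) (hs : 0 < N.scale B) (l : Fin m → Fin q) (i : Fin n) :
    (input N B ε).num 1 i = N.tensor (B i) fun e => l e := by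
  have h1 : 0 < q ^ N.degree (B i) := by rw [pow_degree_eq_one hq hs]; exact one_pos
  have := input_entry N B ε i h1
  rw [entryPos_eq hq hs i.2.le, add_zero] at this
  have hsub : Subsingleton (Fin q) := Fin.subsingleton_iff_le_one.2 (by omega)
  rw [this, List.getD_eq_getElem _ _ (by rwa [length_entryList])]
  simp only [entryList, List.getElem_ofFn]
  congr 1
  exact Subsingleton.elim _ _

/-- There is exactly one labeling and each tensor has exactly one entry, so the entry of the `i`-th
vertex sits at position `i`. -/
theorem value_of_lt_two (hq : q < 2) (hs : 0 < N.scale B) :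
    N.value = ∏ i ∈ Finset.range n, (input N B ε).num 1 i := by
  have hsub : Subsingleton (Fin q) := Fin.subsingleton_iff_le_one.2 (by omega)
  obtain ⟨l⟩ := exists_labeling hs
  rw [TensorNetwork.value, Fintype.sum_subsingleton _ l, Finset.prod_range, ← B.prod_comp]
  exact Finset.prod_congr rfl fun i _ => (input_entry_of_lt_two hq hs l i).symm

/-- Multiplies the first entries of the array `1`, one for each vertex. -/
def productProg : Prog :=
  .seq (.setNum 2 (.lit 0) (.ofNat (.lit 1)))
    (forTo 20 (.get 0 (.lit 1))
      (.setNum 2 (.lit 0) (.mul (.get 2 (.lit 0)) (.get 1 (var 20)))))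

theorem runs_productProg : Runs productProg (input N B ε) (n * 3 + 3) fun s =>
    s.output = ∏ i ∈ Finset.range n, (input N B ε).num 1 i := by
  refine Runs.le (Runs.seq (τ := 1) (τ' := n * 3 + 2) (Runs.setNum ?_)) (by omega)
  refine Runs.forTo (τ := 1) n n le_rfl (fun k s => SameOutside [20] [2] (input N B ε) s ∧
    s.nat 20 0 = k ∧ s.num 2 0 = ∏ i ∈ Finset.range k, (input N B ε).num 1 i) ?_ ?_ ?_ ?_
  · exact ⟨SameOutside.setNat (SameOutside.setNum (.refl _ _ _) (by simp)) (by simp), by simp,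
      by simp [NatExp.eval, NumExp.eval]⟩
  · rintro k s ⟨hf, hk, -⟩
    refine ⟨hk, ?_⟩
    rw [NatExp.eval, hf.1 0 (by simp)]
    rfl
  · rintro k hk s ⟨hf, h20, h2⟩
    refine Runs.setNum ⟨by simpa using h20, SameOutside.setNat (SameOutside.setNum hf (by simp))
      (by simp), by simp, ?_⟩
    simp [NatExp.eval, NumExp.eval, h2, h20, Finset.prod_range_succ, hf.2 1]
  · rintro s ⟨-, -, h2⟩
    exact h2

theorem exec_productProg (hq : q < 2) (hs : 0 < N.scale B) (hε : 0 < ε) :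
    ∃ μ, Exec productProg (input N B ε) μ (n * 3 + 3) ∧
      (μ.map State.output).toOuterMeasure {r : ℂ | ε * N.scale B ≤ ‖N.value - r‖} ≤ 1 / 4 := by
  refine RunsExpect.outer_le one_ne_zero ENNReal.one_ne_top
    (RunsExpect.of_runs runs_productProg fun s hs' => ?_)
  rw [Set.indicator_of_notMem]
  · exact zero_le
  · rw [Set.mem_preimage, hs', ← value_of_lt_two hq hs, Set.mem_ofPred_eq, sub_self, norm_zero,
      not_le]
    positivity

/-! ### The algorithm -/

/-- Computes the value if the dimension is at most one, and estimates it otherwise. -/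
def approximationProg : Prog :=
  .cond (.natLT (.get 0 (.lit 0)) (.lit 2)) productProg estimateProg

open Polynomial in
theorem exists_vertexTime_polynomial : ∃ p : ℕ[X], ∀ D, p.eval D = vertexTime D := by
  refine ⟨(X * (X * 3 + 6) + 4) + ((X * 10 + 5) + ((X * (X * (X * 3 + 7) + 7) + 4) +
    ((X * (X * (X * 3 + 7) + 7) + 4) + ((X * 3 + 4) + ((X * (X * (X * 6 + 6) + 9) + 2) +
    (((X * (X * (X * (X * 6 + 12) + 12) + 11) + 5) + (X * (X * 3 + 8) + 4) + (X + 4)) +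
    ((X * (X * (X * 9 + 40) + 40) + 10) + ((X * (X * (X * 6 + 6) + 11) + 2) + 4)))))))),
    fun D => ?_⟩
  simp [vertexTime]

theorem ceil_eight_div_le (x : ℝ) : ⌈8 / x⌉₊ ≤ 8 * ⌈x⁻¹⌉₊ := by
  refine Nat.ceil_le.2 ?_
  push_cast
  rw [div_eq_mul_inv]
  gcongr
  exact Nat.le_ceil _

/-- The factor `16` comes from `⌈8/ε²⌉ ≤ 8 ⌈1/ε²⌉` and two samples a round. The remaining terms
amount to at most `16 + 224 + 14` times `n * ⌈1/ε²⌉`, which is at least 1, so `300` suffices. -/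
theorem exec_approximationProg (hn : 0 < n) (hε : 0 < ε) (hs : 0 < N.scale B) :
    ∃ μ, Exec approximationProg (input N B ε) μ
        (n * ⌈(ε ^ 2)⁻¹⌉₊ * (16 * vertexTime (q ^ N.maxDegree) + 300)) ∧
      (μ.map State.output).toOuterMeasure {r : ℂ | ε * N.scale B ≤ ‖N.value - r‖} ≤ 1 / 4 := by
  have hc : 0 < ⌈(ε ^ 2)⁻¹⌉₊ := Nat.ceil_pos.2 (by positivity)
  have hnc : 0 < n * ⌈(ε ^ 2)⁻¹⌉₊ := Nat.mul_pos hn hc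
  rcases lt_or_ge q 2 with hq | hq
  · obtain ⟨μ, h1, h2⟩ := exec_productProg hq hs hε
    refine ⟨μ, .weaken _ _ _ _ _ ?_ (.cond_true _ _ _ _ _ _ hq h1), h2⟩
    nlinarith [Nat.zero_le (vertexTime (q ^ N.maxDegree) * (n * ⌈(ε ^ 2)⁻¹⌉₊)),
      Nat.le_mul_of_pos_right n hc]
  · obtain ⟨μ, h1, h2⟩ := exec_estimateProg hq hs hε
    refine ⟨μ, .weaken _ _ _ _ _ ?_ (.cond_false _ _ _ _ _ _ (not_lt.2 hq) h1), h2⟩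
    have h3 := Nat.mul_le_mul_right (2 * (n * (vertexTime (q ^ N.maxDegree) + 1)) + 28)
      (ceil_eight_div_le (ε ^ 2))
    have h4 := Nat.le_mul_of_pos_left ⌈(ε ^ 2)⁻¹⌉₊ hn
    generalize ⌈8 / ε ^ 2⌉₊ = K at h3 ⊢
    generalize ⌈(ε ^ 2)⁻¹⌉₊ = c at h3 h4 hnc ⊢
    generalize vertexTime _ = T at h3 ⊢
    nlinarith

end QRAM

end

/-- One program and one polynomial serve for all tensor networks, bubblings and error parameters. -/
theorem theorem1 :
    ∃ (P : QRAM.Prog) (p : Polynomial ℕ),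
      ∀ (q n m : ℕ) (N : TensorNetwork (Fin n) (Fin m) q) (B : Fin n ≃ Fin n) (ε : ℝ),
        0 < n → 0 < ε → 0 < N.scale B →
        ∃ μ : PMF QRAM.State,
          QRAM.Exec P (QRAM.input N B ε) μ
            (n * ⌈(ε ^ 2)⁻¹⌉₊ * p.eval (q ^ N.maxDegree)) ∧
          (μ.map QRAM.State.output).toOuterMeasure
            {r : ℂ | ε * N.scale B ≤ ‖N.value - r‖} ≤ 1 / 4 := by
  obtain ⟨p, hp⟩ := QRAM.exists_vertexTime_polynomial
  refine ⟨QRAM.approximationProg, 16 * p + 300, fun q n m N B ε hn hε hs => ?_⟩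
  obtain ⟨μ, h1, h2⟩ := QRAM.exec_approximationProg hn hε hs
  refine ⟨μ, ?_, h2⟩
  simpa [hp] using h1
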